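/- Let $K=\mathbb{Q}(i\sqrt7)$, $\mathcal{O}_7$ its ring of integers, $\tau=\frac{1+i\sqrt7}{2}$, $J=\begin{pmatrix}0&0&1\\0&1&0\\1&0&0\end{pmatrix}$ and $\langle v,w\rangle=w^*Jv$ for $v,w\in\mathbb{C}^3$. The complex hyperbolic plane $H^2_{\mathbb{C}}$ is the set of complex lines $[v]$ spanned by vectors $v\in\mathbb C^3$ with $\langle v,v\rangle<0$. Let $\Gamma=PU(J,\mathcal{O}_7)$ be the image in $PGL(3,\mathbb{C})$ of $U(J)\cap GL(3,\mathcal{O}_7)$; it acts on $H^2_{\mathbb C}$. A complex line of $H^2_{\mathbb C}$ is the set $v^\perp\cap H^2_{\mathbb C}$ for some $v$ with $\langle v,v\rangle>0$ (it is polar to $v$); a complex reflection in $\Gamma$ is a nontrivial element that fixes a complex line (its mirror) pointwise. A vector in $\mathcal{O}_7^3$ is primitive if the only common divisors of its entries are units. For $j=1,2$, a $j$-line is a complex line polar to a primitive vector $v$ with $\langle v,v\rangle=j$. Let $$R=\begin{pmatrix}1&0&0\\0&-1&0\\0&0&1\end{pmatrix},\quad I=\begin{pmatrix}0&0&1\\0&-1&0\\1&0&0\end{pmatrix},\quad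 T_1=\begin{pmatrix}1&-1&\frac{-1+i\sqrt7}{2}\\0&1&1\\0&0&1\end{pmatrix}.$$ (1) There are exactly two conjugacy classes of complex reflections in $\Gamma$, represented by $R$ and $I$, both of order $2$. The fixed point set of $R$ in $H^2_{\mathbb{C}}$ is the complex line polar to the primitive vector $(0,1,0)$, of square norm $1$; that of $I$ is the complex line polar to the primitive vector $(1,0,1)$, of square norm $2$. (2) Each of the ten elements $g$ of $\Gamma$ in the following table (words in $R,I,T_1$; the matrix given represents the word up to a scalar) has the order stated and exactly one fixed point in $H^2_{\mathbb{C}}$. The table gives a primitive vector $v\in\mathcal O_7^3$ spanning the fixed point together with $\langle v,v\rangle$, or states that the fixed point is not spanned by any vector of $K^3$; then the order of the stabilizer of the fixed point in $\Gamma$ and the numbers of $1$-lines and of $2$-lines through the fixed point. $$\begin{array}{c|l|c|c|c|c|c|c|c} & g & \text{matrix} & \text{order} & v & \langle v,v\rangle & |\mathrm{Stab}| & \text{1-lines} & \text{2-lines}\\ \hline g_1&(RT_1IT_1^{-1})^2 & \begin{pmatrix} i\sqrt7&0&4\\0&1&0\\2&0&-i\sqrt7\end{pmatrix}&2&(-\bar\tau,0,1)&-1&8&2&2\\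 g_2&IR&\begin{pmatrix}0&0&1\\0&1&0\\1&0&0\end{pmatrix}&2&(-1,0,1)&-2&4&1&1\\ g_3&T_1^2I(T_1^{-1}I)^2T_1^2I&\begin{pmatrix}-\bar\tau&\tau&2\\\tau&2&\bar\tau\\2&\bar\tau&-\tau\end{pmatrix}&2&(\tau,1,\bar\tau)&-2&8&0&4\\ g_4&T_1(IT_1^{-1})^2(IT_1)^2&\begin{pmatrix}-1&\tau&1\\-\bar\tau&1&0\\1&0&0\end{pmatrix}&3&(\tau,1,-\tau)&-3&6&0&3\\ g_5&T_1^2(IT_1^{-1})^2(IT_1)^2&\begin{pmatrix}-1&-\bar\tau&1\\\tau&1&0\\1&0&0\end{pmatrix}&3&(-\bar\tau,1,\bar\tau)&-3&6&0&3\\ g_6&(RT_1)^2IT_1IT_1^{-1}RT_1IT_1^{-1}&\begin{pmatrix}5&0&-3i\sqrt7\\0&-1&0\\-i\sqrt7&0&-4\end{pmatrix}&3&\notin K^3&&6&1&0\\ g_7&IT_1^{-1}RT_1&\begin{pmatrix}0&0&1\\0&1&2\\1&-2&-2\end{pmatrix}&4&(-1,-1,1)&-1&8&2&2\\ g_8&(T_1^{-1}I)^2(T_1I)^2&\begin{pmatrix}0&0&1\\0&1&1+\bar\tau\\1&-1-\tau&-2\end{pmatrix}&4&(\bar\tau,-\tau,-\bar\tau)&-2&8&0&4\\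 g_9&T_1R(T_1I)^2T_1^{-1}RT_1IT_1^{-1}&\begin{pmatrix}-5&0&3i\sqrt7\\0&-1&0\\i\sqrt7&0&4\end{pmatrix}&6&\notin K^3&&6&1&0\\ g_{10}&IRT_1&\begin{pmatrix}0&0&1\\0&1&1\\1&-1&-\bar\tau\end{pmatrix}&7&\notin K^3&&7&0&0 \end{array}$$ The four $2$-lines through the fixed point of $g_8$ form two orbits of two lines each under the stabilizer of that point. (3) For every element $\gamma\in\Gamma$ of finite order that has an isolated fixed point in $H^2_{\mathbb{C}}$, there is exactly one $k\in\{1,\dots,10\}$ such that the cyclic group $\langle\gamma\rangle$ is conjugate in $\Gamma$ to $\langle g_k\rangle$. In other words, up to conjugation and up to replacing an element by another generator of the cyclic group it generates, the torsion elements with an isolated fixed point form exactly ten classes: three of order $2$, three of order $3$, two of order $4$, one of order $6$ and one of order $7$. (4) The stabilizers in $\Gamma$ of the ten fixed points in the table are maximal finite subgroups of $\Gamma$, and every maximal finite subgroup of $\Gamma$ is conjugate to one of them. The stabilizers of the fixed points of $g_1$ and $g_7$ are conjugate, as are those of $g_3$ and $g_8$, and those of $g_6$ and $g_9$; there are no other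 conjugacies between the ten stabilizers, so there are exactly seven conjugacy classes of maximal finite subgroups, of orders $8,4,8,6,6,6,7$. -/

import Mathlib

open Matrix
open scoped LinearAlgebra.Projectivization

namespace Picard7

noncomputable section

/-! ### The field `ℚ(i√7)` and its ring of integers -/

/-- The number `i√7`. -/
def s7 : ℂ := Complex.I * (Real.sqrt 7 : ℝ)

/-- The number `τ = (1 + i√7)/2`. -/
def tau : ℂ := (1 + s7) / 2

/-- The conjugate `(1 - i√7)/2` of `τ`. -/
def tauBar : ℂ := (1 - s7) / 2

/-- The field `K = ℚ(i√7)`, inside `ℂ`. -/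
def K7 : IntermediateField ℚ ℂ := IntermediateField.adjoin ℚ {s7}

/-- The ring `𝒪₇` of algebraic integers in `ℚ(i√7)`, inside `ℂ`. -/
def O7 : Subring ℂ := K7.toSubfield.toSubring ⊓ (integralClosure ℤ ℂ).toSubring

theorem s7_sq : s7 ^ 2 = -7 := by
  unfold s7
  rw [mul_pow, Complex.I_sq, ← Complex.ofReal_pow, Real.sq_sqrt (by norm_num)]
  norm_num

theorem tau_mem_O7 : tau ∈ O7 := by
  constructor
  · have h : s7 ∈ K7 := IntermediateField.subset_adjoin ℚ _ (Set.mem_singleton s7)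
    have h2 : (2 : ℂ) ∈ K7 := ofNat_mem K7 2
    exact K7.div_mem (K7.add_mem K7.one_mem h) h2
  · change IsIntegral ℤ tau
    refine ⟨Polynomial.X ^ 2 - Polynomial.X + Polynomial.C 2, by monicity!, ?_⟩
    have h := s7_sq
    simp only [Polynomial.eval₂_add, Polynomial.eval₂_sub, Polynomial.eval₂_X_pow,
      Polynomial.eval₂_X, Polynomial.eval₂_C, tau]
    norm_num
    linear_combination h / 4

/-! ### The Hermitian form and the Picard modular group -/

/-- The Hermitian matrix `J`, of signature `(2,1)`. -/
def formJ : Matrix (Fin 3) (Fin 3) ℂ := !![0, 0, 1; 0, 1, 0; 1, 0, 0]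

/-- The Hermitian form `⟨v, w⟩ = w* J v`. -/
def herm (v w : Fin 3 → ℂ) : ℂ := star w ⬝ᵥ (formJ *ᵥ v)

/-- The unitary group `U(J)`. -/
def UJ : Subgroup (GL (Fin 3) ℂ) where
  carrier := {A | (A : Matrix (Fin 3) (Fin 3) ℂ)ᴴ * formJ * (A : Matrix (Fin 3) (Fin 3) ℂ) = formJ}
  one_mem' := by simp
  mul_mem' := by
    intro A B hA hB
    simp only [Set.mem_ofPred_eq, Units.val_mul, conjTranspose_mul] at hA hB ⊢
    calc _ = (B : Matrix (Fin 3) (Fin 3) ℂ)ᴴ *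
          ((A : Matrix (Fin 3) (Fin 3) ℂ)ᴴ * formJ * (A : Matrix (Fin 3) (Fin 3) ℂ)) *
          (B : Matrix (Fin 3) (Fin 3) ℂ) := by simp only [Matrix.mul_assoc]
      _ = formJ := by rw [hA, hB]
  inv_mem' := by
    intro A hA
    simp only [Set.mem_ofPred_eq] at hA ⊢
    have h1 : (A : Matrix (Fin 3) (Fin 3) ℂ) * (A⁻¹ : GL (Fin 3) ℂ).val = 1 := by
      rw [← Units.val_mul, mul_inv_cancel, Units.val_one]
    have h2 : (A⁻¹ : GL (Fin 3) ℂ).valᴴ * (A : Matrix (Fin 3) (Fin 3) ℂ)ᴴ = 1 := by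
      rw [← conjTranspose_mul, h1, conjTranspose_one]
    calc _ = (A⁻¹ : GL (Fin 3) ℂ).valᴴ * ((A : Matrix (Fin 3) (Fin 3) ℂ)ᴴ * formJ *
          (A : Matrix (Fin 3) (Fin 3) ℂ)) * (A⁻¹ : GL (Fin 3) ℂ).val := by rw [hA]
      _ = ((A⁻¹ : GL (Fin 3) ℂ).valᴴ * (A : Matrix (Fin 3) (Fin 3) ℂ)ᴴ) * formJ *
          ((A : Matrix (Fin 3) (Fin 3) ℂ) * (A⁻¹ : GL (Fin 3) ℂ).val) := by
            simp only [Matrix.mul_assoc]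
      _ = formJ := by rw [h1, h2, Matrix.one_mul, Matrix.mul_one]

/-- `U(J, 𝒪₇) = U(J) ∩ GL(3, 𝒪₇)`. -/
def UJO7 : Subgroup (GL (Fin 3) ℂ) :=
  UJ ⊓ (GeneralLinearGroup.map (n := Fin 3) O7.subtype).range

/-- The Picard modular group `Γ = PU(J, 𝒪₇)`: the image of `U(J, 𝒪₇)` in `PGL(3, ℂ)`. As a subgroup
of `PGL(3, ℂ)` it acts on the projective plane `ℙ ℂ (Fin 3 → ℂ)`. -/
def PicardGroup : Subgroup (ProjGenLinGroup (Fin 3) ℂ) := UJO7.map ProjGenLinGroup.mk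

/-- The projective class of the matrix `M` is the element `γ` of `Γ`. -/
def RepresentedBy (γ : PicardGroup) (M : Matrix (Fin 3) (Fin 3) ℂ) : Prop :=
  ∃ A : GL (Fin 3) ℂ, A.val = M ∧ ProjGenLinGroup.mk A = (γ : ProjGenLinGroup (Fin 3) ℂ)

/-- The element of `Γ` represented by a matrix with entries in `𝒪₇` that preserves `J` and has
inverse `N` with entries in `𝒪₇`. -/
def ofMatrix (M N : Matrix (Fin 3) (Fin 3) O7) (h : M * N = 1) (h' : N * M = 1)
    (hM : (M.map O7.subtype)ᴴ * formJ * M.map O7.subtype = formJ) : PicardGroup :=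
  ⟨ProjGenLinGroup.mk (GeneralLinearGroup.map O7.subtype ⟨M, N, h, h'⟩),
    Subgroup.mem_map_of_mem _ ⟨hM, ⟨_, rfl⟩⟩⟩

/-- `τ` as an element of `𝒪₇`. -/
def tauO : O7 := ⟨tau, tau_mem_O7⟩

/-- `R = diag(1, -1, 1)`. -/
def R : PicardGroup :=
  ofMatrix !![1, 0, 0; 0, -1, 0; 0, 0, 1] !![1, 0, 0; 0, -1, 0; 0, 0, 1]
    (by ext i j; fin_cases i <;> fin_cases j <;> simp [Matrix.mul_apply, Fin.sum_univ_three])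
    (by ext i j; fin_cases i <;> fin_cases j <;> simp [Matrix.mul_apply, Fin.sum_univ_three])
    (by ext i j; fin_cases i <;> fin_cases j <;>
          simp [Matrix.mul_apply, Fin.sum_univ_three, formJ])

/-- The involution `I`, with rows `(0, 0, 1)`, `(0, -1, 0)`, `(1, 0, 0)`. -/
def I : PicardGroup :=
  ofMatrix !![0, 0, 1; 0, -1, 0; 1, 0, 0] !![0, 0, 1; 0, -1, 0; 1, 0, 0]
    (by ext i j; fin_cases i <;> fin_cases j <;> simp [Matrix.mul_apply, Fin.sum_univ_three])
    (by ext i j; fin_cases i <;> fin_cases j <;> simp [Matrix.mul_apply, Fin.sum_univ_three])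
    (by ext i j; fin_cases i <;> fin_cases j <;>
          simp [Matrix.mul_apply, Fin.sum_univ_three, formJ])

theorem star_tau : (starRingEnd ℂ) tau = 1 - tau := by
  simp only [tau, s7, map_div₀, map_add, map_mul, map_one, Complex.conj_I, Complex.conj_ofReal]
  rw [Complex.conj_ofNat]
  ring

/-- The Heisenberg translation `T₁ = T(1, √7)`; its upper right entry is
`τ - 1 = (-1 + i√7)/2`. -/
def T₁ : PicardGroup :=
  ofMatrix !![1, -1, tauO - 1; 0, 1, 1; 0, 0, 1] !![1, 1, -tauO; 0, 1, -1; 0, 0, 1]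
    (by ext i j; fin_cases i <;> fin_cases j <;> simp [Matrix.mul_apply, Fin.sum_univ_three])
    (by ext i j; fin_cases i <;> fin_cases j <;> simp [Matrix.mul_apply, Fin.sum_univ_three])
    (by
      ext i j
      fin_cases i <;> fin_cases j <;>
        simp [Matrix.mul_apply, Fin.sum_univ_three, formJ, tauO, star_tau])

/-! ### The complex hyperbolic plane -/

/-- The complex projective plane. -/
abbrev P2 : Type := ℙ ℂ (Fin 3 → ℂ)

/-- The vector `v` spans the complex line `p`. -/
def Spans (v : Fin 3 → ℂ) (p : P2) : Prop := ∃ hv : v ≠ 0, Projectivization.mk ℂ v hv = p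

/-- The complex hyperbolic plane: the complex lines spanned by a negative vector. -/
def H2 : Set P2 := {p | ∃ v, (herm v v).re < 0 ∧ Spans v p}

/-- The distance in the complex hyperbolic plane, given by
`cosh (d([v],[w]) / 2) = |⟨v, w⟩| / √(⟨v, v⟩ ⟨w, w⟩)` (independent of the representatives). -/
def hdist (p q : P2) : ℝ :=
  2 * Real.arcosh
    (‖herm p.rep q.rep‖ / Real.sqrt ((herm p.rep p.rep).re * (herm q.rep q.rep).re))

/-- The set of fixed points of `γ` in the complex hyperbolic plane. -/
def fixedSet (γ : PicardGroup) : Set P2 := {p | p ∈ H2 ∧ γ • p = p}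

/-- `p` is an isolated point of the set of fixed points of `γ` in the complex hyperbolic plane. -/
def IsIsolatedFixedPoint (γ : PicardGroup) (p : P2) : Prop :=
  p ∈ fixedSet γ ∧ ∃ ε > 0, ∀ q ∈ fixedSet γ, hdist p q < ε → q = p

/-- The set of points of the complex hyperbolic plane orthogonal to `v`; for a positive vector `v`
this is the complex line polar to `v`. -/
def polarLine (v : Fin 3 → ℂ) : Set P2 := {p | p ∈ H2 ∧ ∀ w, Spans w p → herm w v = 0}

/-- A complex reflection: a nontrivial element that fixes pointwise a complex line of the complex
hyperbolic plane. -/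
def IsComplexReflection (γ : PicardGroup) : Prop :=
  γ ≠ 1 ∧ ∃ v, 0 < (herm v v).re ∧ polarLine v ⊆ fixedSet γ

/-- `v` has entries in `𝒪₇` whose only common divisors in `𝒪₇` are the units. -/
def IsPrimitive (v : Fin 3 → ℂ) : Prop :=
  (∀ i, v i ∈ O7) ∧
    ∀ d ∈ O7, (∀ i, ∃ x ∈ O7, v i = d * x) → ∃ e ∈ O7, d * e = 1

/-- A `j`-line: a complex line polar to a primitive vector `v` with `⟨v, v⟩ = j`. -/
def IsJLine (j : ℕ) (L : Set P2) : Prop :=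
  ∃ v, IsPrimitive v ∧ herm v v = j ∧ L = polarLine v

/-- The set of `j`-lines through `p`. -/
def jLinesThrough (j : ℕ) (p : P2) : Set (Set P2) := {L | IsJLine j L ∧ p ∈ L}

/-- The orbit of the subset `L` under the stabilizer of `p` in `Γ`. -/
def stabOrbit (p : P2) (L : Set P2) : Set (Set P2) :=
  {L' | ∃ g ∈ MulAction.stabilizer PicardGroup p, L' = (fun q => g • q) '' L}

/-- `p` is represented by a vector with entries in `K = ℚ(i√7)`. -/
def IsKRational (p : P2) : Prop := ∃ v, (∀ i, v i ∈ K7) ∧ Spans v p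

/-! ### Subgroups up to conjugacy -/

/-- Two subgroups of `Γ` are conjugate in `Γ`. -/
def ConjSubgroups (H H' : Subgroup PicardGroup) : Prop :=
  ∃ g : PicardGroup, H.map (MulAut.conj g).toMonoidHom = H'

/-- A finite subgroup of `Γ` that is maximal among the finite subgroups. -/
def IsMaximalFinite (H : Subgroup PicardGroup) : Prop :=
  Maximal (fun H' : Subgroup PicardGroup => Finite H') H

/-! ### The table of elements with an isolated fixed point -/

/-- A row of the table. The entry `fixedVec` is `some (v, k)` if the fixed point is spanned by the
primitive vector `v` with `⟨v, v⟩ = k`, and `none` if the fixed point is not `K`-rational. -/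
structure Row where
  /-- the element of `Γ`, as a word in `R`, `I`, `T₁` -/
  elt : PicardGroup
  /-- a matrix that represents it -/
  mat : Matrix (Fin 3) (Fin 3) ℂ
  /-- its order -/
  ord : ℕ
  /-- its fixed point -/
  fixedVec : Option ((Fin 3 → ℂ) × ℤ)
  /-- the order of the stabilizer of the fixed point -/
  stabOrd : ℕ
  /-- the number of 1-lines through the fixed point -/
  lines₁ : ℕ
  /-- the number of 2-lines through the fixed point -/
  lines₂ : ℕ

/-- The ten rows of the table. -/
def table : Fin 10 → Row := ![
  { elt := (R * T₁ * I * T₁⁻¹) ^ 2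
    mat := !![s7, 0, 4; 0, 1, 0; 2, 0, -s7]
    ord := 2, fixedVec := some (![-tauBar, 0, 1], -1), stabOrd := 8, lines₁ := 2, lines₂ := 2 },
  { elt := I * R
    mat := !![0, 0, 1; 0, 1, 0; 1, 0, 0]
    ord := 2, fixedVec := some (![-1, 0, 1], -2), stabOrd := 4, lines₁ := 1, lines₂ := 1 },
  { elt := T₁ ^ 2 * I * (T₁⁻¹ * I) ^ 2 * T₁ ^ 2 * I
    mat := !![-tauBar, tau, 2; tau, 2, tauBar; 2, tauBar, -tau]
    ord := 2, fixedVec := some (![tau, 1, tauBar], -2), stabOrd := 8, lines₁ := 0, lines₂ := 4 },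
  { elt := T₁ * (I * T₁⁻¹) ^ 2 * (I * T₁) ^ 2
    mat := !![-1, tau, 1; -tauBar, 1, 0; 1, 0, 0]
    ord := 3, fixedVec := some (![tau, 1, -tau], -3), stabOrd := 6, lines₁ := 0, lines₂ := 3 },
  { elt := T₁ ^ 2 * (I * T₁⁻¹) ^ 2 * (I * T₁) ^ 2
    mat := !![-1, -tauBar, 1; tau, 1, 0; 1, 0, 0]
    ord := 3, fixedVec := some (![-tauBar, 1, tauBar], -3), stabOrd := 6, lines₁ := 0,
    lines₂ := 3 },
  { elt := (R * T₁) ^ 2 * I * T₁ * I * T₁⁻¹ * R * T₁ * I * T₁⁻¹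
    mat := !![5, 0, -3 * s7; 0, -1, 0; -s7, 0, -4]
    ord := 3, fixedVec := none, stabOrd := 6, lines₁ := 1, lines₂ := 0 },
  { elt := I * T₁⁻¹ * R * T₁
    mat := !![0, 0, 1; 0, 1, 2; 1, -2, -2]
    ord := 4, fixedVec := some (![-1, -1, 1], -1), stabOrd := 8, lines₁ := 2, lines₂ := 2 },
  { elt := (T₁⁻¹ * I) ^ 2 * (T₁ * I) ^ 2
    mat := !![0, 0, 1; 0, 1, 1 + tauBar; 1, -1 - tau, -2]
    ord := 4, fixedVec := some (![tauBar, -tau, -tauBar], -2), stabOrd := 8, lines₁ := 0,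
    lines₂ := 4 },
  { elt := T₁ * R * (T₁ * I) ^ 2 * T₁⁻¹ * R * T₁ * I * T₁⁻¹
    mat := !![-5, 0, 3 * s7; 0, -1, 0; s7, 0, 4]
    ord := 6, fixedVec := none, stabOrd := 6, lines₁ := 1, lines₂ := 0 },
  { elt := I * R * T₁
    mat := !![0, 0, 1; 0, 1, 1; 1, -1, -tauBar]
    ord := 7, fixedVec := none, stabOrd := 7, lines₁ := 0, lines₂ := 0 }]

/-- The description of the fixed point in the row is correct for the point `p`. -/
def FixedVecCorrect (p : P2) : Option ((Fin 3 → ℂ) × ℤ) → Prop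
  | some (v, k) => IsPrimitive v ∧ Spans v p ∧ herm v v = k
  | none => ¬ IsKRational p

/-- All entries of the row are correct, the fixed point of the element being `p`. -/
def Row.IsCorrect (r : Row) (p : P2) : Prop :=
  RepresentedBy r.elt r.mat ∧ orderOf r.elt = r.ord ∧ fixedSet r.elt = {p} ∧
    IsIsolatedFixedPoint r.elt p ∧ FixedVecCorrect p r.fixedVec ∧
    Nat.card (MulAction.stabilizer PicardGroup p) = r.stabOrd ∧
    (jLinesThrough 1 p).encard = r.lines₁ ∧ (jLinesThrough 2 p).encard = r.lines₂

/-- Labels `0, …, 6` of the conjugacy classes of the stabilizers of the ten fixed points. -/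
def stabClass : Fin 10 → Fin 7 := ![0, 1, 2, 3, 4, 5, 0, 2, 5, 6]

end

end Picard7

namespace Picard7

noncomputable section

/-! ### The ring `ℤ[τ]` -/

/-- The ring `ℤ[τ]` with `τ² = τ - 2`. -/
abbrev O := QuadraticAlgebra ℤ (-2) 1

theorem O.norm_eq (z : O) : z.norm = z.re ^ 2 + z.re * z.im + 2 * z.im ^ 2 := by
  rw [QuadraticAlgebra.norm_def]; ring

theorem O.mul_star (z : O) : z * star z = (z.norm : ℤ) := by
  ext
  · rw [QuadraticAlgebra.re_intCast, O.norm_eq]; simp; ring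
  · rw [QuadraticAlgebra.im_intCast]; simp; ring

theorem O.norm_nonneg (z : O) : 0 ≤ z.norm := by
  rw [O.norm_eq]; nlinarith [sq_nonneg (2 * z.re + z.im), sq_nonneg z.im]

theorem O.norm_eq_zero {z : O} : z.norm = 0 ↔ z = 0 := by
  constructor
  · intro h
    rw [O.norm_eq] at h
    have h1 : z.im = 0 := by
      have : z.im ^ 2 = 0 := by nlinarith [sq_nonneg (2 * z.re + z.im), sq_nonneg z.im]
      simpa using this
    have h2 : z.re = 0 := by
      rw [h1] at h; simpa using h
    ext <;> simp [h1, h2]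
  · rintro rfl; simp

theorem O.norm_pos {z : O} (h : z ≠ 0) : 0 < z.norm :=
  lt_of_le_of_ne (O.norm_nonneg z) fun h' => h (O.norm_eq_zero.1 h'.symm)

instance : IsDomain O := by
  have : NoZeroDivisors O := ⟨by
    intro a b h
    have : a.norm * b.norm = 0 := by rw [← map_mul, h, QuadraticAlgebra.norm_zero]
    rcases mul_eq_zero.1 this with h | h
    · exact .inl (O.norm_eq_zero.1 h)
    · exact .inr (O.norm_eq_zero.1 h)⟩
  exact NoZeroDivisors.to_isDomain _

theorem O.norm_intCast (n : ℤ) : ((n : O)).norm = n ^ 2 := QuadraticAlgebra.norm_intCast n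

/-- Rounding an element of `ℤ[τ] / n`. -/
theorem O.exists_round (z : O) {n : ℤ} (hn : 0 < n) : ∃ q : O, 7 * (z - q * n).norm ≤ 4 * n ^ 2 := by
  -- first make `2 * |im| ≤ n`, then reduce `re + im / 2`
  obtain ⟨k, hk⟩ : ∃ k : ℤ, |2 * (z.im - k * n)| ≤ n := by
    refine ⟨(2 * z.im + n) / (2 * n), ?_⟩
    have h1 := Int.emod_nonneg (2 * z.im + n) (by positivity : (2 * n) ≠ 0)
    have h2 := Int.emod_lt_of_pos (2 * z.im + n) (by positivity : 0 < 2 * n)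
    have h3 := Int.mul_ediv_add_emod (2 * z.im + n) (2 * n)
    rw [abs_le]
    constructor <;> nlinarith
  obtain ⟨l, hl⟩ : ∃ l : ℤ, |2 * (z.re - l * n) + (z.im - k * n)| ≤ n := by
    refine ⟨(2 * z.re + (z.im - k * n) + n) / (2 * n), ?_⟩
    have h1 := Int.emod_nonneg (2 * z.re + (z.im - k * n) + n) (by positivity : (2 * n) ≠ 0)
    have h2 := Int.emod_lt_of_pos (2 * z.re + (z.im - k * n) + n) (by positivity : 0 < 2 * n)
    have h3 := Int.mul_ediv_add_emod (2 * z.re + (z.im - k * n) + n) (2 * n)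
    rw [abs_le]
    constructor <;> nlinarith
  -- the sharp bound needs a case distinction on the imaginary part
  obtain ⟨k', l', h1, h2⟩ : ∃ k' l' : ℤ, ∃ x y : ℤ, x = z.re - l' * n ∧ y = z.im - k' * n ∧
      7 * (x ^ 2 + x * y + 2 * y ^ 2) ≤ 4 * n ^ 2 := by
    set x := z.re - l * n with hx
    set y := z.im - k * n with hy
    rw [abs_le] at hk hl
    have key : ∀ X y : ℤ, 0 ≤ X → X ≤ n → 0 ≤ y → 2 * y ≤ n → 16 * n ^ 2 < 7 * (X ^ 2 + 7 * y ^ 2) →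
        7 * ((X - n) ^ 2 + 7 * (y - n) ^ 2) ≤ 16 * n ^ 2 := by
      intro X y h0 h1 h2 h4 h5
      have h3 : 3 * n < 7 * y := by nlinarith
      have hs : 5 * n < 7 * X := by nlinarith
      nlinarith [mul_nonneg (sub_nonneg.2 h1) (sub_nonneg.2 hs.le), mul_pos hn hn,
        mul_nonneg (sub_nonneg.2 h4) (sub_nonneg.2 h3.le), mul_nonneg hn.le (sub_nonneg.2 h1),
        mul_nonneg hn.le (sub_nonneg.2 h3.le)]
    by_cases hgood : 7 * (x ^ 2 + x * y + 2 * y ^ 2) ≤ 4 * n ^ 2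
    · exact ⟨k, l, x, y, rfl, rfl, hgood⟩
    · push Not at hgood
      have hb : 16 * n ^ 2 < 7 * ((2 * x + y) ^ 2 + 7 * y ^ 2) := by nlinarith
      rcases le_total 0 (2 * x + y) with h | h <;> rcases le_total 0 y with h' | h'
      · have := key (2 * x + y) y h hl.2 h' hk.2 hb
        exact ⟨k + 1, l, x, y - n, rfl, by rw [hy]; ring, by nlinarith⟩
      · have := key (2 * x + y) (-y) h hl.2 (by linarith) (by linarith) (by nlinarith)
        exact ⟨k - 1, l + 1, x - n, y + n, by rw [hx]; ring, by rw [hy]; ring, by nlinarith⟩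
      · have := key (-(2 * x + y)) y (by linarith) (by linarith) h' hk.2 (by nlinarith)
        exact ⟨k + 1, l - 1, x + n, y - n, by rw [hx]; ring, by rw [hy]; ring, by nlinarith⟩
      · have := key (-(2 * x + y)) (-y) (by linarith) (by linarith) (by linarith) (by linarith)
          (by nlinarith)
        exact ⟨k - 1, l, x, y + n, rfl, by rw [hy]; ring, by nlinarith⟩
  obtain ⟨y, rfl, rfl, h⟩ := h2
  refine ⟨⟨l', k'⟩, ?_⟩
  rw [O.norm_eq]
  simpa using h

theorem O.exists_div (a : O) {b : O} (hb : b ≠ 0) : ∃ q : O, 7 * (a - q * b).norm ≤ 4 * b.norm := by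
  obtain ⟨q, hq⟩ := O.exists_round (a * star b) (O.norm_pos hb)
  refine ⟨q, ?_⟩
  have h1 : a * star b - q * (b.norm : ℤ) = (a - q * b) * star b := by
    rw [← O.mul_star]; ring
  rw [h1, map_mul, QuadraticAlgebra.norm_star] at hq
  have := O.norm_pos hb
  nlinarith

instance : EuclideanDomain O where
  quotient a b := if h : b = 0 then 0 else (O.exists_div a h).choose
  quotient_zero a := by simp
  remainder a b := if h : b = 0 then a else a - (O.exists_div a h).choose * b
  quotient_mul_add_remainder_eq a b := by
    by_cases h : b = 0
    · simp [h]
    · simp [h]; ring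
  r a b := a.norm.natAbs < b.norm.natAbs
  r_wellFounded := (measure fun a : O => a.norm.natAbs).wf
  remainder_lt a b hb := by
    simp only [hb, dite_false]
    have h1 := (O.exists_div a hb).choose_spec
    have h2 := O.norm_pos hb
    have h3 := O.norm_nonneg (a - (O.exists_div a hb).choose * b)
    omega
  mul_left_not_lt a b hb := by
    rw [not_lt, map_mul, Int.natAbs_mul]
    have h2 := O.norm_pos hb
    exact Nat.le_mul_of_pos_right _ (by omega)

theorem O.exists_bezout (a b : O) : ∃ g a' b' s t : O, a = g * a' ∧ b = g * b' ∧
    s * a' + t * b' = 1 := by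
  by_cases h : a = 0 ∧ b = 0
  · exact ⟨0, 1, 0, 1, 0, by simp [h.1], by simp [h.2], by simp⟩
  · have hg : EuclideanDomain.gcd a b ≠ 0 := fun h' => h (EuclideanDomain.gcd_eq_zero_iff.1 h')
    obtain ⟨a', ha⟩ := EuclideanDomain.gcd_dvd_left a b
    obtain ⟨b', hb⟩ := EuclideanDomain.gcd_dvd_right a b
    refine ⟨_, a', b', EuclideanDomain.gcdA a b, EuclideanDomain.gcdB a b, ha, hb, ?_⟩
    have h1 := EuclideanDomain.gcd_eq_gcd_ab a b
    generalize EuclideanDomain.gcd a b = g at *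
    apply mul_left_cancel₀ hg
    linear_combination -h1 - EuclideanDomain.gcdA a b * ha - EuclideanDomain.gcdB a b * hb

theorem O.norm_le_one {z : O} (h : z.norm ≤ 1) : z ∈ ({0, 1, -1} : Finset O) := by
  rw [O.norm_eq] at h
  have h1 : z.im = 0 := by
    have : z.im ^ 2 < 1 := by nlinarith [sq_nonneg (2 * z.re + z.im), sq_nonneg z.im]
    nlinarith [sq_nonneg z.im, sq_nonneg (z.im)]
  have h2 : -1 ≤ z.re ∧ z.re ≤ 1 := by rw [h1] at h; constructor <;> nlinarith
  obtain ⟨x, y⟩ := z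
  obtain ⟨h2, h3⟩ := h2
  simp only at h1 h2 h3
  subst h1
  interval_cases x <;> decide

theorem O.norm_le_two {z : O} (h : z.norm ≤ 2) :
    z ∈ ({0, 1, -1, ⟨0, 1⟩, ⟨0, -1⟩, ⟨1, -1⟩, ⟨-1, 1⟩} : Finset O) := by
  rw [O.norm_eq] at h
  have h1 : -1 ≤ z.im ∧ z.im ≤ 1 := by
    have : z.im ^ 2 < 2 := by nlinarith [sq_nonneg (2 * z.re + z.im), sq_nonneg z.im]
    constructor <;> nlinarith
  obtain ⟨x, y⟩ := z
  simp only at h h1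
  have h2 : -2 ≤ x ∧ x ≤ 2 := by constructor <;> nlinarith [sq_nonneg (x + 4 * y)]
  obtain ⟨h2, h3⟩ := h2
  obtain ⟨h4, h5⟩ := h1
  interval_cases x <;> interval_cases y <;> first | decide | (exfalso; revert h; decide)

theorem O.isUnit_iff {z : O} : IsUnit z ↔ z = 1 ∨ z = -1 := by
  constructor
  · intro h
    have h1 := QuadraticAlgebra.isUnit_iff_norm_isUnit.1 h
    have h2 : z.norm ≤ 1 := by rcases Int.isUnit_iff.1 h1 with h | h <;> omega
    have := O.norm_le_one h2
    simp only [Finset.mem_insert, Finset.mem_singleton] at this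
    rcases this with rfl | h | h
    · simp at h1
    · exact .inl h
    · exact .inr h
  · rintro (rfl | rfl) <;> simp

theorem O.star_eq_self {z : O} (h : star z = z) : z = (z.re : ℤ) := by
  have := congrArg QuadraticAlgebra.im h
  simp at this
  ext
  · simp
  · simp; omega

/-! ### The embedding of `ℤ[τ]` in `ℂ` with image `𝒪₇` -/

theorem tau_sq : tau * tau = tau - 2 := by
  have h := s7_sq
  simp only [tau]
  linear_combination h / 4

/-- The embedding of `ℤ[τ]` in `ℂ`. -/
def toC : O →+* ℂ where
  toFun z := z.re + z.im * tau
  map_one' := by simp [QuadraticAlgebra.re_one, QuadraticAlgebra.im_one]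
  map_zero' := by simp
  map_add' x y := by simp; ring
  map_mul' x y := by
    simp only [QuadraticAlgebra.re_mul, QuadraticAlgebra.im_mul]
    push_cast
    linear_combination (-(x.im * y.im : ℂ)) * tau_sq

theorem toC_apply (z : O) : toC z = z.re + z.im * tau := rfl

theorem toC_star (z : O) : toC (star z) = star (toC z) := by
  simp only [toC_apply, Complex.star_def, map_add, map_mul, star_tau, map_intCast]
  simp
  ring

theorem toC_norm (z : O) : (z.norm : ℂ) = toC z * star (toC z) := by
  rw [← toC_star, ← map_mul, O.mul_star]; simp

theorem normSq_toC (z : O) : Complex.normSq (toC z) = z.norm := by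
  have := toC_norm z
  rw [Complex.star_def, Complex.mul_conj] at this
  exact_mod_cast this.symm

theorem toC_eq_zero {z : O} : toC z = 0 ↔ z = 0 := by
  rw [← Complex.normSq_eq_zero, normSq_toC, Int.cast_eq_zero, O.norm_eq_zero]

theorem toC_injective : Function.Injective toC :=
  (injective_iff_map_eq_zero toC).2 fun _ h => toC_eq_zero.1 h

theorem toC_inj {z w : O} : toC z = toC w ↔ z = w := toC_injective.eq_iff

theorem s7_eq : s7 = 2 * tau - 1 := by simp only [tau]; ring

theorem tauBar_eq : tauBar = 1 - tau := by simp only [tau, tauBar]; ring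

theorem star_s7 : star s7 = -s7 := by
  simp only [s7_eq, Complex.star_def, map_sub, map_mul, star_tau, map_one, map_ofNat]; ring

theorem exists_rat_of_mem_K7 {z : ℂ} (h : z ∈ K7) : ∃ r s : ℚ, z = r + s * s7 := by
  refine IntermediateField.adjoin_induction ℚ (p := fun z _ => ∃ r s : ℚ, z = r + s * s7)
    ?_ ?_ ?_ ?_ ?_ h
  · rintro x rfl
    exact ⟨0, 1, by simp⟩
  · intro x
    exact ⟨x, 0, by simp⟩
  · rintro x y - - ⟨r, s, rfl⟩ ⟨r', s', rfl⟩
    exact ⟨r + r', s + s', by push_cast; ring⟩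
  · rintro x - ⟨r, s, rfl⟩
    by_cases h0 : (r + s * s7 : ℂ) = 0
    · exact ⟨0, 0, by rw [h0]; simp⟩
    · have h1 : (r - s * s7 : ℂ) ≠ 0 := by
        intro h1
        apply h0
        have := congrArg star h1
        rw [star_sub, star_mul, star_s7] at this
        simp only [Complex.star_def, map_ratCast, map_zero] at this
        linear_combination this
      have h2 : (r ^ 2 + 7 * s ^ 2 : ℂ) = (r + s * s7) * (r - s * s7) := by
        linear_combination s ^ 2 * s7_sq
      have h3 : (r ^ 2 + 7 * s ^ 2 : ℂ) ≠ 0 := by rw [h2]; exact mul_ne_zero h0 h1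
      refine ⟨r / (r ^ 2 + 7 * s ^ 2), -s / (r ^ 2 + 7 * s ^ 2), ?_⟩
      push_cast
      refine inv_eq_of_mul_eq_one_right ?_
      calc _ = (r + s * s7 : ℂ) * (r - s * s7) / (r ^ 2 + 7 * s ^ 2) := by ring
        _ = 1 := by rw [← h2, div_self h3]
  · rintro x y - - ⟨r, s, rfl⟩ ⟨r', s', rfl⟩
    refine ⟨r * r' - 7 * s * s', r * s' + r' * s, ?_⟩
    push_cast
    linear_combination (s * s' : ℂ) * s7_sq

theorem tau_mem_K7 : tau ∈ K7 := tau_mem_O7.1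

theorem toC_mem_K7 (z : O) : toC z ∈ K7 :=
  K7.add_mem (intCast_mem K7 _) (K7.mul_mem (intCast_mem K7 _) tau_mem_K7)

/-- Every element of `K` is a quotient of an element of `ℤ[τ]` and a positive integer. -/
theorem exists_toC_of_mem_K7 {z : ℂ} (h : z ∈ K7) :
    ∃ (x : O) (n : ℕ), 0 < n ∧ (n : ℂ) * z = toC x := by
  obtain ⟨r, s, rfl⟩ := exists_rat_of_mem_K7 h
  refine ⟨⟨r.num * s.den - s.num * r.den, 2 * s.num * r.den⟩, r.den * s.den,
    Nat.mul_pos r.den_pos s.den_pos, ?_⟩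
  have hr : (r : ℂ) * r.den = r.num := by exact_mod_cast Rat.mul_den_eq_num r
  have hs : (s : ℂ) * s.den = s.num := by exact_mod_cast Rat.mul_den_eq_num s
  rw [toC_apply, s7_eq]
  push_cast
  linear_combination (s.den : ℂ) * hr + (r.den : ℂ) * (2 * tau - 1) * hs

theorem exists_int_of_isIntegral_ratCast {q : ℚ} (h : IsIntegral ℤ (q : ℂ)) : ∃ n : ℤ, q = n := by
  have h1 : IsIntegral ℤ q :=
    (isIntegral_algebraMap_iff (algebraMap ℚ ℂ).injective).1 (by simpa using h)
  obtain ⟨n, hn⟩ := IsIntegrallyClosed.isIntegral_iff.1 h1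
  exact ⟨n, by simpa using hn.symm⟩

theorem exists_toC_of_mem_O7 {z : ℂ} (h : z ∈ O7) : ∃ x : O, toC x = z := by
  obtain ⟨r, s, rfl⟩ := exists_rat_of_mem_K7 h.1
  have h1 : IsIntegral ℤ (r + s * s7 : ℂ) := h.2
  have h2 : IsIntegral ℤ (star (r + s * s7 : ℂ)) :=
    h1.map (Complex.conjAe.toAlgHom.restrictScalars ℤ)
  have h3 : star (r + s * s7 : ℂ) = r - s * s7 := by
    rw [star_add, star_mul, star_s7]
    simp only [Complex.star_def, map_ratCast]
    ring
  rw [h3] at h2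
  obtain ⟨a, ha⟩ := exists_int_of_isIntegral_ratCast (q := 2 * r) (by
    have := h1.add h2
    ring_nf at this
    push_cast
    ring_nf
    exact this)
  obtain ⟨b, hb⟩ := exists_int_of_isIntegral_ratCast (q := r ^ 2 + 7 * s ^ 2) (by
    have := h1.mul h2
    have h4 : (r + s * s7 : ℂ) * (r - s * s7) = ((r ^ 2 + 7 * s ^ 2 : ℚ) : ℂ) := by
      push_cast
      linear_combination (-(s : ℂ) ^ 2) * s7_sq
    rwa [h4] at this)
  -- `28 s² = 4 b - a²`, so `14 s` is an integer divisible by `7`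
  have hs : 7 * (2 * s) ^ 2 = ((4 * b - a ^ 2 : ℤ) : ℚ) := by
    push_cast; rw [← ha, ← hb]; ring
  obtain ⟨c, hc⟩ : ∃ c : ℤ, 2 * s = c := by
    have h5 : (14 * s) ^ 2 = ((7 * (4 * b - a ^ 2) : ℤ) : ℚ) := by
      push_cast at hs ⊢; linear_combination 7 * hs
    obtain ⟨d, hd⟩ : ∃ d : ℤ, 14 * s = d := by
      have : IsIntegral ℤ ((14 * s) ^ 2) := by rw [h5]; exact isIntegral_algebraMap (R := ℤ)
      have := IsIntegral.of_pow (by norm_num) this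
      obtain ⟨n, hn⟩ := IsIntegrallyClosed.isIntegral_iff.1 this
      exact ⟨n, by simpa using hn.symm⟩
    rw [hd] at h5
    have h6 : d ^ 2 = 7 * (4 * b - a ^ 2) := by exact_mod_cast h5
    have h7 : (7 : ℤ) ∣ d := Int.Prime.dvd_pow' (by norm_num) (Dvd.intro _ h6.symm)
    obtain ⟨c, rfl⟩ := h7
    exact ⟨c, by push_cast at hd; linarith⟩
  have h8 : 7 * c ^ 2 = 4 * b - a ^ 2 := by rw [hc] at hs; exact_mod_cast hs
  have h9 : a % 2 = c % 2 := by
    have h10 : (a * a + 7 * (c * c)) % 4 = 0 := by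
      have : a * a + 7 * (c * c) = 4 * b := by linarith
      omega
    rcases Int.emod_two_eq_zero_or_one a with h | h <;>
      rcases Int.emod_two_eq_zero_or_one c with h' | h' <;> rw [h, h'] <;> exfalso <;>
      obtain ⟨k, hk⟩ : ∃ k, a = 2 * k + a % 2 := ⟨a / 2, by omega⟩ <;>
      obtain ⟨l, hl⟩ : ∃ l, c = 2 * l + c % 2 := ⟨c / 2, by omega⟩ <;>
      rw [h] at hk <;> rw [h'] at hl <;> subst hk <;> subst hl <;> ring_nf at h10 <;> omega
  refine ⟨⟨(a - c) / 2, c⟩, ?_⟩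
  have h10 : 2 * ((a - c) / 2) = a - c := by omega
  have h11 : (2 : ℂ) * (((a - c) / 2 : ℤ) : ℂ) = a - c := by exact_mod_cast h10
  have h12 : (2 : ℂ) * r = a := by exact_mod_cast ha
  have h13 : (2 : ℂ) * s = c := by exact_mod_cast hc
  rw [toC_apply, s7_eq]
  dsimp only
  linear_combination h11 / 2 - h12 / 2 - (tau - 1 / 2) * h13

theorem toC_mem_O7 (z : O) : toC z ∈ O7 :=
  O7.add_mem (intCast_mem O7 _) (O7.mul_mem (intCast_mem O7 _) tau_mem_O7)

theorem mem_O7_iff {z : ℂ} : z ∈ O7 ↔ ∃ x : O, toC x = z :=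
  ⟨exists_toC_of_mem_O7, by rintro ⟨x, rfl⟩; exact toC_mem_O7 x⟩

/-! ### The special unitary group over `ℤ[τ]` -/

/-- Vectors with entries in `ℤ[τ]`. -/
abbrev V3 := Fin 3 → O

/-- Matrices with entries in `ℤ[τ]`. -/
abbrev M3 := Matrix (Fin 3) (Fin 3) O

/-- The matrix `J` over `ℤ[τ]`. -/
def J0 : M3 := !![0, 0, 1; 0, 1, 0; 1, 0, 0]

/-- The Hermitian form over `ℤ[τ]`. -/
def hO (x y : V3) : O := star y ⬝ᵥ (J0 *ᵥ x)

/-- A vector over `ℤ[τ]` as a complex vector. -/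
def vC (x : V3) : Fin 3 → ℂ := fun i => toC (x i)

/-- A matrix over `ℤ[τ]` as a complex matrix. -/
def mC : M3 →+* Matrix (Fin 3) (Fin 3) ℂ := toC.mapMatrix

theorem mC_apply (A : M3) : mC A = A.map toC := rfl

theorem mC_injective : Function.Injective mC := fun A B h => by
  ext1 i j
  exact toC_injective (congrFun (congrFun h i) j)

theorem mC_conjTranspose (A : M3) : mC Aᴴ = (mC A)ᴴ := by
  ext i j
  exact toC_star _

theorem mC_J0 : mC J0 = formJ := by
  ext i j
  fin_cases i <;> fin_cases j <;> simp [mC_apply, J0, formJ]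

theorem mC_mulVec (A : M3) (x : V3) : mC A *ᵥ vC x = vC (A *ᵥ x) := by
  funext i
  simp [Matrix.mulVec, dotProduct, vC, mC_apply]

theorem mC_smul (a : O) (A : M3) : mC (a • A) = toC a • mC A := by
  ext i j; simp [mC_apply]

theorem hO_eq (x y : V3) : hO x y = star (y 0) * x 2 + star (y 1) * x 1 + star (y 2) * x 0 := by
  simp [hO, J0, Matrix.mulVec, dotProduct, Fin.sum_univ_three]

theorem herm_eq (x y : Fin 3 → ℂ) :
    herm x y = star (y 0) * x 2 + star (y 1) * x 1 + star (y 2) * x 0 := by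
  simp [herm, formJ, Matrix.mulVec, dotProduct, Fin.sum_univ_three]

theorem herm_vC (x y : V3) : herm (vC x) (vC y) = toC (hO x y) := by
  simp only [herm_eq, hO_eq, vC, map_add, map_mul, toC_star]

theorem J0_mul_J0 : J0 * J0 = 1 := by decide +kernel

theorem conjTranspose_J0 : J0ᴴ = J0 := by decide +kernel

/-- The special unitary group of `J` over `ℤ[τ]`. -/
@[ext]
structure SU where
  /-- the matrix -/
  m : M3
  det_m : m.det = 1
  unitary : mᴴ * J0 * m = J0

namespace SU

theorem unitary_mul {A B : M3} (hA : Aᴴ * J0 * A = J0) (hB : Bᴴ * J0 * B = J0) :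
    (A * B)ᴴ * J0 * (A * B) = J0 := by
  rw [conjTranspose_mul]
  calc _ = Bᴴ * (Aᴴ * J0 * A) * B := by simp only [Matrix.mul_assoc]
    _ = J0 := by rw [hA, hB]

theorem inv_mul_of_unitary {A : M3} (hA : Aᴴ * J0 * A = J0) : J0 * Aᴴ * J0 * A = 1 := by
  calc _ = J0 * (Aᴴ * J0 * A) := by simp only [Matrix.mul_assoc]
    _ = 1 := by rw [hA, J0_mul_J0]

theorem mul_inv_of_unitary {A : M3} (hA : Aᴴ * J0 * A = J0) : A * (J0 * Aᴴ * J0) = 1 :=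
  mul_eq_one_comm.1 (inv_mul_of_unitary hA)

instance : Mul SU where
  mul A B := ⟨A.m * B.m, by rw [det_mul, A.det_m, B.det_m, one_mul], unitary_mul A.unitary B.unitary⟩

instance : One SU where
  one := ⟨1, det_one, by simp⟩

instance : Inv SU where
  inv A := ⟨J0 * A.mᴴ * J0, by
      have := congrArg det (inv_mul_of_unitary A.unitary)
      rwa [det_mul, A.det_m, mul_one, det_one] at this, by
      rw [conjTranspose_mul, conjTranspose_mul, conjTranspose_conjTranspose, conjTranspose_J0]
      calc _ = J0 * (A.m * ((J0 * J0) * (J0 * A.mᴴ * J0))) := by simp only [Matrix.mul_assoc]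
        _ = J0 := by rw [J0_mul_J0, one_mul, mul_inv_of_unitary A.unitary, mul_one]⟩

theorem m_mul (A B : SU) : (A * B).m = A.m * B.m := rfl

theorem m_one : (1 : SU).m = 1 := rfl

theorem m_inv (A : SU) : (A⁻¹).m = J0 * A.mᴴ * J0 := rfl

instance : Group SU :=
  Group.ofLeftAxioms (fun _ _ _ => SU.ext (Matrix.mul_assoc _ _ _)) (fun _ => SU.ext (one_mul _))
    fun A => SU.ext (inv_mul_of_unitary A.unitary)

theorem m_mul_inv (A : SU) : A.m * (A⁻¹).m = 1 := mul_inv_of_unitary A.unitary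

theorem m_inv_mul (A : SU) : (A⁻¹).m * A.m = 1 := inv_mul_of_unitary A.unitary

theorem m_pow (A : SU) (n : ℕ) : (A ^ n).m = A.m ^ n := by
  induction n with
  | zero => rw [pow_zero, pow_zero, m_one]
  | succ n ih => rw [pow_succ, pow_succ, m_mul, ih]

end SU

theorem hO_mulVec (A : SU) (x y : V3) : hO (A.m *ᵥ x) (A.m *ᵥ y) = hO x y := by
  simp only [hO, star_mulVec]
  rw [← dotProduct_mulVec, mulVec_mulVec, mulVec_mulVec, A.unitary]

theorem SU.unitaryC (A : SU) : (mC A.m)ᴴ * formJ * mC A.m = formJ := by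
  rw [← mC_conjTranspose, ← mC_J0, ← map_mul, ← map_mul, A.unitary]

theorem herm_mulVec (A : SU) (x y : Fin 3 → ℂ) :
    herm (mC A.m *ᵥ x) (mC A.m *ᵥ y) = herm x y := by
  simp only [herm, star_mulVec]
  rw [← dotProduct_mulVec, mulVec_mulVec, mulVec_mulVec, A.unitaryC]

/-! ### The isomorphism of `SU` with the Picard modular group -/

/-- The isomorphism of `ℤ[τ]` with `𝒪₇`. -/
def toO7 : O ≃+* O7 :=
  RingEquiv.ofBijective (toC.codRestrict O7 toC_mem_O7)
    ⟨fun _ _ h => toC_injective (congrArg Subtype.val h), fun z => by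
      obtain ⟨x, hx⟩ := exists_toC_of_mem_O7 z.2
      exact ⟨x, Subtype.ext hx⟩⟩

theorem coe_toO7 (x : O) : (toO7 x : ℂ) = toC x := rfl

/-- An element of `SU` as a complex matrix. -/
def SU.toGLC : SU →* GL (Fin 3) ℂ where
  toFun A := ⟨mC A.m, mC (A⁻¹).m, by rw [← map_mul, A.m_mul_inv, map_one],
    by rw [← map_mul, A.m_inv_mul, map_one]⟩
  map_one' := Units.ext (map_one mC)
  map_mul' A B := Units.ext (map_mul mC A.m B.m)

theorem SU.val_toGLC (A : SU) : (SU.toGLC A).val = mC A.m := rfl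

theorem SU.toGLC_mem (A : SU) : (SU.toGLC A) ∈ UJO7 := by
  refine ⟨A.unitaryC, GeneralLinearGroup.map toO7.toRingHom
    ⟨A.m, (A⁻¹).m, A.m_mul_inv, A.m_inv_mul⟩, ?_⟩
  ext i j
  rfl

/-- The homomorphism of `SU` onto the Picard modular group. -/
def phiHom : SU →* PicardGroup :=
  (ProjGenLinGroup.mk.comp SU.toGLC).codRestrict PicardGroup fun A =>
    Subgroup.mem_map_of_mem _ (SU.toGLC_mem A)

theorem coe_phiHom (A : SU) :
    (phiHom A : ProjGenLinGroup (Fin 3) ℂ) = ProjGenLinGroup.mk (SU.toGLC A) := rfl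

theorem phiHom_injective : Function.Injective phiHom := by
  rw [injective_iff_map_eq_one]
  intro A hA
  have h1 : ProjGenLinGroup.mk (SU.toGLC A) = 1 := by rw [← coe_phiHom, hA]; rfl
  rw [← map_one ProjGenLinGroup.mk, eq_comm, ProjGenLinGroup.mk_eq_mk_iff] at h1
  obtain ⟨u, hu⟩ := h1
  have h2 : mC A.m = (u : ℂ) • (1 : Matrix (Fin 3) (Fin 3) ℂ) := by
    rw [← SU.val_toGLC, ← hu]
    ext i j
    simp [Matrix.smul_apply, Matrix.one_apply, Matrix.diagonal_apply]
  have h3 : toC (A.m 0 0) = u := by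
    have := congrFun (congrFun h2 0) 0
    simpa [mC_apply] using this
  have h4 : A.m = (A.m 0 0) • (1 : M3) := by
    apply mC_injective
    rw [mC_smul, map_one, h3, h2]
  have h5 : (A.m 0 0) ^ 3 = 1 := by
    have := A.det_m
    rw [h4, det_smul] at this
    simpa using this
  have h6 : A.m 0 0 = 1 := by
    rcases O.isUnit_iff.1 (IsUnit.of_pow_eq_one h5 (by norm_num)) with h | h
    · exact h
    · rw [h] at h5
      exact absurd h5 (by decide)
  apply SU.ext
  rw [h4, h6, one_smul, SU.m_one]

theorem phiHom_surjective : Function.Surjective phiHom := by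
  rintro ⟨γ, A, ⟨hA, B, hB⟩, rfl⟩
  set M : M3 := B.val.map toO7.symm with hM
  have hMC : mC M = A.val := by
    rw [← hB]
    ext i j
    change toC (toO7.symm (B.val i j)) = _
    rw [← coe_toO7, RingEquiv.apply_symm_apply]
    rfl
  have hMU : Mᴴ * J0 * M = J0 := by
    apply mC_injective
    rw [map_mul, map_mul, mC_conjTranspose, hMC, mC_J0]
    exact hA
  have hdet : IsUnit M.det := by
    have h1 : M = toO7.symm.toRingHom.mapMatrix B.val := rfl
    rw [h1, ← RingHom.map_det]
    exact (B.isUnit.map (Matrix.detMonoidHom)).map _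
  rcases O.isUnit_iff.1 hdet with h | h
  · refine ⟨⟨M, h, hMU⟩, Subtype.ext ?_⟩
    rw [coe_phiHom]
    congr 1
    exact Units.ext hMC
  · refine ⟨⟨-M, by rw [det_neg, h]; decide, by simpa using hMU⟩, Subtype.ext ?_⟩
    rw [coe_phiHom]
    rw [ProjGenLinGroup.mk_eq_mk_iff]
    refine ⟨-1, Units.ext ?_⟩
    rw [← hMC]
    simp only [Units.val_mul, SU.val_toGLC, map_neg]
    ext i j
    simp

/-- The isomorphism of `SU` with the Picard modular group. -/
def phi : SU ≃* PicardGroup := MulEquiv.ofBijective phiHom ⟨phiHom_injective, phiHom_surjective⟩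

theorem coe_phi (A : SU) :
    (phi A : ProjGenLinGroup (Fin 3) ℂ) = ProjGenLinGroup.mk (SU.toGLC A) := rfl

theorem mC_mulVec_ne_zero (A : SU) {v : Fin 3 → ℂ} (hv : v ≠ 0) : mC A.m *ᵥ v ≠ 0 := by
  intro h
  apply hv
  have : mC (A⁻¹).m *ᵥ (mC A.m *ᵥ v) = v := by
    rw [mulVec_mulVec, ← map_mul, A.m_inv_mul, map_one, one_mulVec]
  rw [← this, h, mulVec_zero]

theorem phi_smul_mk (A : SU) {v : Fin 3 → ℂ} (hv : v ≠ 0) :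
    phi A • (Projectivization.mk ℂ v hv : P2) =
      Projectivization.mk ℂ (mC A.m *ᵥ v) (mC_mulVec_ne_zero A hv) := rfl

theorem phi_smul_mk_eq_iff (A : SU) {v : Fin 3 → ℂ} (hv : v ≠ 0) :
    phi A • (Projectivization.mk ℂ v hv : P2) = Projectivization.mk ℂ v hv ↔
      ∃ c : ℂ, mC A.m *ᵥ v = c • v := by
  rw [phi_smul_mk, Projectivization.mk_eq_mk_iff']
  exact ⟨fun ⟨c, h⟩ => ⟨c, h.symm⟩, fun ⟨c, h⟩ => ⟨c, h.symm⟩⟩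

theorem representedBy_phi {A : SU} {M : Matrix (Fin 3) (Fin 3) ℂ} (h : mC A.m = M) :
    RepresentedBy (phi A) M := ⟨(SU.toGLC A), h, rfl⟩

theorem representedBy_phi_neg {A : SU} {M : Matrix (Fin 3) (Fin 3) ℂ} (h : mC A.m = -M) :
    RepresentedBy (phi A) M := by
  refine ⟨-(SU.toGLC A), ?_, ?_⟩
  · rw [Units.val_neg, SU.val_toGLC, h, neg_neg]
  · rw [coe_phi, ProjGenLinGroup.mk_eq_mk_iff]
    refine ⟨-1, Units.ext ?_⟩
    ext i j
    simp

/-! ### The Hermitian form over `ℂ` -/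

theorem herm_add_left (x y z : Fin 3 → ℂ) : herm (x + y) z = herm x z + herm y z := by
  simp [herm, mulVec_add]

theorem herm_smul_left (c : ℂ) (x y : Fin 3 → ℂ) : herm (c • x) y = c * herm x y := by
  simp [herm, mulVec_smul]

theorem herm_add_right (x y z : Fin 3 → ℂ) : herm x (y + z) = herm x y + herm x z := by
  simp [herm]

theorem herm_smul_right (c : ℂ) (x y : Fin 3 → ℂ) : herm x (c • y) = star c * herm x y := by
  simp [herm]

theorem herm_zero_left (x : Fin 3 → ℂ) : herm 0 x = 0 := by simp [herm]

theorem herm_sub_left (x y z : Fin 3 → ℂ) : herm (x - y) z = herm x z - herm y z := by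
  simp [herm, mulVec_sub]

theorem star_herm (x y : Fin 3 → ℂ) : star (herm x y) = herm y x := by
  simp only [herm_eq, star_add, star_mul, star_star]; ring

theorem herm_comm_eq_zero {x y : Fin 3 → ℂ} (h : herm x y = 0) : herm y x = 0 := by
  rw [← star_herm, h, star_zero]

theorem herm_self_eq (x : Fin 3 → ℂ) : herm x x = ((herm x x).re : ℂ) := by
  have := star_herm x x
  rw [Complex.star_def, Complex.conj_eq_iff_re] at this
  exact this.symm

theorem two_mul_herm_self (x : Fin 3 → ℂ) :
    2 * (herm x x).re = Complex.normSq (x 0 + x 2) + 2 * Complex.normSq (x 1) -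
      Complex.normSq (x 0 - x 2) := by
  simp [herm_eq, Complex.normSq_apply]; ring

theorem normSq_mul_add_le (a b u v : ℂ) : Complex.normSq (a * star u + b * star v) ≤
    (Complex.normSq a + Complex.normSq b) * (Complex.normSq u + Complex.normSq v) := by
  simp only [Complex.normSq_apply, Complex.star_def, Complex.add_re, Complex.add_im,
    Complex.mul_re, Complex.mul_im, Complex.conj_re, Complex.conj_im]
  nlinarith [sq_nonneg (a.re * v.re - b.re * u.re - (a.im * v.im - b.im * u.im)),
    sq_nonneg (a.re * v.im - b.re * u.im + (a.im * v.re - b.im * u.re)),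
    sq_nonneg (a.re * v.re - b.re * u.re + (a.im * v.im - b.im * u.im)),
    sq_nonneg (a.re * v.im - b.re * u.im - (a.im * v.re - b.im * u.re))]

/-- The orthogonal complement of a negative vector is positive definite. -/
theorem herm_self_pos {p x : Fin 3 → ℂ} (hp : (herm p p).re < 0) (h : herm x p = 0) (hx : x ≠ 0) :
    0 < (herm x x).re := by
  by_contra hneg
  push Not at hneg
  have h1 := two_mul_herm_self p
  have h2 := two_mul_herm_self x
  have h3 : (x 0 - x 2) * star (p 0 - p 2) =
      (x 0 + x 2) * star (p 0 + p 2) + (x 1 * Real.sqrt 2) * star (p 1 * (Real.sqrt 2 : ℂ)) := by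
    rw [herm_eq] at h
    have h4 : ((Real.sqrt 2 : ℝ) : ℂ) * (Real.sqrt 2 : ℝ) = 2 := by
      rw [← Complex.ofReal_mul, Real.mul_self_sqrt (by norm_num)]; norm_num
    simp only [star_add, star_sub, star_mul, Complex.star_def, Complex.conj_ofReal] at h ⊢
    linear_combination -2 * h - (starRingEnd ℂ) (p 1) * x 1 * h4
  have h4 := normSq_mul_add_le (x 0 + x 2) (x 1 * Real.sqrt 2) (p 0 + p 2) (p 1 * (Real.sqrt 2 : ℂ))
  have h5 : Complex.normSq ((Real.sqrt 2 : ℝ) : ℂ) = 2 := by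
    rw [Complex.normSq_ofReal, Real.mul_self_sqrt (by norm_num)]
  rw [← h3, map_mul, map_mul, map_mul, h5, Complex.star_def, Complex.normSq_conj] at h4
  have e0 := Complex.normSq_nonneg (x 0 + x 2)
  have e1 := Complex.normSq_nonneg (x 1)
  have e2 := Complex.normSq_nonneg (x 0 - x 2)
  have e3 := Complex.normSq_nonneg (p 0 + p 2)
  have e4 := Complex.normSq_nonneg (p 1)
  have h6 : Complex.normSq (x 0 - x 2) = 0 := by
    by_contra h0
    have h7 : 0 < Complex.normSq (x 0 - x 2) := lt_of_le_of_ne e2 (Ne.symm h0)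
    have h8 : Complex.normSq (x 0 + x 2) + Complex.normSq (x 1) * 2 ≤ Complex.normSq (x 0 - x 2) := by
      linarith
    have h9 := mul_le_mul_of_nonneg_right h8
      (by positivity : 0 ≤ Complex.normSq (p 0 + p 2) + Complex.normSq (p 1) * 2)
    nlinarith
  have h7 : Complex.normSq (x 0 + x 2) = 0 := by linarith
  have h8 : Complex.normSq (x 1) = 0 := by linarith
  rw [Complex.normSq_eq_zero] at h6 h7 h8
  apply hx
  funext i
  fin_cases i
  · change x 0 = 0; linear_combination (h6 + h7) / 2
  · exact h8
  · change x 2 = 0; linear_combination (h7 - h6) / 2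

theorem ne_zero_of_neg {p : Fin 3 → ℂ} (hp : (herm p p).re < 0) : p ≠ 0 := by
  rintro rfl
  simp [herm_zero_left] at hp

theorem herm_ne_zero_of_neg {p q : Fin 3 → ℂ} (hp : (herm p p).re < 0) (hq : (herm q q).re < 0) :
    herm q p ≠ 0 := fun h => by
  have := herm_self_pos hp h (ne_zero_of_neg hq)
  linarith

theorem herm_smul_self (c : ℂ) (x : Fin 3 → ℂ) :
    (herm (c • x) (c • x)).re = Complex.normSq c * (herm x x).re := by
  rw [herm_smul_left, herm_smul_right, ← mul_assoc, Complex.star_def, Complex.mul_conj,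
    Complex.re_ofReal_mul]

/-! ### Points of the complex hyperbolic plane -/

theorem spans_mk {v w : Fin 3 → ℂ} (hv : v ≠ 0) :
    Spans w (Projectivization.mk ℂ v hv) ↔ ∃ c : ℂ, c ≠ 0 ∧ w = c • v := by
  constructor
  · rintro ⟨hw, h⟩
    obtain ⟨c, hc⟩ := (Projectivization.mk_eq_mk_iff' ℂ _ _ _ _).1 h
    refine ⟨c, ?_, hc.symm⟩
    rintro rfl
    exact hw (by rw [← hc, zero_smul])
  · rintro ⟨c, hc, rfl⟩
    exact ⟨smul_ne_zero hc hv, (Projectivization.mk_eq_mk_iff' ℂ _ _ _ _).2 ⟨c, rfl⟩⟩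

theorem mk_mem_H2 {v : Fin 3 → ℂ} (hv : v ≠ 0) :
    Projectivization.mk ℂ v hv ∈ H2 ↔ (herm v v).re < 0 := by
  constructor
  · rintro ⟨w, hw, h⟩
    obtain ⟨c, hc, rfl⟩ := (spans_mk hv).1 h
    rw [herm_smul_self] at hw
    have := Complex.normSq_pos.2 hc
    nlinarith
  · exact fun h => ⟨v, h, hv, rfl⟩

/-- The point of the projective plane spanned by a negative vector. -/
def pt (v : Fin 3 → ℂ) (hv : (herm v v).re < 0) : P2 := Projectivization.mk ℂ v (ne_zero_of_neg hv)

theorem pt_mem_H2 {v : Fin 3 → ℂ} (hv : (herm v v).re < 0) : pt v hv ∈ H2 :=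
  (mk_mem_H2 _).2 hv

theorem exists_eq_pt {p : P2} (h : p ∈ H2) : ∃ v hv, p = pt v hv := by
  obtain ⟨v, hv, h0, rfl⟩ := h
  exact ⟨v, hv, rfl⟩

theorem pt_eq_pt {v w : Fin 3 → ℂ} {hv hw} : pt v hv = pt w hw ↔ ∃ c : ℂ, v = c • w := by
  unfold pt
  rw [Projectivization.mk_eq_mk_iff']
  exact ⟨fun ⟨c, h⟩ => ⟨c, h.symm⟩, fun ⟨c, h⟩ => ⟨c, h.symm⟩⟩

theorem spans_pt {v w : Fin 3 → ℂ} {hv} : Spans w (pt v hv) ↔ ∃ c : ℂ, c ≠ 0 ∧ w = c • v :=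
  spans_mk _

theorem herm_mulVec_neg (A : SU) {v : Fin 3 → ℂ} (hv : (herm v v).re < 0) :
    (herm (mC A.m *ᵥ v) (mC A.m *ᵥ v)).re < 0 := by rwa [herm_mulVec]

theorem phi_smul_pt (A : SU) {v : Fin 3 → ℂ} (hv : (herm v v).re < 0) :
    phi A • pt v hv = pt (mC A.m *ᵥ v) (herm_mulVec_neg A hv) := rfl

theorem phi_smul_pt_eq_iff (A : SU) {v : Fin 3 → ℂ} (hv : (herm v v).re < 0) :
    phi A • pt v hv = pt v hv ↔ ∃ c : ℂ, mC A.m *ᵥ v = c • v :=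
  phi_smul_mk_eq_iff A _

theorem phi_smul_mem_H2 (A : SU) {p : P2} (h : p ∈ H2) : phi A • p ∈ H2 := by
  obtain ⟨v, hv, rfl⟩ := exists_eq_pt h
  rw [phi_smul_pt]
  exact pt_mem_H2 _

theorem smul_mem_H2 (γ : PicardGroup) {p : P2} (h : p ∈ H2) : γ • p ∈ H2 := by
  obtain ⟨A, rfl⟩ := phi.surjective γ
  exact phi_smul_mem_H2 A h

theorem pt_mem_polarLine {v w : Fin 3 → ℂ} {hv} : pt v hv ∈ polarLine w ↔ herm v w = 0 := by
  constructor
  · intro h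
    exact h.2 v (spans_pt.2 ⟨1, one_ne_zero, (one_smul _ _).symm⟩)
  · intro h
    refine ⟨pt_mem_H2 hv, fun u hu => ?_⟩
    obtain ⟨c, -, rfl⟩ := spans_pt.1 hu
    rw [herm_smul_left, h, mul_zero]

/-! ### Elements of `SU` with a fixed point -/

theorem SU.normSq_eigenvalue {A : SU} {p : Fin 3 → ℂ} {c : ℂ} (hp : (herm p p).re ≠ 0)
    (h : mC A.m *ᵥ p = c • p) : Complex.normSq c = 1 := by
  have h1 := herm_mulVec A p p
  rw [h] at h1
  have h2 := congrArg Complex.re h1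
  rw [herm_smul_self] at h2
  exact mul_right_cancel₀ hp (by linarith)

/-- If `A` fixes a negative line then all eigenvalues have modulus one. -/
theorem SU.normSq_eigenvalue' {A : SU} {p w : Fin 3 → ℂ} {c d : ℂ} (hp : (herm p p).re < 0)
    (h : mC A.m *ᵥ p = c • p) (hw : w ≠ 0) (hd : mC A.m *ᵥ w = d • w) :
    Complex.normSq d = 1 := by
  by_cases h0 : herm w p = 0
  · exact SU.normSq_eigenvalue (herm_self_pos hp h0 hw).ne' hd
  · have h1 := herm_mulVec A w p
    rw [h, hd, herm_smul_left, herm_smul_right, ← mul_assoc] at h1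
    have h2 : d * star c = 1 := mul_right_cancel₀ h0 (by rw [h1, one_mul])
    have h3 := congrArg Complex.normSq h2
    rwa [map_mul, Complex.star_def, Complex.normSq_conj, SU.normSq_eigenvalue hp.ne h, mul_one,
      map_one] at h3

theorem SU.norm_trace_le {A : SU} {p : Fin 3 → ℂ} {c : ℂ} (hp : (herm p p).re < 0)
    (h : mC A.m *ᵥ p = c • p) : A.m.trace.norm ≤ 9 := by
  have h1 : toC A.m.trace = (mC A.m).charpoly.roots.sum := by
    rw [← Matrix.trace_eq_sum_roots_charpoly]
    simp [Matrix.trace, mC_apply]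
  have h2 : ∀ x ∈ (mC A.m).charpoly.roots, ‖x‖ ≤ 1 := by
    intro x hx
    have h3 := Polynomial.isRoot_of_mem_roots hx
    rw [Polynomial.IsRoot.def, Matrix.eval_charpoly] at h3
    obtain ⟨w, hw, h4⟩ := Matrix.exists_mulVec_eq_zero_iff.2 h3
    have h5 : mC A.m *ᵥ w = x • w := by
      rw [sub_mulVec, sub_eq_zero] at h4
      rw [← h4]
      simp
    have h6 := SU.normSq_eigenvalue' hp h hw h5
    rw [Complex.normSq_eq_norm_sq] at h6
    nlinarith [norm_nonneg x]
  have h3 : ‖toC A.m.trace‖ ≤ 3 := by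
    rw [h1]
    calc _ ≤ ((mC A.m).charpoly.roots.map (fun x => ‖x‖)).sum := norm_multiset_sum_le _
      _ ≤ Multiset.card ((mC A.m).charpoly.roots.map (fun x => ‖x‖)) • (1 : ℝ) := by
        apply Multiset.sum_le_card_nsmul
        intro y hy
        obtain ⟨x, hx, rfl⟩ := Multiset.mem_map.1 hy
        exact h2 x hx
      _ ≤ 3 := by
        rw [Multiset.card_map]
        have := Polynomial.card_roots' (mC A.m).charpoly
        rw [Matrix.charpoly_natDegree_eq_dim, Fintype.card_fin] at this
        simpa using this
  have h4 := normSq_toC A.m.trace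
  rw [Complex.normSq_eq_norm_sq] at h4
  have h5 : (A.m.trace.norm : ℝ) ≤ 9 := by rw [← h4]; nlinarith [norm_nonneg (toC A.m.trace)]
  exact_mod_cast h5

theorem cayley_hamilton_three {R : Type*} [CommRing R] (A : Matrix (Fin 3) (Fin 3) R) :
    A ^ 3 - A.trace • A ^ 2 + A.adjugate.trace • A - A.det • (1 : Matrix (Fin 3) (Fin 3) R) = 0 := by
  rw [pow_succ, sq]
  ext i j
  fin_cases i <;> fin_cases j <;>
    simp [Matrix.mul_apply, Fin.sum_univ_three, Matrix.trace_fin_three, Matrix.adjugate_fin_three,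
      Matrix.det_fin_three] <;> ring

theorem trace_sq_three {R : Type*} [CommRing R] (A : Matrix (Fin 3) (Fin 3) R) :
    (A ^ 2).trace = A.trace ^ 2 - 2 * A.adjugate.trace := by
  simp [sq, Matrix.mul_apply, Fin.sum_univ_three, Matrix.trace_fin_three,
      Matrix.adjugate_fin_three]
  ring

theorem SU.adjugate (A : SU) : A.m.adjugate = (A⁻¹).m := by
  have h : A.m * A.m.adjugate = 1 := by rw [mul_adjugate, A.det_m, one_smul]
  calc _ = ((A⁻¹).m * A.m) * A.m.adjugate := by rw [A.m_inv_mul, one_mul]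
    _ = (A⁻¹).m := by rw [Matrix.mul_assoc, h, mul_one]

theorem SU.trace_inv (A : SU) : (A⁻¹).m.trace = star A.m.trace := by
  rw [SU.m_inv, Matrix.trace_mul_comm, ← Matrix.mul_assoc, J0_mul_J0, one_mul,
    Matrix.trace_conjTranspose]

theorem SU.cayley_hamilton (A : SU) :
    A.m ^ 3 - A.m.trace • A.m ^ 2 + star A.m.trace • A.m - 1 = 0 := by
  have := cayley_hamilton_three A.m
  rwa [A.adjugate, A.trace_inv, A.det_m, one_smul] at this

theorem SU.trace_sq (A : SU) : (A ^ 2).m.trace = A.m.trace ^ 2 - 2 * star A.m.trace := by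
  rw [SU.m_pow, trace_sq_three, A.adjugate, A.trace_inv]

theorem SU.trace_cube (A : SU) :
    (A ^ 3).m.trace = A.m.trace ^ 3 - 3 * (A.m.trace * star A.m.trace) + 3 := by
  have h := congrArg Matrix.trace A.cayley_hamilton
  have h2 := A.trace_sq
  rw [SU.m_pow] at h2
  rw [trace_sub, trace_add, trace_sub, trace_smul, trace_smul, h2, trace_zero, trace_one,
    ← SU.m_pow] at h
  simp only [smul_eq_mul, Fintype.card_fin] at h
  push_cast at h
  linear_combination h

/-- The traces of the elements of `SU` with a fixed point. -/
def ellipticTraces : Finset O := {3, -1, 0, 1, 2, ⟨0, -1⟩, ⟨-1, 1⟩}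

theorem mem_ellipticTraces {t : O} (h : t.norm ≤ 9) (h2 : (t ^ 2 - 2 * star t).norm ≤ 9) :
    t ∈ ellipticTraces := by
  obtain ⟨x, y⟩ := t
  have h0 := h
  rw [O.norm_eq] at h0
  have h1 : -2 ≤ y ∧ y ≤ 2 := by
    constructor <;> nlinarith [sq_nonneg (2 * x + y)]
  have h3 : -4 ≤ x ∧ x ≤ 4 := by
    constructor <;> nlinarith [sq_nonneg (x + 4 * y)]
  obtain ⟨h4, h5⟩ := h1
  obtain ⟨h6, h7⟩ := h3
  clear h0
  have key : ∀ x ∈ Finset.Icc (-4 : ℤ) 4, ∀ y ∈ Finset.Icc (-2 : ℤ) 2,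
      (⟨x, y⟩ : O).norm ≤ 9 → ((⟨x, y⟩ : O) ^ 2 - 2 * star (⟨x, y⟩ : O)).norm ≤ 9 →
      (⟨x, y⟩ : O) ∈ ellipticTraces := by decide +kernel
  exact key x (Finset.mem_Icc.2 ⟨h6, h7⟩) y (Finset.mem_Icc.2 ⟨h4, h5⟩) h h2

theorem SU.mulVec_pow_eigen {A : SU} {p : Fin 3 → ℂ} {c : ℂ} (h : mC A.m *ᵥ p = c • p) (n : ℕ) :
    mC (A ^ n).m *ᵥ p = (c ^ n) • p := by
  induction n with
  | zero => simp [SU.m_one]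
  | succ n ih =>
    rw [pow_succ', SU.m_mul, map_mul, ← mulVec_mulVec, ih, mulVec_smul, h, smul_smul, pow_succ]

theorem SU.trace_mem {A : SU} {p : Fin 3 → ℂ} {c : ℂ} (hp : (herm p p).re < 0)
    (h : mC A.m *ᵥ p = c • p) : A.m.trace ∈ ellipticTraces := by
  refine mem_ellipticTraces (SU.norm_trace_le hp h) ?_
  rw [← SU.trace_sq]
  exact SU.norm_trace_le hp (SU.mulVec_pow_eigen h 2)

/-! ### The orders of elements with a fixed point -/

/-- A matrix whose difference from the identity is nilpotent and that fixes a negative vector is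
the identity. -/
theorem SU.eq_one_of_trace {A : SU} {p : Fin 3 → ℂ} {c : ℂ} (hp : (herm p p).re < 0)
    (h : mC A.m *ᵥ p = c • p) (ht : A.m.trace = 3) : A = 1 := by
  set N : Matrix (Fin 3) (Fin 3) ℂ := mC A.m - 1 with hN
  have hN3 : N * (N * N) = 0 := by
    have h1 := A.cayley_hamilton
    have h2 := congrArg mC h1
    rw [ht, show star (3 : O) = 3 by decide] at h2
    have h3 : ∀ B : M3, mC ((3 : O) • B) = mC B + mC B + mC B := by
      intro B
      rw [show (3 : O) = 1 + 1 + 1 by decide +kernel, add_smul, add_smul, one_smul, map_add,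
        map_add]
    rw [map_sub, map_add, map_sub, h3, h3, map_pow, map_pow, map_one, map_zero] at h2
    rw [← h2, hN]
    noncomm_ring
  have hNp : N *ᵥ p = (c - 1) • p := by
    rw [hN, sub_mulVec, h, one_mulVec, sub_smul, one_smul]
  have hc : c = 1 := by
    have h1 : (N * (N * N)) *ᵥ p = ((c - 1) ^ 3) • p := by
      rw [← mulVec_mulVec, ← mulVec_mulVec, hNp, mulVec_smul, hNp, mulVec_smul, mulVec_smul, hNp,
        smul_smul, smul_smul]
      ring_nf
    rw [hN3, zero_mulVec, eq_comm, smul_eq_zero] at h1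
    have h2 := h1.resolve_right (ne_zero_of_neg hp)
    exact sub_eq_zero.1 (pow_eq_zero_iff (by norm_num) |>.1 h2)
  have key : ∀ w, N *ᵥ (N *ᵥ w) = 0 → N *ᵥ w = 0 := by
    intro w hw
    set u := N *ᵥ w with hu
    have hAw : mC A.m *ᵥ w = w + u := by
      rw [hu, hN, sub_mulVec, one_mulVec]; abel
    have hAu : mC A.m *ᵥ u = u := by
      have : mC A.m *ᵥ u = u + N *ᵥ u := by rw [hN, sub_mulVec, one_mulVec]; abel
      rw [this, hw, add_zero]
    have h1 := herm_mulVec A u w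
    rw [hAw, hAu, herm_add_right] at h1
    have h2 := herm_mulVec A w p
    rw [hAw, h, hc, one_smul, herm_add_left] at h2
    by_contra hne
    have := herm_self_pos hp (by linear_combination h2) hne
    rw [show herm u u = 0 by linear_combination h1] at this
    simp at this
  have hN2 : ∀ w, N *ᵥ w = 0 := by
    intro w
    apply key
    apply key
    rw [mulVec_mulVec, mulVec_mulVec, Matrix.mul_assoc, hN3, zero_mulVec]
  have hN0 : N = 0 := Matrix.ext_of_mulVec_single fun i => by rw [hN2, zero_mulVec]
  apply SU.ext
  apply mC_injective
  rw [SU.m_one, map_one]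
  exact sub_eq_zero.1 hN0

theorem SU.trace_pow_add_three (A : SU) (n : ℕ) : (A ^ (n + 3)).m.trace =
    A.m.trace * (A ^ (n + 2)).m.trace - star A.m.trace * (A ^ (n + 1)).m.trace +
      (A ^ n).m.trace := by
  have h : A.m ^ (n + 3) = A.m.trace • A.m ^ (n + 2) - star A.m.trace • A.m ^ (n + 1) + A.m ^ n := by
    have h1 := congrArg (fun X => A.m ^ n * X) A.cayley_hamilton
    simp only [mul_sub, mul_add, mul_smul_comm, ← pow_add, mul_one, mul_zero, ← pow_succ] at h1
    rw [← sub_eq_zero, ← h1]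
    abel
  rw [SU.m_pow, h, trace_add, trace_sub, trace_smul, trace_smul]
  simp only [SU.m_pow, smul_eq_mul]

theorem SU.trace_pow_zero (A : SU) : (A ^ 0).m.trace = 3 := by
  rw [pow_zero, SU.m_one]; decide +kernel

section order
variable {A : SU} {p : Fin 3 → ℂ} {c : ℂ}

theorem SU.pow_eq_one_of_trace (hp : (herm p p).re < 0) (h : mC A.m *ᵥ p = c • p) {n : ℕ}
    (ht : (A ^ n).m.trace = 3) : A ^ n = 1 :=
  SU.eq_one_of_trace hp (SU.mulVec_pow_eigen h n) ht

theorem SU.orderOf_trace_neg_one (hp : (herm p p).re < 0) (h : mC A.m *ᵥ p = c • p)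
    (ht : A.m.trace = -1) : orderOf A = 2 := by
  refine orderOf_eq_prime (SU.pow_eq_one_of_trace hp h ?_) fun h1 => ?_
  · rw [SU.trace_sq, ht]; decide +kernel
  · rw [h1] at ht; revert ht; decide +kernel

theorem SU.orderOf_trace_zero (hp : (herm p p).re < 0) (h : mC A.m *ᵥ p = c • p)
    (ht : A.m.trace = 0) : orderOf A = 3 := by
  refine orderOf_eq_prime (SU.pow_eq_one_of_trace hp h ?_) fun h1 => ?_
  · rw [SU.trace_cube, ht]; decide +kernel
  · rw [h1] at ht; revert ht; decide +kernel

theorem SU.orderOf_trace_one (hp : (herm p p).re < 0) (h : mC A.m *ᵥ p = c • p)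
    (ht : A.m.trace = 1) : orderOf A = 4 := by
  have h2 : (A ^ 2).m.trace = -1 := by rw [SU.trace_sq, ht]; decide +kernel
  have h4 := SU.orderOf_trace_neg_one hp (SU.mulVec_pow_eigen h 2) h2
  have : orderOf A = 2 ^ (1 + 1) := by
    refine orderOf_eq_prime_pow (fun h1 => ?_) ?_
    · rw [pow_one] at h1
      rw [h1, orderOf_one] at h4
      omega
    · have h5 := pow_orderOf_eq_one (A ^ 2)
      rwa [h4, ← pow_mul] at h5
  simpa using this

theorem SU.orderOf_trace_two (hp : (herm p p).re < 0) (h : mC A.m *ᵥ p = c • p)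
    (ht : A.m.trace = 2) : orderOf A = 6 := by
  have h2 : (A ^ 2).m.trace = 0 := by rw [SU.trace_sq, ht]; decide +kernel
  have h3 : (A ^ 3).m.trace = -1 := by rw [SU.trace_cube, ht]; decide +kernel
  have h4 := SU.orderOf_trace_zero hp (SU.mulVec_pow_eigen h 2) h2
  have h5 := SU.orderOf_trace_neg_one hp (SU.mulVec_pow_eigen h 3) h3
  refine orderOf_eq_of_pow_and_pow_div_prime (by norm_num) ?_ fun q hq hq6 => ?_
  · have h6 := pow_orderOf_eq_one (A ^ 2)
    rwa [h4, ← pow_mul] at h6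
  · have h6 : q ∈ Nat.primeFactors 6 := Nat.mem_primeFactors.2 ⟨hq, hq6, by norm_num⟩
    rw [show Nat.primeFactors 6 = {2, 3} by decide +kernel] at h6
    simp only [Finset.mem_insert, Finset.mem_singleton] at h6
    rcases h6 with rfl | rfl
    · intro h7; rw [show 6 / 2 = 3 by norm_num] at h7; rw [h7, orderOf_one] at h5; omega
    · intro h7; rw [show 6 / 3 = 2 by norm_num] at h7; rw [h7, orderOf_one] at h4; omega

theorem SU.orderOf_trace_seven (hp : (herm p p).re < 0) (h : mC A.m *ᵥ p = c • p)
    (ht : A.m.trace = ⟨0, -1⟩ ∨ A.m.trace = ⟨-1, 1⟩) : orderOf A = 7 := by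
  refine (@orderOf_eq_prime _ _ A 7 ⟨by norm_num⟩
    (SU.pow_eq_one_of_trace hp h ?_) fun h1 => ?_)
  · have h0 := A.trace_pow_zero
    have h1 : (A ^ 1).m.trace = A.m.trace := by rw [pow_one]
    have h2 := A.trace_sq
    have h3 := A.trace_pow_add_three 0
    have h4 := A.trace_pow_add_three 1
    have h5 := A.trace_pow_add_three 2
    have h6 := A.trace_pow_add_three 3
    have h7 := A.trace_pow_add_three 4
    norm_num only at h3 h4 h5 h6 h7
    rcases ht with ht | ht <;> rw [ht] at h1 h2 h3 h4 h5 h6 h7 <;>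
      rw [h7, h6, h5, h4, h3, h2, h1, h0] <;> decide +kernel
  · rw [h1] at ht; revert ht; decide +kernel

theorem SU.orderOf_mem (hp : (herm p p).re < 0) (h : mC A.m *ᵥ p = c • p) :
    orderOf A ∈ ({1, 2, 3, 4, 6, 7} : Finset ℕ) := by
  have := SU.trace_mem hp h
  simp only [ellipticTraces, Finset.mem_insert, Finset.mem_singleton] at this
  rcases this with ht | ht | ht | ht | ht | ht | ht
  · rw [SU.eq_one_of_trace hp h ht]; simp
  · rw [SU.orderOf_trace_neg_one hp h ht]; simp
  · rw [SU.orderOf_trace_zero hp h ht]; simp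
  · rw [SU.orderOf_trace_one hp h ht]; simp
  · rw [SU.orderOf_trace_two hp h ht]; simp
  · rw [SU.orderOf_trace_seven hp h (.inl ht)]; simp
  · rw [SU.orderOf_trace_seven hp h (.inr ht)]; simp

end order

/-! ### Double eigenvalues -/

/-- Two vectors have a common nonzero orthogonal vector. -/
theorem exists_herm_eq_zero (p q : Fin 3 → ℂ) : ∃ w ≠ 0, herm w p = 0 ∧ herm w q = 0 := by
  obtain ⟨w, hw, h⟩ := Matrix.exists_mulVec_eq_zero_iff.2
    (show (!![star (p 2), star (p 1), star (p 0); star (q 2), star (q 1), star (q 0);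
      0, 0, 0] : Matrix (Fin 3) (Fin 3) ℂ).det = 0 by simp [Matrix.det_fin_three])
  refine ⟨w, hw, ?_, ?_⟩
  · have := congrFun h 0
    simp [Matrix.mulVec, dotProduct, Fin.sum_univ_three] at this
    rw [herm_eq]; simp; linear_combination this
  · have := congrFun h 1
    simp [Matrix.mulVec, dotProduct, Fin.sum_univ_three] at this
    rw [herm_eq]; simp; linear_combination this

theorem conjTranspose_mul_formJ_mul_apply (P Q : Matrix (Fin 3) (Fin 3) ℂ) (i j : Fin 3) :
    (Pᴴ * formJ * Q) i j = herm (fun k => Q k j) (fun k => P k i) := by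
  rw [Matrix.mul_assoc, herm, Matrix.mul_apply]
  simp [dotProduct, Matrix.mul_apply, Matrix.mulVec]

theorem herm_eq_of_cols {A : Matrix (Fin 3) (Fin 3) ℂ} {e : Fin 3 → Fin 3 → ℂ}
    {d : Fin 3 → ℂ} (he : ∀ i j, herm (e j) (e i) = if i = j then d i else 0)
    {d' : Fin 3 → ℂ} (he' : ∀ i j, herm (A *ᵥ e j) (e i) = if i = j then d' i else 0)
    (hd : ∀ i, d i ≠ 0) : A.trace = ∑ i, d' i / d i ∧ A.det = ∏ i, d' i / d i := by
  set P : Matrix (Fin 3) (Fin 3) ℂ := Matrix.of fun i j => e j i with hP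
  have h1 : Pᴴ * formJ * P = diagonal d := by
    ext i j
    rw [conjTranspose_mul_formJ_mul_apply, diagonal_apply]
    exact he i j
  have h2 : Pᴴ * formJ * (A * P) = diagonal d' := by
    ext i j
    rw [conjTranspose_mul_formJ_mul_apply, diagonal_apply]
    exact he' i j
  set D : Matrix (Fin 3) (Fin 3) ℂ := diagonal fun i => (d i)⁻¹ with hD
  have h3 : D * diagonal d = 1 := by
    rw [hD, diagonal_mul_diagonal, ← diagonal_one]
    congr 1
    funext i
    exact inv_mul_cancel₀ (hd i)
  have h4 : (D * (Pᴴ * formJ)) * P = 1 := by rw [Matrix.mul_assoc, h1, h3]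
  have h5 : P * (D * (Pᴴ * formJ)) = 1 := mul_eq_one_comm.1 h4
  have h6 : (D * (Pᴴ * formJ)) * (A * P) = diagonal fun i => d' i / d i := by
    rw [Matrix.mul_assoc, h2, hD, diagonal_mul_diagonal]
    congr 1
    funext i
    rw [div_eq_inv_mul]
  constructor
  · rw [← trace_diagonal, ← h6, ← Matrix.mul_assoc, Matrix.trace_mul_comm, ← Matrix.mul_assoc, h5,
      one_mul]
  · rw [← det_diagonal, ← h6, det_mul, det_mul A P]
    have := congrArg det h4
    rw [det_mul, det_one] at this
    linear_combination -A.det * this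

/-- The trace of an element whose negative eigenvector has a multiple eigenvalue. -/
theorem SU.trace_eq_of_double {A : SU} {p q : Fin 3 → ℂ} {c : ℂ} (hp : (herm p p).re < 0)
    (h : mC A.m *ᵥ p = c • p) (hq : mC A.m *ᵥ q = c • q) (hpq : ∀ a : ℂ, q ≠ a • p) :
    toC A.m.trace = 2 * c + star c ^ 2 := by
  have hc := SU.normSq_eigenvalue hp.ne h
  have hpp : herm p p ≠ 0 := fun h0 => by rw [h0] at hp; simp at hp
  -- make `q` orthogonal to `p`
  obtain ⟨r, hr0, hrp, hr⟩ : ∃ r, r ≠ 0 ∧ herm r p = 0 ∧ mC A.m *ᵥ r = c • r := by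
    refine ⟨q - (herm q p / herm p p) • p, fun h0 => hpq _ (sub_eq_zero.1 h0), ?_, ?_⟩
    · rw [herm_sub_left, herm_smul_left, div_mul_cancel₀ _ hpp, sub_self]
    · rw [mulVec_sub, mulVec_smul, h, hq, smul_sub, smul_comm]
  obtain ⟨w, hw0, hwp, hwr⟩ := exists_herm_eq_zero p r
  have hrr := herm_self_pos hp hrp hr0
  have hww := herm_self_pos hp hwp hw0
  have hrr' : herm r r ≠ 0 := fun h0 => by rw [h0] at hrr; simp at hrr
  have hww' : herm w w ≠ 0 := fun h0 => by rw [h0] at hww; simp at hww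
  have hc0 : c ≠ 0 := by rintro rfl; simp at hc
  have hAw : ∀ x, mC A.m *ᵥ x = c • x → herm w x = 0 → herm (mC A.m *ᵥ w) x = 0 := by
    intro x hx hwx
    have h1 := herm_mulVec A w x
    rw [hx, herm_smul_right, hwx] at h1
    exact (mul_eq_zero.1 h1).resolve_left (star_ne_zero.2 hc0)
  have hpr := herm_comm_eq_zero hrp
  have hpw := herm_comm_eq_zero hwp
  have hrw := herm_comm_eq_zero hwr
  obtain ⟨h1, h2⟩ := herm_eq_of_cols (A := mC A.m) (e := ![p, r, w])
    (d := ![herm p p, herm r r, herm w w])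
    (d' := ![c * herm p p, c * herm r r, herm (mC A.m *ᵥ w) w])
    (by
      intro i j
      fin_cases i <;> fin_cases j <;> simp [hrp, hwp, hwr, hpr, hpw, hrw])
    (by
      intro i j
      fin_cases i <;> fin_cases j <;>
        simp [h, hr, herm_smul_left, hrp, hpr, hpw, hrw, hAw p h hwp, hAw r hr hwr])
    (by intro i; fin_cases i <;> simpa)
  have hdet : (mC A.m).det = 1 := by
    rw [mC, ← RingHom.map_det, A.det_m, map_one]
  have htr : (mC A.m).trace = toC A.m.trace := by simp [Matrix.trace, mC_apply]
  rw [hdet] at h2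
  rw [htr] at h1
  simp only [Fin.sum_univ_three, Fin.prod_univ_three, Matrix.cons_val_zero, Matrix.cons_val_one,
    Matrix.cons_val, mul_div_cancel_right₀ _ hpp,
    mul_div_cancel_right₀ _ hrr'] at h1 h2
  have hcc : c * star c = 1 := by
    rw [Complex.star_def, Complex.mul_conj, hc]; simp
  rw [h1]
  linear_combination (star c ^ 2) * (-h2) +
    (herm (mC A.m *ᵥ w) w / herm w w) * (-(1 + c * star c)) * hcc

/-- If the eigenvalue of the negative eigenvector of a nontrivial element is not simple, the
element has trace `-1` and the eigenvalue is `-1`. -/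
theorem SU.trace_of_double {A : SU} {p q : Fin 3 → ℂ} {c : ℂ} (hp : (herm p p).re < 0)
    (h : mC A.m *ᵥ p = c • p) (hq : mC A.m *ᵥ q = c • q) (hpq : ∀ a : ℂ, q ≠ a • p) (hA : A ≠ 1) :
    A.m.trace = -1 ∧ c = -1 := by
  have h1 := SU.trace_eq_of_double hp h hq hpq
  have hc := SU.normSq_eigenvalue hp.ne h
  have hcc : c * star c = 1 := by
    rw [Complex.star_def, Complex.mul_conj, hc]; simp
  have h2 : c * toC (2 * A.m.trace ^ 2 - 6 * star A.m.trace) = toC ((A.m.trace.norm - 9 : ℤ) : O) := by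
    rw [Int.cast_sub, map_sub, ← O.mul_star]
    simp only [map_sub, map_mul, map_pow, map_ofNat, toC_star, h1, star_add, star_mul, star_pow,
      star_star, Int.cast_ofNat]
    have : star (2 : ℂ) = 2 := by simp
    rw [this]
    linear_combination (8 + 2 * star c ^ 3 - 4 - star c * c - 1 - 4 + 8 * (c * star c - 1)) * hcc
  have h3 := congrArg Complex.normSq h2
  rw [map_mul, hc, one_mul, normSq_toC, normSq_toC] at h3
  have h4 : (2 * A.m.trace ^ 2 - 6 * star A.m.trace).norm =
      ((A.m.trace.norm - 9 : ℤ) : O).norm := by exact_mod_cast h3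
  have h5 := SU.trace_mem hp h
  have h6 : A.m.trace ≠ 3 := fun h' => hA (SU.eq_one_of_trace hp h h')
  have key : ∀ t ∈ ellipticTraces, t ≠ 3 →
      (2 * t ^ 2 - 6 * star t).norm = ((t.norm - 9 : ℤ) : O).norm → t = -1 := by decide +kernel
  have h7 := key _ h5 h6 h4
  refine ⟨h7, ?_⟩
  rw [h7] at h2
  rw [show (2 * (-1) ^ 2 - 6 * star (-1) : O) = 8 by decide +kernel,
    show (((-1 : O).norm - 9 : ℤ) : O) = -8 by decide +kernel, map_neg, map_ofNat] at h2
  linear_combination h2 / 8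

/-- The fixed point of an element is unique if its eigenvalue is simple. -/
theorem SU.fixedSet_eq {A : SU} {p : Fin 3 → ℂ} {c : ℂ} (hp : (herm p p).re < 0)
    (h : mC A.m *ᵥ p = c • p) (hA : A ≠ 1) (hc : A.m.trace ≠ -1 ∨ c ≠ -1) :
    fixedSet (phi A) = {pt p hp} := by
  ext x
  constructor
  · rintro ⟨hx, hfix⟩
    obtain ⟨q, hq, rfl⟩ := exists_eq_pt hx
    obtain ⟨d, hd⟩ := (phi_smul_pt_eq_iff A hq).1 hfix
    have hcd : d = c := by
      have h1 := herm_mulVec A q p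
      rw [h, hd, herm_smul_left, herm_smul_right, ← mul_assoc] at h1
      have h2 : d * star c = 1 :=
        mul_right_cancel₀ (herm_ne_zero_of_neg hp hq) (by rw [h1, one_mul])
      have h3 : c * star c = 1 := by
        rw [Complex.star_def, Complex.mul_conj, SU.normSq_eigenvalue hp.ne h]; simp
      have h4 : star c ≠ 0 := right_ne_zero_of_mul_eq_one h3
      exact mul_right_cancel₀ h4 (by rw [h2, h3])
    by_contra hne
    have := SU.trace_of_double hp h (hcd ▸ hd)
      (fun a ha => hne (pt_eq_pt.2 ⟨a, ha⟩)) hA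
    tauto
  · rintro rfl
    exact ⟨pt_mem_H2 hp, (phi_smul_pt_eq_iff A hp).2 ⟨c, h⟩⟩

/-! ### Isolated fixed points -/

theorem hdist_pt {v w : Fin 3 → ℂ} (hv : (herm v v).re < 0) (hw : (herm w w).re < 0) :
    hdist (pt v hv) (pt w hw) =
      2 * Real.arcosh (‖herm v w‖ / Real.sqrt ((herm v v).re * (herm w w).re)) := by
  obtain ⟨a, ha⟩ := Projectivization.exists_smul_eq_mk_rep ℂ v (ne_zero_of_neg hv)
  obtain ⟨b, hb⟩ := Projectivization.exists_smul_eq_mk_rep ℂ w (ne_zero_of_neg hw)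
  have ha' : (pt v hv).rep = (a : ℂ) • v := ha.symm
  have hb' : (pt w hw).rep = (b : ℂ) • w := hb.symm
  unfold hdist
  rw [ha', hb', herm_smul_self, herm_smul_self, herm_smul_left, herm_smul_right]
  congr 2
  have h1 : Complex.normSq a * (herm v v).re * (Complex.normSq b * (herm w w).re) =
      (‖(a : ℂ)‖ * ‖(b : ℂ)‖) ^ 2 * ((herm v v).re * (herm w w).re) := by
    rw [Complex.normSq_eq_norm_sq, Complex.normSq_eq_norm_sq]; ring
  rw [h1, Real.sqrt_mul (by positivity), Real.sqrt_sq (by positivity), norm_mul, norm_mul,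
    norm_star, ← mul_assoc]
  refine mul_div_mul_left _ _ ?_
  simp

theorem herm_add_smul_self (p u : Fin 3 → ℂ) (δ : ℝ) :
    (herm (p + (δ : ℂ) • u) (p + (δ : ℂ) • u)).re =
      (herm p p).re + 2 * δ * (herm p u).re + δ ^ 2 * (herm u u).re := by
  simp only [herm_add_left, herm_add_right, herm_smul_left, herm_smul_right]
  rw [← star_herm p u]
  simp only [Complex.add_re, Complex.mul_re, Complex.star_def, Complex.conj_re, Complex.conj_im,
    Complex.ofReal_re, Complex.ofReal_im]
  ring

open Filter Topology in
theorem eventually_neg {p : Fin 3 → ℂ} (hp : (herm p p).re < 0) (u : Fin 3 → ℂ) :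
    ∀ᶠ δ : ℝ in 𝓝 0, (herm (p + (δ : ℂ) • u) (p + (δ : ℂ) • u)).re < 0 := by
  simp only [herm_add_smul_self]
  have : ContinuousAt (fun δ : ℝ => (herm p p).re + 2 * δ * (herm p u).re + δ ^ 2 * (herm u u).re)
    0 := by fun_prop
  exact this.eventually (gt_mem_nhds (by simpa using hp))

theorem exists_neg_add_smul {p : Fin 3 → ℂ} (hp : (herm p p).re < 0) (u : Fin 3 → ℂ) :
    ∃ δ : ℝ, δ ≠ 0 ∧ (herm (p + (δ : ℂ) • u) (p + (δ : ℂ) • u)).re < 0 := by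
  have := ((eventually_neg hp u).filter_mono nhdsWithin_le_nhds).and
    (self_mem_nhdsWithin (s := Set.Ioi (0 : ℝ)))
  obtain ⟨δ, h, h'⟩ := this.exists
  exact ⟨δ, ne_of_gt h', h⟩

open Filter Topology in
theorem not_isIsolatedFixedPoint {A : SU} {p q : Fin 3 → ℂ} {c : ℂ} (hp : (herm p p).re < 0)
    (h : mC A.m *ᵥ p = c • p) (hq : mC A.m *ᵥ q = c • q) (hpq : ∀ a : ℂ, q ≠ a • p) :
    ¬ IsIsolatedFixedPoint (phi A) (pt p hp) := by
  rintro ⟨-, ε, hε, hall⟩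
  have hs : (‖herm p p‖ / Real.sqrt ((herm p p).re * (herm p p).re)) = 1 := by
    rw [Real.sqrt_mul_self_eq_abs, herm_self_eq p, Complex.norm_real, Complex.ofReal_re,
      Real.norm_eq_abs, div_self]
    exact abs_ne_zero.2 hp.ne
  have hpos : Real.sqrt ((herm p p).re * (herm p p).re) ≠ 0 := by
    rw [Real.sqrt_mul_self_eq_abs]; exact abs_ne_zero.2 hp.ne
  set f : ℝ → ℝ := fun δ => ‖herm p (p + (δ : ℂ) • q)‖ /
    Real.sqrt ((herm p p).re * (herm (p + (δ : ℂ) • q) (p + (δ : ℂ) • q)).re) with hf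
  have hf0 : f 0 = 1 := by simpa [hf] using hs
  have hfc : ContinuousAt f 0 := by
    have hfe : f = fun δ : ℝ => ‖herm p p + star (δ : ℂ) * herm p q‖ /
        Real.sqrt ((herm p p).re * ((herm p p).re + 2 * δ * (herm p q).re +
          δ ^ 2 * (herm q q).re)) := by
      funext δ
      simp only [hf, herm_add_smul_self]
      rw [herm_add_right, herm_smul_right]
    rw [hfe]
    refine ContinuousAt.div (by fun_prop) (by fun_prop) ?_
    simpa using hpos
  have hcont : ContinuousAt (fun δ => 2 * Real.arcosh (f δ)) 0 := by
    unfold Real.arcosh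
    refine ContinuousAt.mul continuousAt_const (ContinuousAt.log (ContinuousAt.add hfc
      (((hfc.pow 2).sub continuousAt_const).sqrt)) ?_)
    simp [hf0]
  have h1 : ∀ᶠ δ in 𝓝 (0 : ℝ), 2 * Real.arcosh (f δ) < ε :=
    hcont.eventually (gt_mem_nhds (by simpa [hf0] using hε))
  have h2 := (((eventually_neg hp q).and h1).filter_mono nhdsWithin_le_nhds).and
    (self_mem_nhdsWithin (s := Set.Ioi (0 : ℝ)))
  obtain ⟨δ, ⟨hneg, hlt⟩, hpos⟩ := h2.exists
  have hδ : (δ : ℂ) ≠ 0 := by exact_mod_cast (ne_of_gt hpos)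
  have h3 := hall (pt _ hneg) ⟨pt_mem_H2 _, (phi_smul_pt_eq_iff A _).2 ⟨c, by
    rw [mulVec_add, mulVec_smul, h, hq, smul_add, smul_comm]⟩⟩ (by rw [hdist_pt]; exact hlt)
  obtain ⟨a, ha⟩ := pt_eq_pt.1 h3
  refine hpq ((δ : ℂ)⁻¹ * (a - 1)) ?_
  rw [mul_smul, sub_smul, one_smul, ← ha, add_sub_cancel_left, smul_smul, inv_mul_cancel₀ hδ,
    one_smul]

theorem isIsolatedFixedPoint_of_eq {γ : PicardGroup} {p : P2} (h : fixedSet γ = {p}) :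
    IsIsolatedFixedPoint γ p := by
  refine ⟨by rw [h]; rfl, 1, one_pos, fun q hq _ => ?_⟩
  rwa [h] at hq

/-! ### Polar lines -/

theorem exists_neg_orthogonal {v : Fin 3 → ℂ} (hv : 0 < (herm v v).re) :
    ∃ p, (herm p p).re < 0 ∧ herm p v = 0 := by
  have hvv : herm v v ≠ 0 := fun h0 => by rw [h0] at hv; simp at hv
  set n : Fin 3 → ℂ := ![1, 0, -1] with hn
  have hnn : (herm n n).re < 0 := by simp [hn, herm_eq]
  refine ⟨n - (herm n v / herm v v) • v, ?_, ?_⟩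
  · have h1 : herm (n - (herm n v / herm v v) • v) v = 0 := by
      rw [herm_sub_left, herm_smul_left, div_mul_cancel₀ _ hvv, sub_self]
    have h2 : n = (n - (herm n v / herm v v) • v) + (herm n v / herm v v) • v := by abel
    have h3 := congrArg (fun x => (herm x x).re) h2
    simp only [herm_add_left _ ((herm n v / herm v v) • v),
      herm_add_right _ _ ((herm n v / herm v v) • v)] at h3
    rw [herm_smul_right, h1, mul_zero, add_zero, herm_smul_left, herm_comm_eq_zero h1, mul_zero,
      zero_add, Complex.add_re, herm_smul_self] at h3
    have := Complex.normSq_nonneg (herm n v / herm v v)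
    nlinarith
  · rw [herm_sub_left, herm_smul_left, div_mul_cancel₀ _ hvv, sub_self]

theorem eq_smul_of_polarLine_subset {p v w : Fin 3 → ℂ} (hp : (herm p p).re < 0)
    (hpv : herm p v = 0) (hv : v ≠ 0) (h : polarLine v ⊆ polarLine w) : ∃ c : ℂ, w = c • v := by
  have hvv := herm_self_pos hp (herm_comm_eq_zero hpv) hv
  have hvv' : herm v v ≠ 0 := fun h0 => by rw [h0] at hvv; simp at hvv
  set u := w - (herm w v / herm v v) • v with hu
  have huv : herm u v = 0 := by
    rw [hu, herm_sub_left, herm_smul_left, div_mul_cancel₀ _ hvv', sub_self]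
  have hpw : herm p w = 0 := pt_mem_polarLine.1 (h (pt_mem_polarLine (hv := hp).2 hpv))
  have hup : herm u p = 0 := by
    rw [hu, herm_sub_left, herm_smul_left, herm_comm_eq_zero hpv, herm_comm_eq_zero hpw]; ring
  obtain ⟨δ, hδ, hneg⟩ := exists_neg_add_smul hp u
  have h1 : herm (p + (δ : ℂ) • u) w = 0 := by
    refine pt_mem_polarLine.1 (h (pt_mem_polarLine (hv := hneg).2 ?_))
    rw [herm_add_left, herm_smul_left, hpv, huv]; ring
  rw [herm_add_left, herm_smul_left, hpw, zero_add] at h1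
  have h2 : herm u w = 0 := (mul_eq_zero.1 h1).resolve_left (by exact_mod_cast hδ)
  have h3 : herm u u = 0 := by
    have : u = w + (-(herm w v / herm v v)) • v := by rw [hu]; rw [neg_smul]; abel
    conv_lhs => rw [this, herm_add_right, ← this, herm_smul_right, huv, h2]
    ring
  by_contra hne
  have h4 : u ≠ 0 := fun h0 => hne ⟨_, sub_eq_zero.1 h0⟩
  have := herm_self_pos hp hup h4
  rw [h3] at this
  simp at this

theorem polarLine_smul {c : ℂ} (hc : c ≠ 0) (v : Fin 3 → ℂ) : polarLine (c • v) = polarLine v := by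
  ext p
  constructor
  · rintro ⟨h1, h2⟩
    refine ⟨h1, fun w hw => ?_⟩
    have := h2 w hw
    rw [herm_smul_right] at this
    exact (mul_eq_zero.1 this).resolve_left (star_ne_zero.2 hc)
  · rintro ⟨h1, h2⟩
    refine ⟨h1, fun w hw => ?_⟩
    rw [herm_smul_right, h2 w hw, mul_zero]

theorem phi_image_polarLine (A : SU) (v : Fin 3 → ℂ) :
    (fun q => phi A • q) '' polarLine v = polarLine (mC A.m *ᵥ v) := by
  ext p
  constructor
  · rintro ⟨q, hq, rfl⟩
    obtain ⟨w, hw, rfl⟩ := exists_eq_pt hq.1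
    change phi A • pt w hw ∈ _
    rw [phi_smul_pt, pt_mem_polarLine, herm_mulVec]
    exact pt_mem_polarLine.1 hq
  · intro hp
    obtain ⟨w, hw, rfl⟩ := exists_eq_pt hp.1
    have h1 : mC A.m *ᵥ (mC (A⁻¹).m *ᵥ w) = w := by
      rw [mulVec_mulVec, ← map_mul, A.m_mul_inv, map_one, one_mulVec]
    refine ⟨phi A⁻¹ • pt w hw, ?_, ?_⟩
    · rw [phi_smul_pt, pt_mem_polarLine, ← herm_mulVec A, h1]
      exact pt_mem_polarLine.1 hp
    · change phi A • phi A⁻¹ • pt w hw = _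
      rw [smul_smul, ← map_mul, mul_inv_cancel, map_one, one_smul]

/-! ### Complex reflections -/

/-- A complex reflection has trace `-1`, and its mirror consists of eigenvectors for `-1`. -/
theorem trace_of_isComplexReflection {A : SU} (h : IsComplexReflection (phi A)) :
    A ≠ 1 ∧ ∃ p, (herm p p).re < 0 ∧ mC A.m *ᵥ p = (-1 : ℂ) • p ∧ A.m.trace = -1 := by
  obtain ⟨hne, v, hv, hsub⟩ := h
  have hA : A ≠ 1 := by rintro rfl; exact hne (map_one phi)
  obtain ⟨p, hp, hpv⟩ := exists_neg_orthogonal hv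
  obtain ⟨u, hu0, hup, huv⟩ := exists_herm_eq_zero p v
  obtain ⟨δ, hδ, hneg⟩ := exists_neg_add_smul hp u
  have hδ' : (δ : ℂ) ≠ 0 := by exact_mod_cast hδ
  obtain ⟨c, hc⟩ := (phi_smul_pt_eq_iff A hp).1 (hsub (pt_mem_polarLine (hv := hp).2 hpv)).2
  obtain ⟨d, hd⟩ := (phi_smul_pt_eq_iff A hneg).1 (hsub (pt_mem_polarLine (hv := hneg).2 (by
    rw [herm_add_left, herm_smul_left, hpv, huv]; ring))).2
  have hcd : d = c := by
    have h1 := herm_mulVec A (p + (δ : ℂ) • u) p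
    rw [hc, hd, herm_smul_left, herm_smul_right, ← mul_assoc] at h1
    have h2 : d * star c = 1 :=
      mul_right_cancel₀ (herm_ne_zero_of_neg hp hneg) (by rw [h1, one_mul])
    have h3 : c * star c = 1 := by
      rw [Complex.star_def, Complex.mul_conj, SU.normSq_eigenvalue hp.ne hc]; simp
    exact mul_right_cancel₀ (right_ne_zero_of_mul_eq_one h3) (by rw [h2, h3])
  have hu : mC A.m *ᵥ u = c • u := by
    rw [hcd, mulVec_add, mulVec_smul, hc, smul_add, add_right_inj, smul_comm] at hd
    exact smul_right_injective _ hδ' hd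
  have hpu : ∀ a : ℂ, u ≠ a • p := by
    rintro a rfl
    rw [herm_smul_left] at hup
    have ha := (mul_eq_zero.1 hup).resolve_right (fun h0 => by rw [h0] at hp; simp at hp)
    exact hu0 (by rw [ha, zero_smul])
  obtain ⟨h1, h2⟩ := SU.trace_of_double hp hc hu hpu hA
  exact ⟨hA, p, hp, h2 ▸ hc, h1⟩

/-- The fixed points of the reflection in the positive vector `v`. -/
theorem fixedSet_eq_polarLine {A : SU} {v : Fin 3 → ℂ} {N : ℂ} (hv : 0 < (herm v v).re)
    (h : ∀ y, N • (mC A.m *ᵥ y) = (2 * herm y v) • v - N • y) (hN : N ≠ 0) :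
    fixedSet (phi A) = polarLine v := by
  ext p
  constructor
  · rintro ⟨hp, hfix⟩
    obtain ⟨y, hy, rfl⟩ := exists_eq_pt hp
    obtain ⟨c, hc⟩ := (phi_smul_pt_eq_iff A hy).1 hfix
    rw [pt_mem_polarLine]
    by_contra h0
    have h1 := h y
    rw [hc, eq_sub_iff_add_eq, smul_smul, ← add_smul] at h1
    have h2 : v = ((2 * herm y v)⁻¹ * (N * c + N)) • y := by
      rw [mul_smul, h1, smul_smul, inv_mul_cancel₀ (mul_ne_zero two_ne_zero h0), one_smul]
    rw [h2, herm_smul_self] at hv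
    have := Complex.normSq_nonneg ((2 * herm y v)⁻¹ * (N * c + N))
    nlinarith
  · intro hp
    obtain ⟨y, hy, rfl⟩ := exists_eq_pt hp.1
    rw [pt_mem_polarLine] at hp
    refine ⟨pt_mem_H2 hy, (phi_smul_pt_eq_iff A hy).2 ⟨-1, ?_⟩⟩
    apply smul_right_injective _ hN
    change N • _ = N • _
    rw [h, hp]
    simp

/-! ### Finite subgroups have fixed points -/

/-- The standard positive definite form. -/
def euclid (x : Fin 3 → ℂ) : ℝ := ∑ i, Complex.normSq (x i)

theorem euclid_pos {x : Fin 3 → ℂ} (hx : x ≠ 0) : 0 < euclid x := by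
  obtain ⟨i, hi⟩ := Function.ne_iff.1 hx
  exact Finset.sum_pos' (fun _ _ => Complex.normSq_nonneg _)
    ⟨i, Finset.mem_univ _, Complex.normSq_pos.2 hi⟩

theorem euclid_smul (c : ℂ) (x : Fin 3 → ℂ) : euclid (c • x) = Complex.normSq c * euclid x := by
  simp [euclid, Finset.mul_sum]

theorem euclid_parallelogram (x y : Fin 3 → ℂ) :
    euclid (x + y) + euclid (x - y) = 2 * euclid x + 2 * euclid y := by
  simp only [euclid, Fin.sum_univ_three, Pi.add_apply, Pi.sub_apply, Complex.normSq_apply,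
    Complex.add_re, Complex.add_im, Complex.sub_re, Complex.sub_im]
  ring

theorem herm_parallelogram (x y : Fin 3 → ℂ) :
    (herm (x + y) (x + y)).re + (herm (x - y) (x - y)).re =
      2 * (herm x x).re + 2 * (herm y y).re := by
  rw [sub_eq_add_neg, ← neg_one_smul ℂ y]
  simp only [herm_add_left, herm_add_right, herm_smul_left, herm_smul_right]
  simp
  ring

theorem exists_fixed_of_finite (G : Subgroup SU) [Finite G] :
    ∃ p, (herm p p).re < 0 ∧ ∀ A ∈ G, ∃ c : ℂ, mC A.m *ᵥ p = c • p := by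
  have := Fintype.ofFinite G
  set F : (Fin 3 → ℂ) → ℝ := fun x => ∑ A : G, euclid (mC A.1.m *ᵥ x) with hF
  have hFpos : ∀ x, x ≠ 0 → 0 < F x := fun x hx =>
    Finset.sum_pos (fun A _ => euclid_pos (mC_mulVec_ne_zero A.1 hx)) ⟨1, Finset.mem_univ _⟩
  have hFsmul : ∀ (c : ℂ) x, F (c • x) = Complex.normSq c * F x := by
    intro c x
    simp only [hF, mulVec_smul, euclid_smul, Finset.mul_sum]
  have hFinv : ∀ B ∈ G, ∀ x, F (mC B.m *ᵥ x) = F x := by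
    intro B hB x
    simp only [hF, mulVec_mulVec, ← map_mul, ← SU.m_mul]
    exact Fintype.sum_equiv (Equiv.mulRight (⟨B, hB⟩ : G)) _ _ fun A => rfl
  have hFpar : ∀ x y, F (x + y) + F (x - y) = 2 * F x + 2 * F y := by
    intro x y
    simp only [hF, mulVec_add, mulVec_sub, Finset.mul_sum, ← Finset.sum_add_distrib,
      euclid_parallelogram]
  have hFcont : Continuous F := by
    simp only [hF, euclid]
    fun_prop (disch := exact Complex.continuous_normSq)
  have hherm : Continuous fun x : Fin 3 → ℂ => (herm x x).re := by
    simp only [herm_eq]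
    fun_prop
  obtain ⟨p, hp1, hmin⟩ := (isCompact_sphere (0 : Fin 3 → ℂ) 1).exists_isMinOn
    (f := fun x => (herm x x).re / F x) (NormedSpace.sphere_nonempty.2 zero_le_one)
    (ContinuousOn.div hherm.continuousOn hFcont.continuousOn fun x hx =>
      (hFpos x (ne_zero_of_mem_unit_sphere ⟨x, hx⟩)).ne')
  have hp0 : p ≠ 0 := ne_zero_of_mem_unit_sphere ⟨p, hp1⟩
  set m := (herm p p).re / F p with hm
  have hall : ∀ x, x ≠ 0 → m * F x ≤ (herm x x).re := by
    intro x hx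
    have hnx : (‖x‖ : ℂ) ≠ 0 := by exact_mod_cast norm_ne_zero_iff.2 hx
    have h1 := hmin (a := ((‖x‖ : ℂ)⁻¹) • x) (by
      rw [mem_sphere_zero_iff_norm, norm_smul, norm_inv, Complex.norm_real, norm_norm,
        inv_mul_cancel₀ (norm_ne_zero_iff.2 hx)])
    have h2 : 0 < Complex.normSq (‖x‖ : ℂ)⁻¹ := Complex.normSq_pos.2 (inv_ne_zero hnx)
    simp only [Set.mem_ofPred_eq, hFsmul, herm_smul_self] at h1
    rw [mul_div_mul_left _ _ h2.ne', le_div_iff₀ (hFpos x hx)] at h1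
    exact h1
  have hp : (herm p p).re < 0 := by
    have hn : (herm (![1, 0, -1] : Fin 3 → ℂ) ![1, 0, -1]).re < 0 := by simp [herm_eq]
    have h1 := hall _ (ne_zero_of_neg hn)
    have h2 := hFpos _ (ne_zero_of_neg hn)
    have h3 : m < 0 := by nlinarith
    rw [hm, div_neg_iff] at h3
    have := hFpos p hp0
    rcases h3 with h | h
    · linarith
    · exact h.1
  have hmp : m * F p = (herm p p).re := div_mul_cancel₀ _ (hFpos p hp0).ne'
  refine ⟨p, hp, fun A hA => ?_⟩
  set q := mC A.m *ᵥ p with hq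
  have hpp : herm p p ≠ 0 := fun h0 => by rw [h0] at hp; simp at hp
  have hqq : m * F q = (herm q q).re := by rw [hq, hFinv A hA, herm_mulVec, hmp]
  refine ⟨herm q p / herm p p, ?_⟩
  set a := herm q p / herm p p with ha
  by_contra hne
  have h0 : q - a • p ≠ 0 := sub_ne_zero.2 hne
  have h1 : herm (q - a • p) p = 0 := by
    rw [herm_sub_left, herm_smul_left, ha, div_mul_cancel₀ _ hpp, sub_self]
  have h2 := herm_self_pos hp h1 h0
  have h3 := hFpar q (a • p)
  have h4 := herm_parallelogram q (a • p)
  rw [hFsmul] at h3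
  rw [herm_smul_self] at h4
  have h5 := hall _ h0
  have h6 : m * F (q + a • p) ≤ (herm (q + a • p) (q + a • p)).re := by
    by_cases h7 : q + a • p = 0
    · rw [h7]; simp [herm_zero_left, hF, euclid]
    · exact hall _ h7
  have h7 : m < 0 := by
    have := hFpos p hp0
    nlinarith
  have h8 := hFpos _ h0
  have h9 : m * F (q + a • p) + m * F (q - a • p) =
      (herm (q + a • p) (q + a • p)).re + (herm (q - a • p) (q - a • p)).re := by
    rw [← mul_add, h3, h4, ← hqq, ← hmp]; ring
  nlinarith

/-! ### The Hermitian form over the ring of integers -/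

theorem hO_add_left (x y z : V3) : hO (x + y) z = hO x z + hO y z := by
  simp only [hO_eq, Pi.add_apply]; ring

theorem hO_add_right (x y z : V3) : hO x (y + z) = hO x y + hO x z := by
  simp only [hO_eq, Pi.add_apply, star_add]; ring

theorem hO_smul_left (c : O) (x y : V3) : hO (c • x) y = c * hO x y := by
  simp only [hO_eq, Pi.smul_apply, smul_eq_mul]; ring

theorem hO_smul_right (c : O) (x y : V3) : hO x (c • y) = star c * hO x y := by
  simp only [hO_eq, Pi.smul_apply, smul_eq_mul, star_mul]; ring

theorem hO_neg_left (x y : V3) : hO (-x) y = -hO x y := by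
  simp only [hO_eq, Pi.neg_apply]; ring

theorem hO_neg_right (x y : V3) : hO x (-y) = -hO x y := by
  simp only [hO_eq, Pi.neg_apply, star_neg]; ring

theorem hO_sub_left (x y z : V3) : hO (x - y) z = hO x z - hO y z := by
  simp only [hO_eq, Pi.sub_apply]; ring

theorem hO_zero_left (x : V3) : hO 0 x = 0 := by simp [hO_eq]

theorem star_hO (x y : V3) : star (hO x y) = hO y x := by
  simp only [hO_eq, star_add, star_mul, star_star]; ring

theorem exists_hO_self (x : V3) : ∃ n : ℤ, hO x x = n :=
  ⟨_, O.star_eq_self (star_hO x x)⟩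

/-! ### Bases -/

/-- The matrix with the given columns. -/
def cols (u w z : V3) : M3 := !![u 0, w 0, z 0; u 1, w 1, z 1; u 2, w 2, z 2]

theorem cols_mulVec (u w z c : V3) : cols u w z *ᵥ c = c 0 • u + c 1 • w + c 2 • z := by
  ext i <;> fin_cases i <;> simp [cols, mulVec, dotProduct, Fin.sum_univ_three] <;> ring

theorem mul_cols (A : M3) (u w z : V3) : A * cols u w z = cols (A *ᵥ u) (A *ᵥ w) (A *ᵥ z) := by
  refine Matrix.ext fun i j => ?_
  fin_cases j <;> fin_cases i <;>
    simp [cols, mulVec, dotProduct, Matrix.mul_apply, Fin.sum_univ_three]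

theorem gram_cols (u w z : V3) : (cols u w z)ᴴ * J0 * cols u w z =
    !![hO u u, hO w u, hO z u; hO u w, hO w w, hO z w; hO u z, hO w z, hO z z] := by
  refine Matrix.ext fun i j => ?_
  fin_cases j <;> fin_cases i <;>
    simp [cols, J0, Matrix.mul_apply, Fin.sum_univ_three, conjTranspose_apply, hO_eq] <;> ring

theorem star_mul_self_of_isUnit {d : O} (hd : IsUnit d) : star d * d = 1 := by
  rcases O.isUnit_iff.1 hd with rfl | rfl <;> simp

theorem det_gram_of_isUnit {B : M3} (hB : IsUnit B.det) : (Bᴴ * J0 * B).det = -1 := by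
  have hJ : J0.det = -1 := by decide +kernel
  rw [det_mul, det_mul, det_conjTranspose, hJ]
  linear_combination -star_mul_self_of_isUnit hB

theorem det_gram (B : M3) : (Bᴴ * J0 * B).det = -(B.det.norm : O) := by
  have hJ : J0.det = -1 := by decide +kernel
  rw [det_mul, det_mul, det_conjTranspose, hJ, ← O.mul_star]
  ring

/-- `v` is fixed by `A`, and `u, w, z` is a basis of the lattice in which `⟨·, v⟩` is the last
coordinate. -/
structure IsFrame (A : SU) (v u w z : V3) : Prop where
  fix : A.m *ᵥ v = v
  hu : hO u v = 0
  hw : hO w v = 0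
  hz : hO z v = 1
  det : IsUnit (cols u w z).det

theorem det_cols (u w z : V3) : (cols u w z).det = u 0 * w 1 * z 2 - u 0 * w 2 * z 1 -
    u 1 * w 0 * z 2 + u 1 * w 2 * z 0 + u 2 * w 0 * z 1 - u 2 * w 1 * z 0 := by
  simp [cols, det_fin_three]; ring

theorem exists_coords {B : M3} (hB : IsUnit B.det) (x : V3) : ∃ c, B *ᵥ c = x :=
  ⟨B⁻¹ *ᵥ x, by rw [mulVec_mulVec, mul_nonsing_inv _ hB, one_mulVec]⟩

theorem exists_basis_of_primitive {v x : V3} (h : hO x v = 1) :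
    ∃ u w z, hO u v = 0 ∧ hO w v = 0 ∧ hO z v = 1 ∧ IsUnit (cols u w z).det := by
  obtain ⟨g, a, b, s, t, ha, hb, hst⟩ := O.exists_bezout (star (v 2)) (star (v 1))
  obtain ⟨g', c, d, p, q, hg, hd, hpq⟩ := O.exists_bezout g (star (v 0))
  have hg' : g' ∣ 1 := ⟨c * (a * x 0 + b * x 1) + d * x 2, by
    rw [← h, hO_eq, ha, hb, hd, hg]; ring⟩
  have hu : IsUnit g' := isUnit_of_dvd_one hg'
  have hgg : g' * g' = 1 := by rcases O.isUnit_iff.1 hu with rfl | rfl <;> simp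
  refine ⟨![-b, a, 0], ![-d * s, -d * t, c], ![g' * p * s, g' * p * t, g' * q], ?_, ?_, ?_, ?_⟩
  · simp only [hO_eq]; simp; rw [ha, hb]; ring
  · simp only [hO_eq]; simp; rw [ha, hb, hd, hg]; linear_combination (-g' * c * d) * hst
  · simp only [hO_eq]; simp; rw [ha, hb, hd, hg]
    linear_combination (g' * g' * p * c) * hst + g' * g' * hpq + hgg
  · have : (cols ![-b, a, 0] ![-d * s, -d * t, c] ![g' * p * s, g' * p * t, g' * q]).det = g' := by
      rw [det_cols]; simp
      linear_combination (g' * (p * c + q * d)) * hst + g' * hpq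
    rwa [this]

theorem exists_primitive {x : V3} (hx : x ≠ 0) : ∃ (g : O) (v y : V3), g ≠ 0 ∧ x = g • v ∧ hO y v = 1 := by
  obtain ⟨g, a, b, s, t, ha, hb, hst⟩ := O.exists_bezout (x 0) (x 1)
  obtain ⟨g', c, d, p, q, hg, hd, hpq⟩ := O.exists_bezout g (x 2)
  have hx' : x = g' • ![c * a, c * b, d] := by
    ext i <;> fin_cases i <;> simp [ha, hb, hg, hd] <;> ring
  refine ⟨g', _, ![star q, star (p * t), star (p * s)], ?_, hx', ?_⟩
  · rintro rfl; exact hx (by rw [hx', zero_smul])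
  · have : hO ![c * a, c * b, d] ![star q, star (p * t), star (p * s)] = 1 := by
      simp [hO_eq]
      linear_combination (p * c) * hst + hpq
    rw [← star_hO, this, star_one]

/-! ### Frames -/

namespace IsFrame

variable {A A' : SU} {v u w z v' u' w' z' : V3}

theorem exists_coords (h : IsFrame A v u w z) (x : V3) :
    ∃ a b : O, x = a • u + b • w + hO x v • z := by
  obtain ⟨c, hc⟩ := Picard7.exists_coords h.det x
  rw [cols_mulVec] at hc
  refine ⟨c 0, c 1, ?_⟩
  have : hO x v = c 2 := by
    rw [← hc, hO_add_left, hO_add_left, hO_smul_left, hO_smul_left, hO_smul_left, h.hu, h.hw, h.hz]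
    ring
  rw [this, hc]

theorem exists_coords_perp (h : IsFrame A v u w z) {x : V3} (hx : hO x v = 0) :
    ∃ a b : O, x = a • u + b • w := by
  obtain ⟨a, b, hab⟩ := h.exists_coords x
  exact ⟨a, b, by rw [hx, zero_smul, add_zero] at hab; exact hab⟩

theorem coords_inj (h : IsFrame A v u w z) {a b c d : O} (he : a • u + b • w = c • u + d • w) :
    a = c ∧ b = d := by
  have h1 : cols u w z *ᵥ ![a, b, 0] = cols u w z *ᵥ ![c, d, 0] := by
    rw [cols_mulVec, cols_mulVec]; simpa using he
  have h2 := mulVec_injective_of_isUnit ((isUnit_iff_isUnit_det _).2 h.det) h1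
  exact ⟨congrFun h2 0, congrFun h2 1⟩

theorem hO_map (h : IsFrame A v u w z) (x : V3) : hO (A.m *ᵥ x) v = hO x v := by
  conv_lhs => rw [← h.fix]
  exact hO_mulVec A x v

/-- The discriminant of the orthogonal complement of `v` is `-⟨v, v⟩`. -/
theorem disc (h : IsFrame A v u w z) : hO u u * hO w w - hO w u * hO u w = -hO v v := by
  obtain ⟨a, b, hab⟩ := h.exists_coords v
  have h1 := h.hu
  have h2 := h.hw
  have h3 := h.hz
  have hd := det_gram_of_isUnit h.det
  rw [gram_cols, det_fin_three] at hd
  simp at hd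
  rw [← star_hO] at h1 h2 h3
  have e1 : hO v u = 0 := by simpa using congrArg star h1
  have e2 : hO v w = 0 := by simpa using congrArg star h2
  have e3 : hO v z = 1 := by simpa using congrArg star h3
  rw [hab] at e1 e2 e3
  simp only [hO_add_left, hO_smul_left] at e1 e2 e3
  generalize hO v v = N at *
  linear_combination (hO w w * hO u z - hO u w * hO w z) * e1 -
    (hO w u * hO u z - hO u u * hO w z) * e2 - (hO u u * hO w w - hO w u * hO u w) * e3 + N * hd

/-- The action of `A` in a frame. -/
theorem exists_action (h : IsFrame A v u w z) : ∃ a b c d : O, A.m *ᵥ u = a • u + b • w ∧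
    A.m *ᵥ w = c • u + d • w ∧ a + d = A.m.trace - 1 ∧ a * d - b * c = 1 := by
  obtain ⟨a, b, hu⟩ := h.exists_coords_perp (x := A.m *ᵥ u) (by rw [h.hO_map, h.hu])
  obtain ⟨c, d, hw⟩ := h.exists_coords_perp (x := A.m *ᵥ w) (by rw [h.hO_map, h.hw])
  obtain ⟨e, f, hz⟩ := h.exists_coords (A.m *ᵥ z)
  rw [h.hO_map, h.hz] at hz
  have hX : A.m * cols u w z = cols u w z * !![a, c, e; b, d, f; 0, 0, 1] := by
    rw [mul_cols, hu, hw, hz]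
    refine Matrix.ext fun i j => ?_
    fin_cases j <;> fin_cases i <;>
      simp [cols, Matrix.mul_apply, Fin.sum_univ_three] <;> ring
  have hX' : A.m = cols u w z * !![a, c, e; b, d, f; 0, 0, 1] * (cols u w z)⁻¹ := by
    rw [← hX, mul_assoc, mul_nonsing_inv _ h.det, mul_one]
  refine ⟨a, b, c, d, hu, hw, ?_, ?_⟩
  · rw [hX', trace_mul_comm, ← mul_assoc, nonsing_inv_mul _ h.det, one_mul, trace_fin_three]
    simp
  · have h1 := congrArg Matrix.det hX
    rw [det_mul, det_mul, A.det_m, one_mul] at h1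
    have h2 := h.det.mul_left_cancel ((mul_one _).trans h1)
    rw [h2, det_fin_three]
    simp
    ring

theorem swap (h : IsFrame A v u w z) : IsFrame A v w u z :=
  ⟨h.fix, h.hw, h.hu, h.hz, by
    have : (cols w u z).det = -(cols u w z).det := by rw [det_cols, det_cols]; ring
    rw [this]; exact h.det.neg⟩

theorem shift (h : IsFrame A v u w z) (k : O) : IsFrame A v u (w + k • u) z :=
  ⟨h.fix, h.hu, by rw [hO_add_left, hO_smul_left, h.hu, h.hw]; ring, h.hz, by
    have : (cols u (w + k • u) z).det = (cols u w z).det := by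
      rw [det_cols, det_cols]; simp only [Pi.add_apply, Pi.smul_apply, smul_eq_mul]; ring
    rw [this]; exact h.det⟩

theorem smul_right (h : IsFrame A v u w z) {k : O} (hk : IsUnit k) : IsFrame A v u (k • w) z :=
  ⟨h.fix, h.hu, by rw [hO_smul_left, h.hw, mul_zero], h.hz, by
    have : (cols u (k • w) z).det = k * (cols u w z).det := by
      rw [det_cols, det_cols]; simp only [Pi.smul_apply, smul_eq_mul]; ring
    rw [this]; exact hk.mul h.det⟩

theorem shift_last (h : IsFrame A v u w z) (k l : O) : IsFrame A v u w (z + k • u + l • w) :=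
  ⟨h.fix, h.hu, h.hw, by
    rw [hO_add_left, hO_add_left, hO_smul_left, hO_smul_left, h.hu, h.hw, h.hz]; ring, by
    have : (cols u w (z + k • u + l • w)).det = (cols u w z).det := by
      rw [det_cols, det_cols]; simp only [Pi.add_apply, Pi.smul_apply, smul_eq_mul]; ring
    rw [this]; exact h.det⟩

/-- If `A u` is `a u + b w` with `b` a unit, then `w` can be replaced with `A u`. -/
theorem replace (h : IsFrame A v u w z) {a b : O} (hu : A.m *ᵥ u = a • u + b • w) (hb : IsUnit b) :
    IsFrame A v u (A.m *ᵥ u) z := by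
  rw [hu, add_comm]
  exact (h.smul_right hb).shift a

end IsFrame

/-! ### Conjugacy -/

theorem isUnit_of_det_cols_ne_zero {x : V3} {M : M3} (hM : M.det ≠ 0) (h : M *ᵥ x = 0) : x = 0 := by
  by_contra hx
  exact hM (exists_mulVec_eq_zero_iff.1 ⟨x, hx, h⟩)

/-- Two elements of the group with the same Gram matrix and the same action in suitable
coordinates are conjugate. -/
theorem isConj_of_gram {A A' : SU} {B B' Y Z : M3} (hB : IsUnit B.det) (hB' : IsUnit B'.det)
    (hG : Bᴴ * J0 * B = B'ᴴ * J0 * B') (hY : Y.det ≠ 0) (hA : A.m * (B * Y) = B * Z)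
    (hA' : A'.m * (B' * Y) = B' * Z) : IsConj A A' := by
  have hBi : B * B⁻¹ = 1 := mul_nonsing_inv _ hB
  have hBi' : B⁻¹ * B = 1 := nonsing_inv_mul _ hB
  have hCu : ∀ d : O, star d * d = 1 → (d • (B' * B⁻¹))ᴴ * J0 * (d • (B' * B⁻¹)) = J0 := by
    intro d hd
    calc _ = (star d * d) • ((B⁻¹)ᴴ * (B'ᴴ * J0 * B') * B⁻¹) := by
          rw [conjTranspose_smul, conjTranspose_mul, smul_mul_assoc, smul_mul_assoc,
            mul_smul_comm, smul_smul]
          simp only [mul_assoc]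
      _ = (B * B⁻¹)ᴴ * J0 * (B * B⁻¹) := by
          rw [hd, one_smul, ← hG, conjTranspose_mul]
          simp only [mul_assoc]
      _ = J0 := by rw [hBi]; simp
  have hdet : ∃ d : O, star d * d = 1 ∧ (d • (B' * B⁻¹)).det = 1 := by
    have h1 : IsUnit (B' * B⁻¹).det := by
      rw [det_mul]; exact hB'.mul ((isUnit_nonsing_inv_det_iff).2 hB)
    rcases O.isUnit_iff.1 h1 with h | h
    · exact ⟨1, by simp, by rw [one_smul, h]⟩
    · exact ⟨-1, by simp, by rw [det_smul, h, Fintype.card_fin]; norm_num⟩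
  obtain ⟨d, hd, hd1⟩ := hdet
  rw [isConj_iff]
  refine ⟨⟨d • (B' * B⁻¹), hd1, hCu d hd⟩, ?_⟩
  rw [mul_inv_eq_iff_eq_mul]
  apply SU.ext
  change d • (B' * B⁻¹) * A.m = A'.m * d • (B' * B⁻¹)
  rw [smul_mul_assoc, mul_smul_comm]
  congr 1
  have h1 : (B' * B⁻¹ * A.m - A'.m * (B' * B⁻¹)) * (B * Y) = 0 := by
    have e1 : B' * B⁻¹ * A.m * (B * Y) = B' * Z := by
      rw [mul_assoc, hA, mul_assoc, ← mul_assoc B⁻¹, hBi', one_mul]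
    have e2 : A'.m * (B' * B⁻¹) * (B * Y) = B' * Z := by
      rw [mul_assoc, mul_assoc B', ← mul_assoc B⁻¹, hBi', one_mul, hA']
    rw [sub_mul, e1, e2, sub_self]
  have h2 : (B * Y).det ≠ 0 := by rw [det_mul]; exact mul_ne_zero hB.ne_zero hY
  have h3 : (B * Y) * (B * Y).adjugate = (B * Y).det • 1 := mul_adjugate _
  have h4 := congrArg (· * (B * Y).adjugate) h1
  simp only [mul_assoc _ (B * Y), h3, zero_mul, mul_smul_comm, mul_one] at h4
  exact sub_eq_zero.1 ((smul_eq_zero.1 h4).resolve_left h2)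

theorem IsFrame.isConj {A A' : SU} {v u w z v' u' w' z' : V3} (h : IsFrame A v u w z)
    (h' : IsFrame A' v' u' w' z') (hv : hO v v ≠ 0) (huu : hO u u = hO u' u')
    (hwu : hO w u = hO w' u') (hww : hO w w = hO w' w') (hzu : hO z u = hO z' u')
    (hzw : hO z w = hO z' w') (hzz : hO z z = hO z' z') {a b c d : O}
    (hu : A.m *ᵥ u = a • u + b • w) (hw : A.m *ᵥ w = c • u + d • w)
    (hu' : A'.m *ᵥ u' = a • u' + b • w') (hw' : A'.m *ᵥ w' = c • u' + d • w') : IsConj A A' := by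
  have hG : (cols u w z)ᴴ * J0 * cols u w z = (cols u' w' z')ᴴ * J0 * cols u' w' z' := by
    rw [gram_cols, gram_cols, huu, hwu, hww, hzu, hzw, hzz, ← star_hO w u, ← star_hO z u,
      ← star_hO z w, hwu, hzu, hzw, star_hO, star_hO, star_hO]
  obtain ⟨y, hy⟩ := Picard7.exists_coords h.det v
  obtain ⟨y', hy'⟩ := Picard7.exists_coords h'.det v'
  have key : ∀ {A : SU} {v u w z y : V3}, IsFrame A v u w z → cols u w z *ᵥ y = v →
      ((cols u w z)ᴴ * J0 * cols u w z) *ᵥ y = ![0, 0, 1] ∧ y 2 = hO v v := by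
    intro A v u w z y h hy
    constructor
    · have e : ∀ x, y 0 * hO u x + y 1 * hO w x + y 2 * hO z x = hO v x := by
        intro x
        rw [← hy, cols_mulVec]
        simp only [hO_add_left, hO_smul_left]
      have e1 := e u
      have e2 := e w
      have e3 := e z
      rw [← star_hO u v, h.hu, star_zero] at e1
      rw [← star_hO w v, h.hw, star_zero] at e2
      rw [← star_hO z v, h.hz, star_one] at e3
      rw [gram_cols]
      funext i
      fin_cases i <;> simp only [mulVec, dotProduct, Fin.sum_univ_three]
      · exact (by simp; ring : _ = _).trans e1
      · exact (by simp; ring : _ = _).trans e2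
      · exact (by simp; ring : _ = _).trans e3
    · have e := congrArg (hO · v) hy
      simp only [cols_mulVec] at e
      rw [← e, hO_add_left, hO_add_left, hO_smul_left, hO_smul_left, hO_smul_left, h.hu, h.hw, h.hz]
      ring
  obtain ⟨k1, k2⟩ := key h hy
  obtain ⟨k1', k2'⟩ := key h' hy'
  have hyy : y = y' := by
    have hdet : ((cols u w z)ᴴ * J0 * cols u w z).det ≠ 0 := by
      rw [det_gram_of_isUnit h.det]; exact neg_ne_zero.2 one_ne_zero
    refine sub_eq_zero.1 (isUnit_of_det_cols_ne_zero hdet ?_)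
    rw [mulVec_sub, k1, hG, k1', sub_self]
  refine isConj_of_gram h.det h'.det hG (Y := !![1, 0, y 0; 0, 1, y 1; 0, 0, y 2])
    (Z := !![a, c, y 0; b, d, y 1; 0, 0, y 2]) ?_ ?_ ?_
  · rw [det_fin_three]; simp; rwa [k2]
  · have e1 : cols u w z * !![1, 0, y 0; 0, 1, y 1; 0, 0, y 2] = cols u w v := by
      rw [← hy, cols_mulVec]
      refine Matrix.ext fun i j => ?_
      fin_cases j <;> fin_cases i <;> simp [cols, Matrix.mul_apply, Fin.sum_univ_three] <;> ring
    rw [e1, mul_cols, hu, hw, h.fix]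
    conv_lhs => rw [← hy, cols_mulVec]
    refine Matrix.ext fun i j => ?_
    fin_cases j <;> fin_cases i <;> simp [cols, Matrix.mul_apply, Fin.sum_univ_three] <;> ring
  · rw [hyy]
    have e1 : cols u' w' z' * !![1, 0, y' 0; 0, 1, y' 1; 0, 0, y' 2] = cols u' w' v' := by
      rw [← hy', cols_mulVec]
      refine Matrix.ext fun i j => ?_
      fin_cases j <;> fin_cases i <;> simp [cols, Matrix.mul_apply, Fin.sum_univ_three] <;> ring
    rw [e1, mul_cols, hu', hw', h'.fix]
    conv_lhs => rw [← hy', cols_mulVec]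
    refine Matrix.ext fun i j => ?_
    fin_cases j <;> fin_cases i <;> simp [cols, Matrix.mul_apply, Fin.sum_univ_three] <;> ring

/-! ### Reduction of binary Hermitian forms -/

/-- A Hermitian form on the lattice. -/
structure IsHermForm (F : V3 → V3 → O) : Prop where
  add_left : ∀ x y z, F (x + y) z = F x z + F y z
  smul_left : ∀ (c : O) x y, F (c • x) y = c * F x y
  symm : ∀ x y, star (F x y) = F y x

namespace IsHermForm

variable {F : V3 → V3 → O}

theorem add_right (hF : IsHermForm F) (x y z : V3) : F x (y + z) = F x y + F x z := by
  rw [← hF.symm, hF.add_left, star_add, hF.symm, hF.symm]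

theorem smul_right (hF : IsHermForm F) (c : O) (x y : V3) : F x (c • y) = star c * F x y := by
  rw [← hF.symm, hF.smul_left, star_mul', hF.symm]

theorem exists_int (hF : IsHermForm F) (x : V3) : ∃ n : ℤ, F x x = n :=
  ⟨_, O.star_eq_self (hF.symm x x)⟩

theorem mul_symm (hF : IsHermForm F) (x y : V3) : F x y * F y x = ((F x y).norm : ℤ) := by
  rw [← hF.symm x y, O.mul_star]

/-- Reduction theory: among the bases of a lattice with a binary form of discriminant `D > 0`, there
is one with small first vector. -/
theorem exists_reduced (hF : IsHermForm F) {P : V3 → V3 → Prop} {D : ℤ} (hD : 0 < D)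
    (hswap : ∀ u w, P u w → P w u) (hshift : ∀ (u w : V3) (k : O), P u w → P u (w + k • u))
    (hdisc : ∀ u w, P u w → F u u * F w w - F w u * F u w = (D : O)) {u w : V3} (h : P u w) :
    ∃ u w, ∃ p : ℤ, P u w ∧ F u u = p ∧ p ≠ 0 ∧ 7 * (F w u).norm ≤ 4 * p ^ 2 ∧ 3 * p ^ 2 ≤ 7 * D := by
  obtain ⟨p, hp⟩ := hF.exists_int u
  induction hn : p.natAbs using Nat.strong_induction_on generalizing u w p with
  | _ n ih =>
    have hp0 : p ≠ 0 := by
      rintro rfl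
      have h1 := hdisc u w h
      rw [hp, hF.mul_symm] at h1
      have h2 : -(F w u).norm = D := by
        have : ((-(F w u).norm : ℤ) : O) = (D : ℤ) := by rw [← h1]; push_cast; ring
        exact Int.cast_injective this
      have := O.norm_nonneg (F w u)
      omega
    obtain ⟨k, hk⟩ := O.exists_div (F w u) (b := (p : O)) (Int.cast_ne_zero.2 hp0)
    have h' := hshift u w (-k) h
    have e : F (w + -k • u) u = F w u - k * p := by
      rw [hF.add_left, hF.smul_left, hp]; ring
    rw [← e, O.norm_intCast] at hk
    obtain ⟨r, hr⟩ := hF.exists_int (w + -k • u)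
    have h1 := hdisc _ _ h'
    rw [hp, hr, hF.mul_symm] at h1
    have h2 : p * r - (F (w + -k • u) u).norm = D := by exact_mod_cast h1
    by_cases hlt : r.natAbs < n
    · exact ih _ hlt (hswap _ _ h') r hr rfl
    · refine ⟨u, _, p, h', hp, hp0, hk, ?_⟩
      have h3 := O.norm_nonneg (F (w + -k • u) u)
      have h4 : |p| ≤ |r| := by
        rw [Int.abs_eq_natAbs, Int.abs_eq_natAbs]; exact_mod_cast (by omega)
      have h5 : p * r = |p| * |r| := by rw [← abs_mul, abs_of_pos (by omega)]
      have h6 : p ^ 2 = |p| * |p| := by rw [← sq, sq_abs]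
      have h7 : |p| * |p| ≤ |p| * |r| := mul_le_mul_of_nonneg_left h4 (abs_nonneg p)
      omega

end IsHermForm

theorem isHermForm_hO : IsHermForm hO := ⟨hO_add_left, hO_smul_left, star_hO⟩

/-! ### Normal forms of frames -/

/-- `A` has a frame with the given Gram matrix and the given action on the orthogonal complement of
the fixed vector. -/
def HasFrame (A : SU) (uu wu ww zu zw zz a b c d : O) : Prop :=
  ∃ v u w z, IsFrame A v u w z ∧ hO u u = uu ∧ hO w u = wu ∧ hO w w = ww ∧ hO z u = zu ∧
    hO z w = zw ∧ hO z z = zz ∧ A.m *ᵥ u = a • u + b • w ∧ A.m *ᵥ w = c • u + d • w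

theorem HasFrame.isConj {A A' : SU} {uu wu ww zu zw zz a b c d : O}
    (h : HasFrame A uu wu ww zu zw zz a b c d) (h' : HasFrame A' uu wu ww zu zw zz a b c d)
    (hD : uu * ww - wu * star wu ≠ 0) : IsConj A A' := by
  obtain ⟨v, u, w, z, hf, rfl, rfl, rfl, rfl, rfl, rfl, hu, hw⟩ := h
  obtain ⟨v', u', w', z', hf', h1, h2, h3, h4, h5, h6, hu', hw'⟩ := h'
  refine hf.isConj hf' ?_ h1.symm h2.symm h3.symm h4.symm h5.symm h6.symm hu hw hu' hw'
  intro h0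
  have := hf.disc
  rw [h0, neg_zero] at this
  rw [star_hO] at hD
  exact hD this

namespace IsFrame

variable {A : SU} {v u w z : V3}

theorem gram_det (h : IsFrame A v u w z) : hO u u * hO w w * hO z z -
    hO u u * (hO z w * star (hO z w)) - hO z z * (hO w u * star (hO w u)) +
    hO w u * hO z w * star (hO z u) + hO z u * star (hO w u) * star (hO z w) -
    hO w w * (hO z u * star (hO z u)) = -1 := by
  have hd := det_gram_of_isUnit h.det
  rw [gram_cols, det_fin_three] at hd
  simp only [of_apply, cons_val', cons_val_zero, cons_val_one, cons_val] at hd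
  rw [star_hO, star_hO, star_hO]
  linear_combination hd

theorem hO_shift_left (u w z x : V3) (k l : O) :
    hO (z + k • u + l • w) x = hO z x + k * hO u x + l * hO w x := by
  simp only [hO_add_left, hO_smul_left]

/-- The orthogonal complement of `v` splits off if its Gram matrix is unimodular. -/
theorem exists_orthogonal (h : IsFrame A v u w z) {D : O}
    (hD : hO u u * hO w w - hO w u * hO u w = D) (hDD : D * D = 1) :
    ∃ z', IsFrame A v u w z' ∧ hO z' u = 0 ∧ hO z' w = 0 ∧ hO z' z' = -D := by
  have h' := h.shift_last (D * (hO z w * hO w u - hO z u * hO w w))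
    (D * (hO z u * hO u w - hO z w * hO u u))
  have e1 := hO_shift_left u w z u (D * (hO z w * hO w u - hO z u * hO w w))
    (D * (hO z u * hO u w - hO z w * hO u u))
  have e2 := hO_shift_left u w z w (D * (hO z w * hO w u - hO z u * hO w w))
    (D * (hO z u * hO u w - hO z w * hO u u))
  generalize z + (D * (hO z w * hO w u - hO z u * hO w w)) • u +
    (D * (hO z u * hO u w - hO z w * hO u u)) • w = z' at *
  have e3 : hO z' u = 0 := by
    rw [e1]; linear_combination (-D * hO z u) * hD - hO z u * hDD
  have e4 : hO z' w = 0 := by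
    rw [e2]; linear_combination (-D * hO z w) * hD - hO z w * hDD
  refine ⟨z', h', e3, e4, ?_⟩
  have hg := h'.gram_det
  rw [e3, e4, star_hO] at hg
  simp only [star_zero] at hg
  linear_combination D * hg - hO z' z' * D * hD - hO z' z' * hDD

end IsFrame

@[simp] theorem O.re_one : (1 : O).re = 1 := rfl
@[simp] theorem O.im_one : (1 : O).im = 0 := rfl
@[simp] theorem O.re_two : (2 : O).re = 2 := rfl
@[simp] theorem O.im_two : (2 : O).im = 0 := rfl
@[simp] theorem O.re_three : (3 : O).re = 3 := rfl
@[simp] theorem O.im_three : (3 : O).im = 0 := rfl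

theorem exists_add_two_mul (x : O) : ∃ k, x + k * 2 ∈ ({0, 1, ⟨0, 1⟩, ⟨1, 1⟩} : Finset O) := by
  have : x + ⟨-(x.re / 2), -(x.im / 2)⟩ * 2 = ⟨x.re % 2, x.im % 2⟩ := by
    ext <;> simp <;> omega
  refine ⟨_, Eq.mpr (congrArg (· ∈ _) this) ?_⟩
  rcases Int.emod_two_eq_zero_or_one x.re with h1 | h1 <;>
    rcases Int.emod_two_eq_zero_or_one x.im with h2 | h2 <;> rw [h1, h2] <;> decide +kernel

theorem exists_add_three_mul (x : O) : ∃ k, x + k * 3 ∈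
    ({0, 1, -1, ⟨0, 1⟩, ⟨0, -1⟩, ⟨1, 1⟩, ⟨1, -1⟩, ⟨-1, 1⟩, ⟨-1, -1⟩} : Finset O) := by
  have : x + ⟨-((x.re + 1) / 3), -((x.im + 1) / 3)⟩ * 3 =
      ⟨(x.re + 1) % 3 - 1, (x.im + 1) % 3 - 1⟩ := by
    ext <;> simp <;> omega
  refine ⟨_, Eq.mpr (congrArg (· ∈ _) this) ?_⟩
  have h : ∀ n : ℤ, n % 3 = 0 ∨ n % 3 = 1 ∨ n % 3 = 2 := by omega
  rcases h (x.re + 1) with h1 | h1 | h1 <;> rcases h (x.im + 1) with h2 | h2 | h2 <;>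
    rw [h1, h2] <;> decide +kernel

theorem exists_add_tau_mul (x : O) : ∃ k, x + k * ⟨0, 1⟩ ∈ ({0, 1} : Finset O) := by
  have : x + ⟨-(x.im + x.re / 2), x.re / 2⟩ * ⟨0, 1⟩ = ⟨x.re % 2, 0⟩ := by
    ext <;> simp
    omega
  refine ⟨_, Eq.mpr (congrArg (· ∈ _) this) ?_⟩
  rcases Int.emod_two_eq_zero_or_one x.re with h1 | h1 <;> rw [h1] <;> decide +kernel

theorem exists_add_tauBar_mul (x : O) : ∃ k, x + k * ⟨1, -1⟩ ∈ ({0, 1} : Finset O) := by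
  obtain ⟨k, hk⟩ := exists_add_tau_mul (star x)
  refine ⟨star k, ?_⟩
  have h1 : x + star k * ⟨1, -1⟩ = star (star x + k * ⟨0, 1⟩) := by
    rw [star_add, star_star, star_mul', show star (⟨0, 1⟩ : O) = ⟨1, -1⟩ by decide +kernel]
  rw [h1]
  simp only [Finset.mem_insert, Finset.mem_singleton] at hk ⊢
  rcases hk with hk | hk <;> rw [hk] <;> simp

namespace IsFrame

variable {A : SU} {v u w z : V3}

theorem exists_of_one_zero_two (h : IsFrame A v u w z) (huu : hO u u = 1) (hwu : hO w u = 0)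
    (hww : hO w w = 2) : ∃ z', IsFrame A v u w z' ∧ hO z' u = 0 ∧ hO z' w = 1 ∧ hO z' z' = 0 := by
  obtain ⟨l, hl⟩ := exists_add_two_mul (hO z w)
  have huw : hO u w = 0 := by rw [← star_hO, hwu, star_zero]
  have h' := h.shift_last (-hO z u) l
  have e1 := hO_shift_left u w z u (-hO z u) l
  have e2 := hO_shift_left u w z w (-hO z u) l
  generalize z + (-hO z u) • u + l • w = z' at *
  rw [huu, hwu] at e1
  rw [hww, huw, mul_zero, add_zero] at e2
  have e3 : hO z' u = 0 := by rw [e1]; ring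
  rw [← e2] at hl
  obtain ⟨n, hn⟩ := exists_hO_self z'
  have hg := h'.gram_det
  rw [huu, hwu, hww, e3, hn, O.mul_star] at hg
  have hg' : 2 * n - (hO z' w).norm = -1 := by
    have : ((2 * n - (hO z' w).norm : ℤ) : O) = (-1 : ℤ) := by
      push_cast; simp only [star_zero] at hg; linear_combination hg
    exact_mod_cast this
  have key : ∀ x ∈ ({0, 1, ⟨0, 1⟩, ⟨1, 1⟩} : Finset O), x.norm % 2 = 1 → x = 1 ∧ x.norm = 1 := by
    decide +kernel
  obtain ⟨k1, k2⟩ := key _ hl (by omega)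
  refine ⟨z', h', e3, k1, ?_⟩
  rw [hn, show n = 0 by omega, Int.cast_zero]

theorem exists_of_two_tau_two (h : IsFrame A v u w z) (huu : hO u u = 2)
    (hwu : hO w u = ⟨0, 1⟩ ∨ hO w u = ⟨1, -1⟩) (hww : hO w w = 2) :
    ∃ z', IsFrame A v u w z' ∧ hO z' u = 1 ∧ hO z' w = 1 ∧ hO z' z' = 1 := by
  have hmem : ∃ z', IsFrame A v u w z' ∧ hO z' u ∈ ({0, 1} : Finset O) ∧
      hO z' w ∈ ({0, 1} : Finset O) := by
    rcases hwu with hwu | hwu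
    · have huw : hO u w = ⟨1, -1⟩ := by rw [← star_hO, hwu]; decide +kernel
      obtain ⟨l, hl⟩ := exists_add_tau_mul (hO z u)
      obtain ⟨k, hk⟩ := exists_add_tauBar_mul (hO z w + l * 2)
      refine ⟨_, h.shift_last (-k) (l + k * ⟨1, -1⟩), ?_, ?_⟩
      · rw [hO_shift_left, huu, hwu]
        convert hl using 1
        have : (⟨1, -1⟩ : O) * ⟨0, 1⟩ = 2 := by decide +kernel
        linear_combination k * this
      · rw [hO_shift_left, hww, huw]
        convert hk using 1
        ring
    · have huw : hO u w = ⟨0, 1⟩ := by rw [← star_hO, hwu]; decide +kernel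
      obtain ⟨l, hl⟩ := exists_add_tauBar_mul (hO z u)
      obtain ⟨k, hk⟩ := exists_add_tau_mul (hO z w + l * 2)
      refine ⟨_, h.shift_last (-k) (l + k * ⟨0, 1⟩), ?_, ?_⟩
      · rw [hO_shift_left, huu, hwu]
        convert hl using 1
        have : (⟨1, -1⟩ : O) * ⟨0, 1⟩ = 2 := by decide +kernel
        linear_combination k * this
      · rw [hO_shift_left, hww, huw]
        convert hk using 1
        ring
  obtain ⟨z', h', e1, e2⟩ := hmem
  refine ⟨z', h', ?_⟩
  obtain ⟨n, hn⟩ := exists_hO_self z'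
  have hg := h'.gram_det
  rw [huu, hww, hn] at hg
  simp only [Finset.mem_insert, Finset.mem_singleton] at e1 e2
  rw [hn]
  rcases e1 with e1 | e1 <;> rcases e2 with e2 | e2 <;> rcases hwu with hwu | hwu <;>
    rw [hwu, e1, e2] at hg <;> rw [e1, e2]
  all_goals
    have hg1 := congrArg QuadraticAlgebra.re hg
    simp at hg1
    first
    | (exfalso; omega)
    | (refine ⟨rfl, rfl, ?_⟩
       rw [show n = 1 by omega, Int.cast_one])

theorem exists_of_zero_tau_zero (h : IsFrame A v u w z) (huu : hO u u = 0)
    (hwu : hO w u = ⟨0, 1⟩) (hww : hO w w = 0) :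
    ∃ z', IsFrame A v u w z' ∧ hO z' u = 1 ∧ hO z' w = 1 ∧ hO z' z' = 1 := by
  have huw : hO u w = ⟨1, -1⟩ := by rw [← star_hO, hwu]; decide +kernel
  obtain ⟨l, hl⟩ := exists_add_tau_mul (hO z u)
  obtain ⟨k, hk⟩ := exists_add_tauBar_mul (hO z w)
  have h' := h.shift_last k l
  have e1 := hO_shift_left u w z u k l
  have e2 := hO_shift_left u w z w k l
  generalize z + k • u + l • w = z' at *
  rw [huu, hwu, mul_zero, add_zero] at e1
  rw [hww, huw, mul_zero, add_zero] at e2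
  rw [← e1] at hl
  rw [← e2] at hk
  refine ⟨z', h', ?_⟩
  obtain ⟨n, hn⟩ := exists_hO_self z'
  have hg := h'.gram_det
  rw [huu, hww, hn, hwu] at hg
  simp only [Finset.mem_insert, Finset.mem_singleton] at hl hk
  rw [hn]
  rcases hl with e1 | e1 <;> rcases hk with e2 | e2 <;> rw [e1, e2] at hg <;> rw [e1, e2]
  all_goals
    have hg1 := congrArg QuadraticAlgebra.re hg
    simp at hg1
    first
    | (exfalso; omega)
    | (refine ⟨rfl, rfl, ?_⟩
       rw [show n = 1 by omega, Int.cast_one])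

theorem exists_of_two_neg_one_two (h : IsFrame A v u w z) (huu : hO u u = 2) (hwu : hO w u = -1)
    (hww : hO w w = 2) : ∃ z', IsFrame A v u w z' ∧ hO z' u = 0 ∧
      hO z' w ∈ ({⟨0, 1⟩, ⟨0, -1⟩, ⟨1, -1⟩, ⟨-1, 1⟩} : Finset O) ∧ hO z' z' = 1 := by
  have huw : hO u w = -1 := by rw [← star_hO, hwu]; simp
  obtain ⟨k, hk⟩ := exists_add_three_mul (hO z w + hO z u * 2)
  have h' := h.shift_last k (hO z u + 2 * k)
  have e1 := hO_shift_left u w z u k (hO z u + 2 * k)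
  have e2 := hO_shift_left u w z w k (hO z u + 2 * k)
  generalize z + k • u + (hO z u + 2 * k) • w = z' at *
  have e3 : hO z' u = 0 := by rw [e1, huu, hwu]; ring
  have e4 : hO z' w = hO z w + hO z u * 2 + k * 3 := by rw [e2, hww, huw]; ring
  rw [← e4] at hk
  obtain ⟨n, hn⟩ := exists_hO_self z'
  have hg := h'.gram_det
  rw [huu, hwu, hww, e3, hn, O.mul_star] at hg
  have hg' : 3 * n - 2 * (hO z' w).norm = -1 := by
    have : ((3 * n - 2 * (hO z' w).norm : ℤ) : O) = (-1 : ℤ) := by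
      push_cast; simp only [star_zero, star_neg, star_one] at hg; linear_combination hg
    exact_mod_cast this
  have key : ∀ x ∈ ({0, 1, -1, ⟨0, 1⟩, ⟨0, -1⟩, ⟨1, 1⟩, ⟨1, -1⟩, ⟨-1, 1⟩, ⟨-1, -1⟩} : Finset O),
      (2 * x.norm) % 3 = 1 → x ∈ ({⟨0, 1⟩, ⟨0, -1⟩, ⟨1, -1⟩, ⟨-1, 1⟩} : Finset O) ∧ x.norm = 2 := by
    decide +kernel
  obtain ⟨k1, k2⟩ := key _ hk (by omega)
  refine ⟨z', h', e3, k1, ?_⟩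
  rw [hn, show n = 1 by omega, Int.cast_one]

end IsFrame

/-! ### Elliptic elements with real trace -/

theorem det_sub_one {R : Type*} [CommRing R] (A : Matrix (Fin 3) (Fin 3) R) :
    (A - 1).det = A.det - A.adjugate.trace + A.trace - 1 := by
  simp only [det_fin_three, adjugate_fin_three, trace_fin_three, Matrix.sub_apply]
  simp
  ring

theorem vC_ne_zero {x : V3} (hx : x ≠ 0) : vC x ≠ 0 := fun h => hx <| by
  funext i; exact toC_eq_zero.1 (congrFun h i)

theorem herm_vC_self_re {x : V3} {n : ℤ} (h : hO x x = n) : (herm (vC x) (vC x)).re = n := by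
  rw [herm_vC, h, map_intCast, Complex.intCast_re]

/-- A nontrivial element with real trace that fixes a negative line has a frame. -/
theorem exists_isFrame {A : SU} {p : Fin 3 → ℂ} {c : ℂ} (hp : (herm p p).re < 0)
    (h : mC A.m *ᵥ p = c • p) (ht : star A.m.trace = A.m.trace) (hA : A ≠ 1) :
    ∃ v u w z, ∃ N : ℤ, IsFrame A v u w z ∧ hO v v = N ∧
      ((0 < N ∧ herm p (vC v) = 0) ∨ (N < 0 ∧ c = 1 ∧ ∃ k : ℂ, vC v = k • p)) := by
  have hdet : (A.m - 1).det = 0 := by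
    rw [det_sub_one, SU.adjugate, SU.trace_inv, A.det_m, ht]; ring
  obtain ⟨x, hx0, hx⟩ := exists_mulVec_eq_zero_iff.2 hdet
  obtain ⟨g, v, y, hg, rfl, hy⟩ := exists_primitive hx0
  obtain ⟨u, w, z, hu, hw, hz, hd⟩ := exists_basis_of_primitive hy
  have hv : A.m *ᵥ v = v := by
    rw [sub_mulVec, one_mulVec, mulVec_smul, ← smul_sub] at hx
    exact sub_eq_zero.1 ((smul_eq_zero.1 hx).resolve_left hg)
  obtain ⟨N, hN⟩ := exists_hO_self v
  refine ⟨v, u, w, z, N, ⟨hv, hu, hw, hz, hd⟩, hN, ?_⟩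
  have hv0 : vC v ≠ 0 := vC_ne_zero (by rintro rfl; rw [smul_zero] at hx0; exact hx0 rfl)
  have hvC : mC A.m *ᵥ vC v = vC v := by rw [mC_mulVec, hv]
  by_cases hk : ∃ k : ℂ, vC v = k • p
  · right
    obtain ⟨k, hk⟩ := hk
    have hk0 : k ≠ 0 := by rintro rfl; exact hv0 (by rw [hk, zero_smul])
    refine ⟨?_, ?_, k, hk⟩
    · have h1 := herm_vC_self_re hN
      rw [hk, herm_smul_self] at h1
      have h2 := Complex.normSq_pos.2 hk0
      have h3 : (N : ℝ) < 0 := by rw [← h1]; nlinarith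
      exact_mod_cast h3
    · rw [hk, mulVec_smul, h, smul_smul, ← sub_eq_zero, ← sub_smul] at hvC
      have h1 := (smul_eq_zero.1 hvC).resolve_right (ne_zero_of_neg hp)
      have h2 : k * (c - 1) = 0 := by linear_combination h1
      exact sub_eq_zero.1 ((mul_eq_zero.1 h2).resolve_left hk0)
  · left
    have hc : c ≠ 1 := by
      rintro rfl
      have := (SU.trace_of_double hp h (by rw [hvC, one_smul]) (by simpa using hk) hA).2
      norm_num at this
    have h1 : herm p (vC v) = 0 := by
      have h2 := herm_mulVec A p (vC v)
      rw [h, hvC, herm_smul_left] at h2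
      have h3 : (c - 1) * herm p (vC v) = 0 := by linear_combination h2
      exact (mul_eq_zero.1 h3).resolve_left (sub_ne_zero.2 hc)
    refine ⟨?_, h1⟩
    have h2 := herm_self_pos hp (herm_comm_eq_zero h1) hv0
    rw [herm_vC_self_re hN] at h2
    exact_mod_cast h2

namespace IsFrame

variable {A : SU} {v u w z : V3}

/-- The vectors fixed by `A` are multiples of `v`. -/
theorem mul_hO_of_fixed (h : IsFrame A v u w z) {N T : ℤ} (hN : hO v v = N) (hT : A.m.trace = T)
    (hT3 : T ≠ 3) {y : V3} (hy : A.m *ᵥ y = y) : N * hO y z = hO y v * hO v z := by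
  have hT3' : (3 : O) - T ≠ 0 := by
    intro h0
    apply hT3
    have : ((3 - T : ℤ) : O) = (0 : ℤ) := by push_cast; exact h0
    have : (3 - T : ℤ) = 0 := Int.cast_injective this
    omega
  obtain ⟨a, b, c, d, hu, hw, htr, hdet⟩ := h.exists_action
  obtain ⟨α, β, hab⟩ := h.exists_coords_perp (x := (N : O) • y - hO y v • v) (by
    rw [hO_sub_left, hO_smul_left, hO_smul_left, hN]; ring)
  have h1 : A.m *ᵥ ((N : O) • y - hO y v • v) = (N : O) • y - hO y v • v := by
    rw [mulVec_sub, mulVec_smul, mulVec_smul, hy, h.fix]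
  rw [hab, mulVec_add, mulVec_smul, mulVec_smul, hu, hw] at h1
  obtain ⟨e1, e2⟩ := h.coords_inj (a := α * a + β * c) (b := α * b + β * d) (c := α) (d := β)
    (by rw [← h1]; module)
  rw [hT] at htr
  have hα : α = 0 := by
    refine (mul_eq_zero.1 (?_ : ((3 : O) - T) * α = 0)).resolve_left hT3'
    linear_combination (d - 1) * e1 - c * e2 + α * htr - α * hdet
  have hβ : β = 0 := by
    refine (mul_eq_zero.1 (?_ : ((3 : O) - T) * β = 0)).resolve_left hT3'
    linear_combination (a - 1) * e2 - b * e1 + β * htr - β * hdet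
  rw [hα, hβ, zero_smul, zero_smul, add_zero] at hab
  have := congrArg (hO · z) (sub_eq_zero.1 hab)
  simpa only [hO_smul_left] using this

theorem dvd_of_fixed (h : IsFrame A v u w z) {N T m : ℤ} (hN : hO v v = N) (hT : A.m.trace = T)
    (hT3 : T ≠ 3) {y : V3} (hy : A.m *ᵥ y = y) (hyv : hO y v = m) : N ∣ m := by
  have h1 := h.mul_hO_of_fixed hN hT hT3 hy
  rw [hyv, ← star_hO z v, h.hz, star_one, mul_one] at h1
  have h2 := congrArg QuadraticAlgebra.re h1
  refine ⟨(hO y z).re, ?_⟩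
  simp at h2
  exact h2.symm

/-- The square norm of the fixed vector divides `3 - tr A`. -/
theorem dvd_of_trace (h : IsFrame A v u w z) {N T : ℤ} (hN : hO v v = N) (hT : A.m.trace = T)
    (hT3 : T ≠ 3) : N ∣ 3 - T := by
  set y := A.m *ᵥ (A.m *ᵥ z) - ((T : O) - 1) • (A.m *ᵥ z) + z with hy
  have hyv : hO y v = 3 - T := by
    rw [hy, hO_add_left, hO_sub_left, hO_smul_left, h.hO_map, h.hO_map, h.hz]; ring
  have hCH : A.m *ᵥ y = y := by
    have h1 := A.cayley_hamilton
    have h2 : (A.m * A.m * A.m) *ᵥ z = (A.m.trace • (A.m * A.m) - star A.m.trace • A.m + 1) *ᵥ z := by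
      rw [← pow_three']
      congr 1
      rw [← sub_eq_zero, ← h1, pow_two]; abel
    rw [hT, show star (T : O) = T by simp] at h2
    simp only [add_mulVec, sub_mulVec, smul_mulVec, one_mulVec, ← mulVec_mulVec] at h2
    rw [hy, mulVec_add, mulVec_sub, mulVec_smul, h2]
    module
  exact h.dvd_of_fixed hN hT hT3 hCH (by rw [hyv]; push_cast; rfl)

theorem dvd_two (h : IsFrame A v u w z) {N : ℤ} (hN : hO v v = N) (hT : A.m.trace = -1)
    (h2 : A ^ 2 = 1) : N ∣ 2 := by
  refine h.dvd_of_fixed (T := -1) (y := A.m *ᵥ z + z) hN (by rw [hT]; simp) (by norm_num) ?_ ?_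
  · rw [mulVec_add, mulVec_mulVec, ← pow_two, ← SU.m_pow, h2, SU.m_one, one_mulVec, add_comm]
  · rw [hO_add_left, h.hO_map, h.hz]; norm_num

theorem _root_.Picard7.pos_of_perp {v : V3} {N : ℤ} (hN : hO v v = N) (hneg : N < 0) {x : V3}
    (hx : hO x v = 0) {n : ℤ} (hn : hO x x = n) (hn0 : n ≠ 0) : 0 < n := by
  have hx0 : x ≠ 0 := by
    rintro rfl
    rw [hO_zero_left] at hn
    exact hn0 (by exact_mod_cast hn.symm)
  have h1 : (herm (vC v) (vC v)).re < 0 := by rw [herm_vC_self_re hN]; exact_mod_cast hneg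
  have h2 := herm_self_pos h1 (by rw [herm_vC, hx, map_zero]) (vC_ne_zero hx0)
  rw [herm_vC_self_re hn] at h2
  exact_mod_cast h2

/-- A reduced basis of the orthogonal complement of a negative fixed vector. -/
theorem exists_reduced (h : IsFrame A v u w z) {N : ℤ} (hN : hO v v = N) (hneg : N < 0) :
    ∃ u w, ∃ p r : ℤ, IsFrame A v u w z ∧ hO u u = p ∧ hO w w = r ∧ 0 < p ∧
      p * r - (hO w u).norm = -N ∧ 7 * (hO w u).norm ≤ 4 * p ^ 2 ∧ 3 * p ^ 2 ≤ -7 * N := by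
  obtain ⟨u, w, p, hf, hp, hp0, h1, h2⟩ := isHermForm_hO.exists_reduced
    (P := fun u w => IsFrame A v u w z) (D := -N) (by omega) (fun _ _ h => h.swap)
    (fun _ _ k h => h.shift k) (fun _ _ h => by rw [h.disc, hN]; push_cast; ring) h
  obtain ⟨r, hr⟩ := exists_hO_self w
  refine ⟨u, w, p, r, hf, hp, hr, pos_of_perp hN hneg hf.hu hp hp0, ?_, h1, by linarith⟩
  have := hf.disc
  rw [hp, hr, hN, isHermForm_hO.mul_symm] at this
  exact_mod_cast this

/-- The action of an element of order two on the orthogonal complement of its fixed vector. -/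
theorem action_of_sq (h : IsFrame A v u w z) (ht : A.m.trace = -1) (h2 : A ^ 2 = 1) :
    A.m *ᵥ u = (-1 : O) • u + (0 : O) • w ∧ A.m *ᵥ w = (0 : O) • u + (-1 : O) • w := by
  obtain ⟨a, b, c, d, hu, hw, htr, hdet⟩ := h.exists_action
  rw [ht] at htr
  have hm : ∀ x, A.m *ᵥ (A.m *ᵥ x) = x := by
    intro x
    rw [mulVec_mulVec, ← pow_two, ← SU.m_pow, h2, SU.m_one, one_mulVec]
  have h1 := hm u
  rw [hu, mulVec_add, mulVec_smul, mulVec_smul, hu, hw] at h1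
  have h3 := hm w
  rw [hw, mulVec_add, mulVec_smul, mulVec_smul, hu, hw] at h3
  obtain ⟨e1, e2⟩ := h.coords_inj (a := a * a + b * c) (b := a * b + b * d) (c := 1) (d := 0)
    (by rw [one_smul, zero_smul, add_zero]; refine Eq.trans ?_ h1; module)
  obtain ⟨e3, e4⟩ := h.coords_inj (a := c * a + d * c) (b := c * b + d * d) (c := 0) (d := 1)
    (by rw [one_smul, zero_smul, zero_add]; refine Eq.trans ?_ h3; module)
  have h20 : (2 : O) ≠ 0 := by decide +kernel
  have hb : b = 0 := (mul_eq_zero.1 (by linear_combination b * htr - e2 : (2 : O) * b = 0)).resolve_left h20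
  have hc : c = 0 := (mul_eq_zero.1 (by linear_combination c * htr - e3 : (2 : O) * c = 0)).resolve_left h20
  have ha : a = -1 := by
    have : (a + 1) ^ 2 = 0 := by
      rw [hb] at hdet
      linear_combination a * htr - hdet
    exact eq_neg_of_add_eq_zero_left (pow_eq_zero_iff two_ne_zero |>.1 this)
  have hd : d = -1 := by rw [ha] at htr; linear_combination htr
  exact ⟨by rw [hu, ha, hb], by rw [hw, hc, hd]⟩

end IsFrame

namespace IsFrame

variable {A : SU} {v u w z : V3} {ε : ℤ}

theorem mulVec_mulVec_left (h : IsFrame A v u w z) (ht : A.m.trace = 1 + ε) :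
    A.m *ᵥ (A.m *ᵥ u) = (ε : O) • (A.m *ᵥ u) - u := by
  obtain ⟨a, b, c, d, hu, hw, htr, hdet⟩ := h.exists_action
  rw [ht] at htr
  have e1 : (ε : O) = a + d := by rw [htr]; ring
  rw [e1, hu, mulVec_add, mulVec_smul, mulVec_smul, hu, hw]
  have e2 : u = (a * d - b * c) • u := by rw [hdet, one_smul]
  conv_rhs => rhs; rw [e2]
  module

theorem add_star_eq (h : IsFrame A v u w z) (ht : A.m.trace = 1 + ε) :
    hO (A.m *ᵥ u) u + hO u (A.m *ᵥ u) = ε * hO u u := by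
  have h1 := hO_mulVec A (A.m *ᵥ u) u
  rw [h.mulVec_mulVec_left ht, hO_sub_left, hO_smul_left, hO_mulVec] at h1
  linear_combination -h1

theorem two_re_add_im (h : IsFrame A v u w z) (ht : A.m.trace = 1 + ε) {n : ℤ} (hn : hO u u = n) :
    2 * (hO (A.m *ᵥ u) u).re + (hO (A.m *ᵥ u) u).im = ε * n := by
  have h1 := h.add_star_eq ht
  rw [← star_hO (A.m *ᵥ u) u, hn] at h1
  have h2 := congrArg QuadraticAlgebra.re h1
  simp at h2
  linarith

theorem exists_norm_eq (h : IsFrame A v u w z) (ht : A.m.trace = 1 + ε) {n N : ℤ} (hn : hO u u = n)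
    (hN : hO v v = N) : ∃ a b : O, A.m *ᵥ u = a • u + b • w ∧
      (4 - ε ^ 2) * n ^ 2 - 7 * (hO (A.m *ᵥ u) u).im ^ 2 = -4 * N * b.norm ∧
      n ^ 2 - (hO (A.m *ᵥ u) u).norm = -N * b.norm := by
  obtain ⟨a, b, -, -, hu, -⟩ := h.exists_action
  have h1 : n ^ 2 - (hO (A.m *ᵥ u) u).norm = -N * b.norm := by
    have h2 := h.disc
    have h3 := hO_mulVec A u u
    have e : ((n ^ 2 - (hO (A.m *ᵥ u) u).norm : ℤ) : O) = ((-N * b.norm : ℤ) : O) := by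
      push_cast
      rw [← O.mul_star, ← O.mul_star, star_hO, ← hN, ← hn]
      conv_lhs => rw [sq]; lhs; rhs; rw [← h3]
      rw [hu]
      simp only [hO_add_left, hO_add_right, hO_smul_left, hO_smul_right]
      linear_combination (b * star b) * h2
    exact_mod_cast e
  refine ⟨a, b, hu, ?_, h1⟩
  have h2 := h.two_re_add_im ht hn
  have h3 := O.norm_eq (hO (A.m *ᵥ u) u)
  generalize hO (A.m *ᵥ u) u = β at *
  have h4 : 4 * β.norm = (2 * β.re + β.im) ^ 2 + 7 * β.im ^ 2 := by rw [h3]; ring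
  rw [h2] at h4
  linarith

/-- The number `i√7` in `O`. -/
def _root_.Picard7.sO : O := ⟨-1, 2⟩

/-- The definite Hermitian form `⟨i√7 (A - A⁻¹) x, y⟩` attached to `A`. -/
def _root_.Picard7.skewForm (A : SU) (x y : V3) : O := sO * hO (A.m *ᵥ x - (A⁻¹).m *ᵥ x) y

theorem _root_.Picard7.hO_inv_mulVec (A : SU) (x y : V3) : hO ((A⁻¹).m *ᵥ x) y = hO x (A.m *ᵥ y) := by
  rw [← hO_mulVec A, mulVec_mulVec, SU.m_mul_inv, one_mulVec]

theorem _root_.Picard7.isHermForm_skewForm (A : SU) : IsHermForm (skewForm A) where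
  add_left x y z := by
    simp only [skewForm, mulVec_add, hO_add_left, hO_sub_left]; ring
  smul_left c x y := by
    simp only [skewForm, mulVec_smul, hO_smul_left, hO_sub_left]; ring
  symm x y := by
    have hs : star sO = -sO := by decide +kernel
    have h1 : hO ((A⁻¹).m *ᵥ x) y = hO x (A.m *ᵥ y) := hO_inv_mulVec A x y
    have h2 : hO ((A⁻¹).m *ᵥ y) x = hO y (A.m *ᵥ x) := hO_inv_mulVec A y x
    simp only [skewForm, hO_sub_left, star_mul', star_sub, hs, h1, h2, star_hO]
    ring

theorem skewForm_left (h : IsFrame A v u w z) (ht : A.m.trace = 1 + ε) (y : V3) :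
    skewForm A u y = sO * (2 * hO (A.m *ᵥ u) y - ε * hO u y) := by
  have h1 : (A⁻¹).m *ᵥ u = (ε : O) • u - A.m *ᵥ u := by
    have h2 := congrArg ((A⁻¹).m *ᵥ ·) (h.mulVec_mulVec_left ht)
    simp only [mulVec_sub, mulVec_smul, mulVec_mulVec, SU.m_inv_mul, one_mulVec] at h2
    rw [← mul_assoc, SU.m_inv_mul, one_mul] at h2
    rw [h2]; abel
  rw [skewForm, h1, hO_sub_left, hO_sub_left, hO_smul_left]
  ring

theorem skewForm_disc (h : IsFrame A v u w z) (ht : A.m.trace = 1 + ε) :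
    skewForm A u u * skewForm A w w - skewForm A w u * skewForm A u w =
      7 * (4 - ε ^ 2) * hO v v := by
  obtain ⟨a, b, c, d, hu, hw, htr, hdet⟩ := h.exists_action
  rw [h.skewForm_left ht, h.skewForm_left ht, h.swap.skewForm_left ht, h.swap.skewForm_left ht,
    hu, hw]
  simp only [hO_add_left, hO_smul_left]
  have hs : sO * sO = -7 := by decide +kernel
  have hd := h.disc
  have e : (ε : O) = a + d := by rw [htr, ht]; ring
  have hdet' : b * c = a * d - 1 := by linear_combination -hdet
  rw [e]
  have key : (2 * a - (a + d)) * (2 * d - (a + d)) - 4 * (b * c) = 4 - (a + d) ^ 2 := by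
    linear_combination (-4) * hdet'
  linear_combination (sO * sO * ((2 * a - (a + d)) * (2 * d - (a + d)) - 4 * (b * c))) * hd -
    hO v v * sO * sO * key - hO v v * (4 - (a + d) ^ 2) * hs

/-- A basis of the orthogonal complement of a positive fixed vector which is reduced with respect to
the form attached to `A`. -/
theorem exists_skew_reduced (h : IsFrame A v u w z) {N : ℤ} (hN : hO v v = N) (hpos : 0 < N)
    (ht : A.m.trace = 1 + ε) (hε : ε ^ 2 < 4) :
    ∃ u w, IsFrame A v u w z ∧ (hO (A.m *ᵥ u) u).im ≠ 0 ∧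
      3 * (hO (A.m *ᵥ u) u).im ^ 2 ≤ N * (4 - ε ^ 2) := by
  obtain ⟨u, w, p, hf, hp, hp0, -, h2⟩ := (isHermForm_skewForm A).exists_reduced
    (P := fun u w => IsFrame A v u w z) (D := 7 * (4 - ε ^ 2) * N)
    (by have : 0 < 4 - ε ^ 2 := by omega
        positivity) (fun _ _ h => h.swap)
    (fun _ _ k h => h.shift k) (fun _ _ h => by rw [h.skewForm_disc ht, hN]; push_cast; ring) h
  have hy : p = -7 * (hO (A.m *ᵥ u) u).im := by
    rw [hf.skewForm_left ht] at hp
    have h1 := hf.add_star_eq ht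
    rw [← star_hO (A.m *ᵥ u) u] at h1
    have h3 : sO * (hO (A.m *ᵥ u) u - star (hO (A.m *ᵥ u) u)) = p := by
      rw [← hp]; linear_combination -sO * h1
    have h4 := congrArg QuadraticAlgebra.re h3
    simp [sO] at h4
    linarith
  refine ⟨u, w, hf, ?_, ?_⟩
  · intro h0; rw [h0] at hy; exact hp0 (by rw [hy]; ring)
  · rw [hy] at h2
    linarith

/-- The frame whose second vector is `A u`. -/
theorem hasFrame_of_replace (h : IsFrame A v u w z) (ht : A.m.trace = 1 + ε) {a b : O}
    (hu : A.m *ᵥ u = a • u + b • w) (hb : b.norm = 1) :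
    IsFrame A v u (A.m *ᵥ u) z ∧ A.m *ᵥ u = (0 : O) • u + (1 : O) • (A.m *ᵥ u) ∧
      A.m *ᵥ (A.m *ᵥ u) = (-1 : O) • u + (ε : O) • (A.m *ᵥ u) := by
  have hb' : IsUnit b := by
    refine isUnit_of_dvd_one ⟨star b, ?_⟩
    rw [O.mul_star, hb, Int.cast_one]
  refine ⟨h.replace hu hb', by rw [zero_smul, one_smul, zero_add], ?_⟩
  rw [h.mulVec_mulVec_left ht]
  module

end IsFrame

/-! ### Normal forms of elliptic elements -/

section normalForms

variable {A : SU} {v u w z : V3} {N : ℤ}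

theorem O.eq_of_norm_two {x : O} (hx : x.norm = 2) :
    x = ⟨0, 1⟩ ∨ x = ⟨0, -1⟩ ∨ x = ⟨1, -1⟩ ∨ x = ⟨-1, 1⟩ := by
  have key : ∀ x ∈ ({0, 1, -1, ⟨0, 1⟩, ⟨0, -1⟩, ⟨1, -1⟩, ⟨-1, 1⟩} : Finset O), x.norm = 2 →
    x = ⟨0, 1⟩ ∨ x = ⟨0, -1⟩ ∨ x = ⟨1, -1⟩ ∨ x = ⟨-1, 1⟩ := by decide +kernel
  exact key x (O.norm_le_two hx.le) hx

theorem hO_neg_one_smul (x : V3) : hO ((-1 : O) • x) ((-1 : O) • x) = hO x x := by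
  rw [hO_smul_left, hO_smul_right]; simp

theorem IsFrame.change (h : IsFrame A v u w z) {a b c d : O} (hd : a * d - b * c = 1) :
    IsFrame A v (a • u + b • w) (c • u + d • w) z :=
  ⟨h.fix, by rw [hO_add_left, hO_smul_left, hO_smul_left, h.hu, h.hw]; ring,
    by rw [hO_add_left, hO_smul_left, hO_smul_left, h.hu, h.hw]; ring, h.hz, by
    have : (cols (a • u + b • w) (c • u + d • w) z).det = (cols u w z).det := by
      rw [det_cols, det_cols]; simp only [Pi.add_apply, Pi.smul_apply, smul_eq_mul]
      linear_combination (u 0 * w 1 * z 2 - u 0 * w 2 * z 1 -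
        u 1 * w 0 * z 2 + u 1 * w 2 * z 0 + u 2 * w 0 * z 1 - u 2 * w 1 * z 0) * hd
    rw [this]; exact h.det⟩

/-- If the basis vectors have the same square norm and their product has norm two, the product can
be taken to be `τ`. -/
theorem IsFrame.exists_hO_eq_tau (h : IsFrame A v u w z) {s : O} (huu : hO u u = s)
    (hww : hO w w = s) (hq : (hO w u).norm = 2) :
    ∃ u w, IsFrame A v u w z ∧ hO u u = s ∧ hO w w = s ∧ hO w u = ⟨0, 1⟩ := by
  have hneg : IsUnit (-1 : O) := isUnit_one.neg
  rcases O.eq_of_norm_two hq with hwu | hwu | hwu | hwu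
  · exact ⟨u, w, h, huu, hww, hwu⟩
  · refine ⟨u, _, h.smul_right hneg, huu, by rw [hO_neg_one_smul, hww], ?_⟩
    rw [hO_smul_left, hwu]; decide +kernel
  · refine ⟨w, u, h.swap, hww, huu, ?_⟩
    rw [← star_hO, hwu]; decide +kernel
  · refine ⟨w, _, h.swap.smul_right hneg, hww, by rw [hO_neg_one_smul, huu], ?_⟩
    rw [hO_smul_left, ← star_hO, hwu]; decide +kernel

theorem eq_one_of_sq_le {p m : ℤ} (hp : 0 < p) (h : 3 * p ^ 2 ≤ m) (hm : m < 12) : p = 1 := by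
  have : p < 2 := by nlinarith
  omega

theorem le_two_of_sq_le {p m : ℤ} (hp : 0 < p) (h : 3 * p ^ 2 ≤ m) (hm : m < 27) :
    p = 1 ∨ p = 2 := by
  have : p < 3 := by nlinarith
  omega

/-- Elements of order two with a negative fixed vector. -/
theorem IsFrame.normalForm_two_neg (h : IsFrame A v u w z) (hN : hO v v = N) (hneg : N < 0)
    (ht : A.m.trace = -1) (h2 : A ^ 2 = 1) :
    HasFrame A 1 0 1 0 0 (-1) (-1) 0 0 (-1) ∨ HasFrame A 1 0 2 0 1 0 (-1) 0 0 (-1) ∨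
      HasFrame A 2 ⟨0, 1⟩ 2 1 1 1 (-1) 0 0 (-1) := by
  have hN2 : N = -1 ∨ N = -2 := by
    have h3 := h.dvd_two hN ht h2
    have h4 := Int.le_of_dvd (by norm_num) ((neg_dvd).2 h3)
    have h5 : N ≠ 0 := by omega
    omega
  have form12 : ∀ {u w z : V3}, IsFrame A v u w z → hO u u = 1 → hO w u = 0 → hO w w = 2 →
      HasFrame A 1 0 2 0 1 0 (-1) 0 0 (-1) := by
    intro u w z h huu hwu hww
    obtain ⟨z', h', e1, e2, e3⟩ := h.exists_of_one_zero_two huu hwu hww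
    obtain ⟨a1, a2⟩ := h'.action_of_sq ht h2
    exact ⟨v, u, w, z', h', huu, hwu, hww, e1, e2, e3, a1, a2⟩
  obtain ⟨u, w, p, r, hf, hp, hr, hp0, hd, hq, hb⟩ := h.exists_reduced hN hneg
  have hnn := O.norm_nonneg (hO w u)
  rcases hN2 with rfl | rfl
  · left
    obtain rfl := eq_one_of_sq_le hp0 hb (by norm_num)
    have h0 : (hO w u).norm = 0 := by omega
    have hr1 : r = 1 := by omega
    have hwu : hO w u = 0 := O.norm_eq_zero.1 h0
    have huw : hO u w = 0 := by rw [← star_hO, hwu, star_zero]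
    rw [hr1, Int.cast_one] at hr
    rw [Int.cast_one] at hp
    obtain ⟨z', h', e1, e2, e3⟩ := hf.exists_orthogonal (D := 1) (by rw [hp, hr, hwu]; ring) (by ring)
    obtain ⟨a1, a2⟩ := h'.action_of_sq ht h2
    exact ⟨v, u, w, z', h', hp, hwu, hr, e1, e2, e3, a1, a2⟩
  · right
    rcases le_two_of_sq_le hp0 hb (by norm_num) with rfl | rfl
    · left
      have h0 : (hO w u).norm = 0 := by omega
      have hr1 : r = 2 := by omega
      have hwu : hO w u = 0 := O.norm_eq_zero.1 h0
      exact form12 hf (by simpa using hp) hwu (by simpa [hr1] using hr)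
    · have h02 : (hO w u).norm = 0 ∨ (hO w u).norm = 2 := by omega
      rcases h02 with h0 | h0
      · left
        have hr1 : r = 1 := by omega
        have hwu : hO w u = 0 := O.norm_eq_zero.1 h0
        exact form12 hf.swap (by simpa [hr1] using hr) (by rw [← star_hO, hwu, star_zero])
          (by simpa using hp)
      · right
        have hr1 : r = 2 := by omega
        obtain ⟨u, w, h', huu, hww, hwu⟩ := hf.exists_hO_eq_tau (s := 2) (by simpa using hp)
          (by simpa [hr1] using hr) h0
        obtain ⟨z', h', e1, e2, e3⟩ := h'.exists_of_two_tau_two huu (.inl hwu) hww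
        obtain ⟨a1, a2⟩ := h'.action_of_sq ht h2
        exact ⟨v, u, w, z', h', huu, hwu, hww, e1, e2, e3, a1, a2⟩

/-- The orthogonal complement of a positive vector `v` contains an isotropic vector if `⟨v, v⟩` is a
norm. -/
theorem IsFrame.exists_isotropic (h : IsFrame A v u w z) {ν : O} (hν : hO v v = ν * star ν) :
    ∃ u w, IsFrame A v u w z ∧ hO u u = 0 := by
  by_cases hu : hO u u = 0
  · exact ⟨u, w, h, hu⟩
  obtain ⟨g, a, b, s, t, ha, hb, hst⟩ := O.exists_bezout (ν - hO w u) (hO u u)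
  have hg : g ≠ 0 := by rintro rfl; exact hu (by rw [hb, zero_mul])
  refine ⟨_, _, h.change (a := a) (b := b) (c := -t) (d := s) (by linear_combination hst), ?_⟩
  have hp : star (hO u u) = hO u u := star_hO u u
  have h1 : (g * star g) * hO (a • u + b • w) (a • u + b • w) = 0 := by
    have e1 : (g * star g) * hO (a • u + b • w) (a • u + b • w) =
        (g * a) * star (g * a) * hO u u + (g * a) * star (g * b) * hO u w +
        (g * b) * star (g * a) * hO w u + (g * b) * star (g * b) * hO w w := by
      simp only [hO_add_left, hO_add_right, hO_smul_left, hO_smul_right, star_mul']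
      ring
    rw [e1, ← ha, ← hb, hp, star_sub, star_hO]
    have hd := h.disc
    rw [hν] at hd
    linear_combination hO u u * hd
  exact (mul_eq_zero.1 h1).resolve_left (mul_ne_zero hg (star_ne_zero.2 hg))

/-- Elements of order two with a positive fixed vector. -/
theorem IsFrame.normalForm_two_pos (h : IsFrame A v u w z) (hN : hO v v = N) (hpos : 0 < N)
    (ht : A.m.trace = -1) (h2 : A ^ 2 = 1) :
    (N = 1 ∧ HasFrame A 0 1 0 0 0 1 (-1) 0 0 (-1)) ∨
      (N = 2 ∧ HasFrame A 0 ⟨0, 1⟩ 0 1 1 1 (-1) 0 0 (-1)) := by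
  have hN2 : N = 1 ∨ N = 2 := by
    have h4 := Int.le_of_dvd (by norm_num) (h.dvd_two hN ht h2)
    omega
  have hiso : ∃ u w, IsFrame A v u w z ∧ hO u u = 0 := by
    rcases hN2 with rfl | rfl
    · exact h.exists_isotropic (ν := 1) (by rw [hN]; simp)
    · exact h.exists_isotropic (ν := ⟨0, 1⟩) (by rw [hN]; decide +kernel)
  obtain ⟨u, w, hf, huu⟩ := hiso
  have hq : (hO w u).norm = N := by
    have := hf.disc
    rw [huu, hN, isHermForm_hO.mul_symm, zero_mul, zero_sub, neg_inj] at this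
    exact_mod_cast this
  obtain ⟨r, hr⟩ := exists_hO_self w
  have hshift : ∀ k : O, hO (w + k • u) u = hO w u ∧
      hO (w + k • u) (w + k • u) = r + (k * star (hO w u) + star (k * star (hO w u))) := by
    intro k
    simp only [hO_add_left, hO_add_right, hO_smul_left, hO_smul_right, huu, hr, star_mul', star_hO]
    constructor <;> ring
  rcases hN2 with rfl | rfl
  · left
    refine ⟨rfl, ?_⟩
    have hqq : hO w u = 1 ∨ hO w u = -1 := by
      have key : ∀ x ∈ ({0, 1, -1} : Finset O), x.norm = 1 → x = 1 ∨ x = -1 := by decide +kernel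
      exact key _ (O.norm_le_one hq.le) hq
    have h10 : ∃ u w, IsFrame A v u w z ∧ hO u u = 0 ∧ hO w w = 0 ∧ hO w u = 1 := by
      rcases hqq with e | e
      · refine ⟨u, _, hf.shift ⟨0, -r⟩, huu, ?_, by rw [(hshift _).1, e]⟩
        rw [(hshift _).2, e]
        ext <;> simp
      · refine ⟨u, _, (hf.shift ⟨0, r⟩).smul_right (isUnit_one.neg), huu, ?_, ?_⟩
        · rw [hO_neg_one_smul, (hshift _).2, e]
          ext <;> simp
        · rw [hO_smul_left, (hshift _).1, e]; ring
    obtain ⟨u, w, h', huu, hww, hwu⟩ := h10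
    have huw : hO u w = 1 := by rw [← star_hO, hwu, star_one]
    obtain ⟨z', h', e1, e2, e3⟩ := h'.exists_orthogonal (D := -1)
      (by rw [huu, hww, hwu, huw]; ring) (by ring)
    obtain ⟨a1, a2⟩ := h'.action_of_sq ht h2
    exact ⟨v, u, w, z', h', huu, hwu, hww, e1, e2, by rw [e3]; ring, a1, a2⟩
  · right
    refine ⟨rfl, ?_⟩
    have h10 : ∃ w, IsFrame A v u w z ∧ hO w w = 0 ∧ (hO w u).norm = 2 := by
      have key : ∃ k : O, (r : O) + (k * star (hO w u) + star (k * star (hO w u))) = 0 := by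
        rcases O.eq_of_norm_two hq with e | e | e | e <;> rw [e]
        · exact ⟨⟨-r, 0⟩, by ext <;> simp⟩
        · exact ⟨⟨r, 0⟩, by ext <;> simp⟩
        · exact ⟨⟨-r, 0⟩, by ext <;> simp⟩
        · exact ⟨⟨r, 0⟩, by ext <;> simp⟩
      obtain ⟨k, hk⟩ := key
      exact ⟨_, hf.shift k, by rw [(hshift k).2, hk], by rw [(hshift k).1, hq]⟩
    obtain ⟨w, h', hww, hq'⟩ := h10
    obtain ⟨u, w, h', huu, hww, hwu⟩ := h'.exists_hO_eq_tau huu hww hq'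
    obtain ⟨z', h', e1, e2, e3⟩ := h'.exists_of_zero_tau_zero huu hwu hww
    obtain ⟨a1, a2⟩ := h'.action_of_sq ht h2
    exact ⟨v, u, w, z', h', huu, hwu, hww, e1, e2, e3, a1, a2⟩

theorem int_sq_le_one {y : ℤ} (h : y ^ 2 < 4) : y = 0 ∨ y = 1 ∨ y = -1 := by
  have h1 : y < 2 := by nlinarith
  have h2 : -2 < y := by nlinarith
  omega

/-- Elements of order three or six. -/
theorem IsFrame.normalForm_three_six (h : IsFrame A v u w z) (hN : hO v v = N) {ε : ℤ}
    (ht : A.m.trace = 1 + ε) (hε : ε = 1 ∨ ε = -1) (hNv : N = 1 ∨ N = -1 ∨ N = 3 ∨ N = -3) :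
    (N = 1 ∧ ∃ n x y : ℤ, (n = 1 ∨ n = -1) ∧ (y = 1 ∨ y = -1) ∧ 2 * x + y = ε * n ∧
      HasFrame A n ⟨x, y⟩ n 0 0 1 0 1 (-1) ε) ∨
    (N = -3 ∧ (ε = -1 → ∃ c ∈ ({⟨0, 1⟩, ⟨0, -1⟩, ⟨1, -1⟩, ⟨-1, 1⟩} : Finset O),
      HasFrame A 2 (-1) 2 0 c 1 0 1 (-1) ε)) := by
  have hε2 : ε ^ 2 = 1 := by rcases hε with rfl | rfl <;> norm_num
  rcases lt_or_gt_of_ne (show N ≠ 0 by omega) with hneg | hpos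
  · obtain ⟨u, w, p, r, hf, hp, hr, hp0, hd, hq, hb⟩ := h.exists_reduced hN hneg
    obtain ⟨a, b, hu, h1, h2⟩ := hf.exists_norm_eq ht hp hN
    have h3 := hf.two_re_add_im ht hp
    rw [hε2] at h1
    have hbn := O.norm_nonneg b
    have hN' : N = -1 ∨ N = -3 := by omega
    have hy : (hO (A.m *ᵥ u) u).im = 0 ∨ (hO (A.m *ᵥ u) u).im = 1 ∨ (hO (A.m *ᵥ u) u).im = -1 := by
      apply int_sq_le_one
      rcases hN' with rfl | rfl <;> nlinarith
    have hp2 : p = 2 ∧ N = -3 ∧ (hO (A.m *ᵥ u) u).im = 0 ∧ b.norm = 1 := by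
      rcases hN' with rfl | rfl
      · obtain rfl := eq_one_of_sq_le hp0 hb (by norm_num)
        exfalso
        rcases hy with hy | hy | hy <;> rw [hy] at h1 h3 <;> omega
      · rcases le_two_of_sq_le hp0 hb (by norm_num) with rfl | rfl
        · exfalso
          rcases hy with hy | hy | hy <;> rw [hy] at h1 h3 <;> omega
        · refine ⟨rfl, rfl, ?_⟩
          rcases hy with hy | hy | hy <;> rw [hy] at h1 h3 ⊢ <;> omega
    obtain ⟨rfl, rfl, hy0, hb1⟩ := hp2
    right
    refine ⟨rfl, ?_⟩
    rintro rfl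
    obtain ⟨hf', a1, a2⟩ := hf.hasFrame_of_replace ht hu hb1
    have hwu : hO (A.m *ᵥ u) u = -1 := by
      rw [hy0] at h3
      ext
      · simp; omega
      · simpa using hy0
    have hww : hO (A.m *ᵥ u) (A.m *ᵥ u) = 2 := by rw [hO_mulVec, hp]; simp
    obtain ⟨z', h', e1, e2, e3⟩ := hf'.exists_of_two_neg_one_two (by rw [hp]; simp) hwu hww
    exact ⟨_, e2, v, u, _, z', h', by rw [hp]; simp, hwu, hww, e1, rfl, e3, a1, a2⟩
  · obtain ⟨u, w, hf, hy0, hb⟩ := h.exists_skew_reduced hN hpos ht (by rw [hε2]; norm_num)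
    obtain ⟨n, hn⟩ := exists_hO_self u
    obtain ⟨a, b, hu, h1, h2⟩ := hf.exists_norm_eq ht hn hN
    have h3 := hf.two_re_add_im ht hn
    rw [hε2] at h1 hb
    have hbn := O.norm_nonneg b
    have hN' : N = 1 ∨ N = 3 := by omega
    have hy : (hO (A.m *ᵥ u) u).im = 0 ∨ (hO (A.m *ᵥ u) u).im = 1 ∨ (hO (A.m *ᵥ u) u).im = -1 := by
      apply int_sq_le_one
      rcases hN' with rfl | rfl <;> linarith
    have hy2 : (hO (A.m *ᵥ u) u).im ^ 2 = 1 := by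
      rcases hy with hy | hy | hy <;> rw [hy] at hy0 ⊢ <;> simp at hy0 ⊢
    rw [hy2] at h1
    rcases hN' with rfl | rfl
    · left
      refine ⟨rfl, n, (hO (A.m *ᵥ u) u).re, (hO (A.m *ᵥ u) u).im, ?_, by tauto, h3, ?_⟩
      all_goals
        have hnn : n = 0 ∨ n = 1 ∨ n = -1 := int_sq_le_one (by omega)
        have hn1 : n = 1 ∨ n = -1 := by
          rcases hnn with rfl | h | h
          · exfalso; omega
          · exact .inl h
          · exact .inr h
      · exact hn1
      have hb1 : b.norm = 1 := by rcases hn1 with rfl | rfl <;> omega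
      obtain ⟨hf', a1, a2⟩ := hf.hasFrame_of_replace ht hu hb1
      have hd := hf'.disc
      rw [hN] at hd
      obtain ⟨z', h', e1, e2, e3⟩ := hf'.exists_orthogonal hd (by norm_num)
      exact ⟨v, u, _, z', h', hn, rfl, by rw [hO_mulVec, hn], e1, e2, by rw [e3]; simp, a1, a2⟩
    · exfalso
      omega

/-- Elements of order four. -/
theorem IsFrame.normalForm_four (h : IsFrame A v u w z) (hN : hO v v = N)
    (ht : A.m.trace = 1) (hNv : N = 1 ∨ N = -1 ∨ N = 2 ∨ N = -2) :
    (N = -1 ∧ HasFrame A 1 0 1 0 0 (-1) 0 1 (-1) 0) ∨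
    (N = -2 ∧ (HasFrame A 2 ⟨1, -1⟩ 2 1 1 1 1 ⟨0, -1⟩ ⟨1, -1⟩ (-1) ∨
      HasFrame A 2 ⟨0, 1⟩ 2 1 1 1 1 ⟨-1, 1⟩ ⟨0, 1⟩ (-1))) := by
  have ht' : A.m.trace = 1 + (0 : ℤ) := by rw [ht]; simp
  rcases lt_or_gt_of_ne (show N ≠ 0 by omega) with hneg | hpos
  · obtain ⟨u, w, p, r, hf, hp, hr, hp0, hd, hq, hb⟩ := h.exists_reduced hN hneg
    obtain ⟨a, b, hu, h1, h2⟩ := hf.exists_norm_eq ht' hp hN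
    have h3 := hf.two_re_add_im ht' hp
    have hbn := O.norm_nonneg b
    have hN' : N = -1 ∨ N = -2 := by omega
    have hy : (hO (A.m *ᵥ u) u).im = 0 ∨ (hO (A.m *ᵥ u) u).im = 1 ∨ (hO (A.m *ᵥ u) u).im = -1 := by
      apply int_sq_le_one
      rcases hN' with rfl | rfl <;> nlinarith
    have hy0 : (hO (A.m *ᵥ u) u).im = 0 := by omega
    rw [hy0] at h1 h3
    have hb0 : hO (A.m *ᵥ u) u = 0 := by
      ext
      · simp; omega
      · simpa using hy0
    rcases hN' with rfl | rfl
    · left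
      refine ⟨rfl, ?_⟩
      obtain rfl := eq_one_of_sq_le hp0 hb (by norm_num)
      obtain ⟨hf', a1, a2⟩ := hf.hasFrame_of_replace ht' hu (by omega)
      have hd := hf'.disc
      rw [hN] at hd
      obtain ⟨z', h', e1, e2, e3⟩ := hf'.exists_orthogonal hd (by norm_num)
      exact ⟨v, u, _, z', h', by rw [hp]; simp, hb0, by rw [hO_mulVec, hp]; simp, e1, e2,
        by rw [e3]; simp, a1, by simpa using a2⟩
    · right
      refine ⟨rfl, ?_⟩
      rcases le_two_of_sq_le hp0 hb (by norm_num) with rfl | rfl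
      · exfalso; omega
      have hb2 : b.norm = 2 := by omega
      have key : ∀ {u w : V3} {a b : O}, IsFrame A v u w z → hO u u = 2 → hO (A.m *ᵥ u) u = 0 →
          A.m *ᵥ u = a • u + b • w → (b = ⟨0, -1⟩ ∨ b = ⟨-1, 1⟩) →
          HasFrame A 2 ⟨1, -1⟩ 2 1 1 1 1 ⟨0, -1⟩ ⟨1, -1⟩ (-1) ∨
          HasFrame A 2 ⟨0, 1⟩ 2 1 1 1 1 ⟨-1, 1⟩ ⟨0, 1⟩ (-1) := by
        intro u w a b hf huu hau hu hb
        have hbb : b * star b = 2 := by rcases hb with rfl | rfl <;> decide +kernel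
        have hb0 : b ≠ 0 := by rcases hb with rfl | rfl <;> decide +kernel
        have hk : ∃ k : O, a + k * -b ∈ ({0, 1} : Finset O) := by
          rcases hb with rfl | rfl
          · exact exists_add_tau_mul a
          · exact exists_add_tauBar_mul a
        obtain ⟨k, hk⟩ := hk
        have hf' := hf.shift k
        obtain ⟨a', b', c', d', hu', hw', htr, hdet⟩ := hf'.exists_action
        obtain ⟨ea, eb⟩ := hf'.coords_inj (a := a') (b := b') (c := a + k * -b) (d := b)
          (by rw [← hu', hu]; module)
        rw [← ea] at hk
        clear hu hf ea
        subst b'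
        generalize w + k • u = w at *
        rw [ht] at htr
        obtain rfl : d' = -a' := by linear_combination htr
        simp only [Finset.mem_insert, Finset.mem_singleton] at hk
        rcases hk with rfl | rfl
        · exfalso
          have h1 : IsUnit b := isUnit_of_dvd_one ⟨-c', by linear_combination -hdet⟩
          rcases O.isUnit_iff.1 h1 with rfl | rfl <;> exact absurd hbb (by decide +kernel)
        have hc : c' = -star b := mul_left_cancel₀ hb0 (by linear_combination -hdet + hbb)
        have hwu : hO w u = -star b := by
          rw [hu', hO_add_left, hO_smul_left, hO_smul_left, huu] at hau
          exact mul_left_cancel₀ hb0 (by linear_combination hau + hbb)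
        have hww : hO w w = 2 := by
          have hd := hf'.disc
          rw [huu, hN, ← star_hO w u, hwu] at hd
          simp only [star_neg, star_star] at hd
          have h2 : (2 : O) ≠ 0 := by decide +kernel
          refine mul_left_cancel₀ h2 ?_
          push_cast at hd
          linear_combination hd + hbb
        rw [hc] at hw'
        rcases hb with rfl | rfl
        · left
          have e : -star (⟨0, -1⟩ : O) = ⟨1, -1⟩ := by decide +kernel
          rw [e] at hwu hw'
          obtain ⟨z', h', e1, e2, e3⟩ := hf'.exists_of_two_tau_two huu (.inr hwu) hww
          exact ⟨v, u, w, z', h', huu, hwu, hww, e1, e2, e3, hu', hw'⟩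
        · right
          have e : -star (⟨-1, 1⟩ : O) = ⟨0, 1⟩ := by decide +kernel
          rw [e] at hwu hw'
          obtain ⟨z', h', e1, e2, e3⟩ := hf'.exists_of_two_tau_two huu (.inl hwu) hww
          exact ⟨v, u, w, z', h', huu, hwu, hww, e1, e2, e3, hu', hw'⟩
      have hp2 : hO u u = 2 := by rw [hp]; simp
      have hneg : A.m *ᵥ u = a • u + (-b) • ((-1 : O) • w) := by rw [hu]; module
      rcases O.eq_of_norm_two hb2 with rfl | rfl | rfl | rfl
      · exact key (hf.smul_right isUnit_one.neg) hp2 hb0 hneg (.inl (by decide +kernel))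
      · exact key hf hp2 hb0 hu (.inl rfl)
      · exact key (hf.smul_right isUnit_one.neg) hp2 hb0 hneg (.inr (by decide +kernel))
      · exact key hf hp2 hb0 hu (.inr rfl)
  · exfalso
    obtain ⟨u, w, hf, hy0, hb⟩ := h.exists_skew_reduced hN hpos ht' (by norm_num)
    obtain ⟨n, hn⟩ := exists_hO_self u
    have h3 := hf.two_re_add_im ht' hn
    have hy : (hO (A.m *ᵥ u) u).im = 0 ∨ (hO (A.m *ᵥ u) u).im = 1 ∨ (hO (A.m *ᵥ u) u).im = -1 := by
      apply int_sq_le_one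
      have hN' : N = 1 ∨ N = 2 := by omega
      rcases hN' with rfl | rfl <;> linarith
    omega

end normalForms

/-! ### Elements of order seven -/

theorem herm_neg_left (x y : Fin 3 → ℂ) : herm (-x) y = -herm x y := by
  rw [← neg_one_smul ℂ x, herm_smul_left]; ring

theorem herm_neg_right (x y : Fin 3 → ℂ) : herm x (-y) = -herm x y := by
  rw [← neg_one_smul ℂ y, herm_smul_right]; simp

section spectral

variable {t c : ℂ}

theorem eigenvalue_eq {A : SU} {p : Fin 3 → ℂ} (hp0 : p ≠ 0) (h : mC A.m *ᵥ p = c • p) :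
    c ^ 3 - toC A.m.trace * c ^ 2 + toC (star A.m.trace) * c - 1 = 0 := by
  have h1 := congrArg (fun M => mC M *ᵥ p) A.cayley_hamilton
  simp only [map_sub, map_add, map_mul, map_one, mC_smul, map_zero, sub_mulVec, add_mulVec,
    smul_mulVec, one_mulVec, zero_mulVec, pow_succ, pow_zero, one_mul, ← mulVec_mulVec, h,
    mulVec_smul, smul_smul] at h1
  have h2 : (c ^ 3 - toC A.m.trace * c ^ 2 + toC (star A.m.trace) * c - 1) • p = 0 := by
    rw [← h1]; module
  exact (smul_eq_zero.1 h2).resolve_right hp0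

theorem trace_seven_sq : (toC ⟨0, -1⟩) ^ 2 + toC ⟨0, -1⟩ + 2 = 0 := by
  have : (⟨0, -1⟩ : O) ^ 2 + ⟨0, -1⟩ + 2 = 0 := by decide +kernel
  have h := congrArg toC this
  simpa only [map_add, map_pow, map_ofNat, map_zero] using h

/-- The relations between the eigenvalue and the trace of an element of order seven. -/
theorem sq_eigenvalue {d : ℂ} (hcd : c * d = 1) (hc : c ^ 3 - t * c ^ 2 + (-1 - t) * c - 1 = 0) :
    c ^ 2 = t * c + 1 + t + d := by
  linear_combination d * hc + (-c ^ 2 + t * c + 1 + t) * hcd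

theorem cubic_of_eigenvalue {d : ℂ} (ht : t ^ 2 + t + 2 = 0) (hcd : c * d = 1)
    (hc2 : c ^ 2 = t * c + 1 + t + d) (hd2 : d ^ 2 = (-1 - t) * d - t + c) :
    (c + d) ^ 3 + (c + d) ^ 2 - 2 * (c + d) - 1 = 0 := by
  linear_combination (c + t + 1) * hc2 + (d - t) * hd2 + (3 * (c + d) + 4) * hcd + 2 * ht + (c + d) * ht

/-- The element `A`, `A²` or `A⁴` has an eigenvalue with positive real part. -/
theorem exists_pow_re_pos {d : ℂ} (hd : d = star c) (hcd : c * d = 1)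
    (hcub : (c + d) ^ 3 + (c + d) ^ 2 - 2 * (c + d) - 1 = 0) :
    ∃ k ∈ ({1, 2, 4} : Finset ℕ), 0 < (c ^ k).re := by
  set x : ℝ := 2 * c.re with hx
  have hxc : c + d = x := by
    rw [hd, Complex.star_def, Complex.add_conj]
  have h1 : x ^ 3 + x ^ 2 - 2 * x - 1 = 0 := by
    rw [hxc] at hcub; exact_mod_cast hcub
  have hsum : ∀ k, ((2 * (c ^ k).re : ℝ) : ℂ) = c ^ k + d ^ k := by
    intro k
    rw [← Complex.add_conj, map_pow, ← Complex.star_def, hd]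
  have h2 : 2 * (c ^ 2).re = x ^ 2 - 2 := by
    have : ((2 * (c ^ 2).re : ℝ) : ℂ) = ((x ^ 2 - 2 : ℝ) : ℂ) := by
      rw [hsum]; push_cast; rw [← hxc]; linear_combination (-2) * hcd
    exact_mod_cast this
  have h4 : 2 * (c ^ 4).re = (x ^ 2 - 2) ^ 2 - 2 := by
    have : ((2 * (c ^ 4).re : ℝ) : ℂ) = (((x ^ 2 - 2) ^ 2 - 2 : ℝ) : ℂ) := by
      rw [hsum]; push_cast; rw [← hxc]
      linear_combination (-4 * c ^ 2 - 4 * d ^ 2 - 6 * c * d + 2 ) * hcd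
    exact_mod_cast this
  by_contra hne
  push Not at hne
  have e1 := hne 1 (by simp)
  have e2 := hne 2 (by simp)
  have e4 := hne 4 (by simp)
  rw [pow_one] at e1
  have f1 : x ≤ 0 := by linarith
  have f2 : x ^ 2 - 2 ≤ 0 := by linarith
  have f4 : (x ^ 2 - 2) ^ 2 - 2 ≤ 0 := by linarith
  have h5 := mul_nonneg_of_nonpos_of_nonpos f1 f2
  have h6 := mul_nonpos_of_nonneg_of_nonpos h5 f4
  have h7 : x * (x ^ 2 - 2) * ((x ^ 2 - 2) ^ 2 - 2) = 1 := by
    linear_combination (x ^ 4 - x ^ 3 - 3 * x ^ 2 + 2 * x + 1) * h1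
  linarith

end spectral

/-- The form `-⟨(A + A⁻¹) x, x⟩` is positive if `A` has order seven and its negative eigenvector has
an eigenvalue with positive real part. -/
theorem re_herm_neg_of_order_seven {A : SU} {p : Fin 3 → ℂ} {c : ℂ} (hp : (herm p p).re < 0)
    (h : mC A.m *ᵥ p = c • p) (ht : A.m.trace = ⟨0, -1⟩) (hc : 0 < c.re) {x : Fin 3 → ℂ}
    (hx : x ≠ 0) : (herm (mC A.m *ᵥ x) x).re < 0 := by
  have hA1 : A ≠ 1 := by rintro rfl; revert ht; decide +kernel
  obtain ⟨t, htdef⟩ : ∃ t, t = toC A.m.trace := ⟨_, rfl⟩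
  obtain ⟨d, hd⟩ : ∃ d, d = star c := ⟨_, rfl⟩
  have htt : t ^ 2 + t + 2 = 0 := by rw [htdef, ht]; exact trace_seven_sq
  have hts : toC (star A.m.trace) = -1 - t := by
    rw [htdef, ht, ← map_one toC, ← map_neg, ← map_sub]
    congr 1
  have hcd : c * d = 1 := by
    rw [hd, Complex.star_def, Complex.mul_conj, SU.normSq_eigenvalue hp.ne h]; simp
  have hchar := eigenvalue_eq (ne_zero_of_neg hp) h
  rw [hts, ← htdef] at hchar
  have hc2 := sq_eigenvalue hcd hchar
  have hd2 : d ^ 2 = (-1 - t) * d - t + c := by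
    have h1 := congrArg star hc2
    have h2 : star t = -1 - t := by rw [← hts, toC_star, htdef]
    simp only [star_pow, star_add, star_mul', star_one, h2, ← hd] at h1
    rw [hd, star_star, ← hd] at h1
    linear_combination h1
  have hcub := cubic_of_eigenvalue htt hcd hc2 hd2
  set μ : ℝ := 2 * c.re with hμ
  have hμc : c + d = μ := by rw [hd, Complex.star_def, Complex.add_conj]
  have hμ1 : μ * (μ ^ 2 + μ - 2) = 1 := by
    have : (μ : ℂ) * (μ ^ 2 + μ - 2) = 1 := by rw [← hμc]; linear_combination hcub
    exact_mod_cast this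
  have hμ0 : 0 < μ := by rw [hμ]; linarith
  have hδ : 0 < μ ^ 2 + μ - 2 := by
    by_contra hle
    push Not at hle
    have := mul_nonpos_of_nonneg_of_nonpos hμ0.le hle
    linarith
  have hpp : herm p p ≠ 0 := fun h0 => by rw [h0] at hp; simp at hp
  have hc0 : c ≠ 0 := left_ne_zero_of_mul_eq_one hcd
  -- the orthogonal complement of `p`
  have hperp : ∀ y, herm y p = 0 → herm (mC A.m *ᵥ y) p = 0 := by
    intro y hy
    have h1 := herm_mulVec A y p
    rw [h, hy, herm_smul_right] at h1
    exact (mul_eq_zero.1 h1).resolve_left (star_ne_zero.2 hc0)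
  have hquad : ∀ y, herm y p = 0 →
      mC A.m *ᵥ (mC A.m *ᵥ y) = (t - c) • (mC A.m *ᵥ y) - d • y := by
    intro y hy
    set z := mC A.m *ᵥ (mC A.m *ᵥ y) - (t - c) • (mC A.m *ᵥ y) + d • y with hz
    have hzp : herm z p = 0 := by
      rw [hz, herm_add_left, herm_sub_left, herm_smul_left, herm_smul_left, hperp _ (hperp _ hy),
        hperp _ hy, hy]
      ring
    have hAz : mC A.m *ᵥ z = c • z := by
      have h1 := congrArg (fun M => mC M *ᵥ y) A.cayley_hamilton
      simp only [map_sub, map_add, map_mul, map_one, mC_smul, map_zero, sub_mulVec, add_mulVec,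
        smul_mulVec, one_mulVec, zero_mulVec, pow_succ, pow_zero, one_mul, ← mulVec_mulVec,
        hts, ← htdef] at h1
      rw [← sub_eq_zero, ← h1, hz]
      simp only [mulVec_add, mulVec_sub, mulVec_smul, smul_add, smul_sub, smul_smul, hcd]
      have h2 : c * (t - c) = -1 - t - d := by linear_combination -hc2
      rw [h2]
      module
    by_cases hz0 : z = 0
    · rw [hz] at hz0
      rw [← sub_eq_zero, ← hz0]; abel
    · exfalso
      have h1 := (SU.trace_of_double hp h hAz (fun a ha => by
        rw [ha, herm_smul_left] at hzp
        have ha0 := (mul_eq_zero.1 hzp).resolve_right hpp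
        exact hz0 (by rw [ha, ha0, zero_smul])) hA1).1
      rw [ht] at h1
      revert h1; decide +kernel
  have key : ∀ y, herm y p = 0 → y ≠ 0 → (herm (mC A.m *ᵥ y) y).re < 0 := by
    intro y hy hy0
    set z := (c - 1) • (mC A.m *ᵥ y) - (c * (t - c)) • y with hz
    have hinv : ∀ a b, herm (mC A.m *ᵥ a) b = herm a (mC (A⁻¹).m *ᵥ b) := by
      intro a b
      rw [← herm_mulVec A a, mulVec_mulVec, ← map_mul, SU.m_mul_inv, map_one, one_mulVec]
    have hAinv : ∀ y, herm y p = 0 → mC (A⁻¹).m *ᵥ y = (c * (t - c)) • y - c • (mC A.m *ᵥ y) := by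
      intro y hy
      have h1 := congrArg (fun v => c • (mC (A⁻¹).m *ᵥ v)) (hquad y hy)
      simp only [mulVec_sub, mulVec_smul, mulVec_mulVec, ← map_mul, smul_sub, smul_smul, hcd] at h1
      rw [← mul_assoc, SU.m_inv_mul, one_mul, map_one, one_mulVec, one_smul] at h1
      rw [h1]; abel
    have hzH : z = -(mC A.m *ᵥ y + mC (A⁻¹).m *ᵥ y) := by
      rw [hAinv y hy, hz]; module
    have hzp : herm z p = 0 := by
      rw [hz, herm_sub_left, herm_smul_left, herm_smul_left, hperp _ hy, hy]; ring
    have hzz : -(mC A.m *ᵥ z + mC (A⁻¹).m *ᵥ z) =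
        ((μ : ℂ) + 1) • z - ((μ : ℂ) ^ 2 + μ - 2) • y := by
      rw [hAinv z hzp, hz]
      simp only [mulVec_sub, mulVec_smul, hquad y hy, ← hμc]
      have e1 : (t - c) * (1 - c ^ 2) = (c + d + 1) * (c - 1) := by
        linear_combination (c - 1) * hc2
      have hcs : c * (t - c) = -1 - t - d := by linear_combination -hc2
      have e2 : -((c - 1) * (c - 1) * d) + (c * (t - c)) ^ 2 =
          -((c + d + 1) * (c * (t - c))) - ((c + d) ^ 2 + (c + d) - 2) := by
        rw [hcs]
        linear_combination (-c + 3) * hcd + hc2 + hd2 + htt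
      calc _ = ((t - c) * (1 - c ^ 2)) • (mC A.m *ᵥ y) +
            (-((c - 1) * (c - 1) * d) + (c * (t - c)) ^ 2) • y := by module
        _ = _ := by rw [e1, e2]; module
    have h1 : herm z y = -(herm (mC A.m *ᵥ y) y + star (herm (mC A.m *ᵥ y) y)) := by
      rw [hzH, star_herm, herm_neg_left, herm_add_left]
      have : herm y (mC A.m *ᵥ y) = herm (mC (A⁻¹).m *ᵥ y) y := by
        rw [← star_herm, hinv, star_herm]
      rw [this]
    have h2 : herm (-(mC A.m *ᵥ z + mC (A⁻¹).m *ᵥ z)) y = herm z z := by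
      conv_rhs => rhs; rw [hzH]
      rw [herm_neg_left, herm_neg_right, herm_add_left, herm_add_right, hinv]
      have : herm z (mC A.m *ᵥ y) = herm (mC (A⁻¹).m *ᵥ z) y := by
        rw [← star_herm, hinv, star_herm]
      rw [this]; ring
    rw [hzz, herm_sub_left, herm_smul_left, herm_smul_left, h1] at h2
    have h3 := congrArg Complex.re h2
    rw [herm_self_eq y] at h3
    have h4 : ((μ : ℂ) + 1) = ((μ + 1 : ℝ) : ℂ) := by push_cast; ring
    have h5 : ((μ : ℂ) ^ 2 + μ - 2) = ((μ ^ 2 + μ - 2 : ℝ) : ℂ) := by push_cast; ring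
    rw [h4, h5, Complex.sub_re, Complex.re_ofReal_mul, Complex.re_ofReal_mul, Complex.ofReal_re,
      Complex.neg_re, Complex.add_re, Complex.star_def, Complex.conj_re] at h3
    have h6 := herm_self_pos hp hy hy0
    have h7 : 0 ≤ (herm z z).re := by
      by_cases hz0 : z = 0
      · rw [hz0, herm_zero_left]; simp
      · exact (herm_self_pos hp hzp hz0).le
    have h8 := mul_pos hδ h6
    nlinarith
  -- decomposition of `x`
  set a := herm x p / herm p p with ha
  set y := x - a • p with hy
  have hyp : herm y p = 0 := by
    rw [hy, herm_sub_left, herm_smul_left, ha, div_mul_cancel₀ _ hpp, sub_self]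
  have hxy : x = y + a • p := by rw [hy]; abel
  have h1 : herm (mC A.m *ᵥ x) x = herm (mC A.m *ᵥ y) y + c * (a * star a) * herm p p := by
    rw [hxy, mulVec_add, mulVec_smul, h]
    simp only [herm_add_left, herm_add_right, herm_smul_left, herm_smul_right, hperp y hyp,
      herm_comm_eq_zero hyp]
    ring
  have h2 : (c * (a * star a) * herm p p).re = c.re * (Complex.normSq a * (herm p p).re) := by
    rw [herm_self_eq p, Complex.star_def, Complex.mul_conj, mul_assoc, ← Complex.ofReal_mul,
      Complex.re_mul_ofReal, Complex.ofReal_re]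
  rw [h1, Complex.add_re, h2]
  by_cases hy0 : y = 0
  · have ha0 : a ≠ 0 := by rintro h0; rw [hxy, hy0, h0] at hx; simp at hx
    rw [hy0, mulVec_zero, herm_zero_left, Complex.zero_re, zero_add]
    exact mul_neg_of_pos_of_neg hc (mul_neg_of_pos_of_neg (Complex.normSq_pos.2 ha0) hp)
  · have h3 := key y hyp hy0
    have h4 : Complex.normSq a * (herm p p).re ≤ 0 :=
      mul_nonpos_of_nonneg_of_nonpos (Complex.normSq_nonneg a) hp.le
    nlinarith

theorem gram_cols₂ (u w z u' w' z' : V3) : (cols u w z)ᴴ * J0 * cols u' w' z' =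
    !![hO u' u, hO w' u, hO z' u; hO u' w, hO w' w, hO z' w; hO u' z, hO w' z, hO z' z] := by
  refine Matrix.ext fun i j => ?_
  fin_cases j <;> fin_cases i <;>
    simp [cols, J0, Matrix.mul_apply, Fin.sum_univ_three, conjTranspose_apply, hO_eq] <;> ring

theorem det_sq_add_one {R : Type*} [CommRing R] (A : Matrix (Fin 3) (Fin 3) R) :
    (A * A + 1).det = A.det ^ 2 + (A.adjugate.trace ^ 2 - 2 * A.trace * A.det) +
      (A.trace ^ 2 - 2 * A.adjugate.trace) + 1 := by
  simp only [det_fin_three, adjugate_fin_three, trace_fin_three, Matrix.add_apply, Matrix.mul_apply,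
    Fin.sum_univ_three]
  simp
  ring

namespace SU

/-- The matrix `-(A + A⁻¹)`. -/
def negSum (A : SU) : M3 := -(A.m + (A⁻¹).m)

theorem det_negSum {A : SU} (ht : A.m.trace = ⟨0, -1⟩) : A.negSum.det = -1 := by
  have h1 : (A.m * (A.m + (A⁻¹).m)).det = 1 := by
    rw [mul_add, A.m_mul_inv, det_sq_add_one, A.adjugate, A.trace_inv, A.det_m, ht]
    decide +kernel
  rw [det_mul, A.det_m, one_mul] at h1
  rw [negSum, det_neg, h1, Fintype.card_fin]
  norm_num

/-- The Hermitian form `-⟨(A + A⁻¹) x, y⟩`. -/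
def sumForm (A : SU) (x y : V3) : O := hO (A.negSum *ᵥ x) y

theorem sumForm_eq (A : SU) (x y : V3) :
    A.sumForm x y = -(hO (A.m *ᵥ x) y + hO x (A.m *ᵥ y)) := by
  rw [sumForm, negSum, neg_mulVec, add_mulVec, hO_neg_left, hO_add_left, hO_inv_mulVec]

theorem isHermForm_sumForm (A : SU) : IsHermForm A.sumForm where
  add_left x y z := by simp only [sumForm, mulVec_add, hO_add_left]
  smul_left c x y := by simp only [sumForm, mulVec_smul, hO_smul_left]
  symm x y := by
    simp only [sumForm_eq, star_neg, star_add, star_hO]; ring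

theorem sumForm_map (A : SU) (x y : V3) : A.sumForm (A.m *ᵥ x) (A.m *ᵥ y) = A.sumForm x y := by
  simp only [sumForm_eq, hO_mulVec]

theorem det_gram_sumForm {A : SU} (ht : A.m.trace = ⟨0, -1⟩) (u w z : V3) :
    (!![A.sumForm u u, A.sumForm w u, A.sumForm z u; A.sumForm u w, A.sumForm w w, A.sumForm z w;
      A.sumForm u z, A.sumForm w z, A.sumForm z z] : M3).det = ((cols u w z).det.norm : ℤ) := by
  simp only [sumForm]
  have hJ : J0.det = -1 := by decide +kernel
  rw [← gram_cols₂, ← mul_cols, ← mul_assoc, det_mul, det_mul, det_mul, det_conjTranspose, hJ,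
    det_negSum ht, ← O.mul_star]
  ring

end SU

/-- A form on the lattice which takes positive values. -/
structure IsPosForm (F : V3 → V3 → O) : Prop extends IsHermForm F where
  pos : ∀ x n, x ≠ 0 → F x x = ((n : ℤ) : O) → 0 < n

namespace IsPosForm

variable {F : V3 → V3 → O}

theorem norm_le (hF : IsPosForm F) {x z : V3} {m : ℤ} (hm : 0 < m) (hx : F x x = m)
    (hz : F z z = m) : (F z x).norm ≤ m ^ 2 := by
  by_contra hlt
  push Not at hlt
  set y := (m : O) • z - F z x • x with hy
  have hyy : F y y = ((m * (m ^ 2 - (F z x).norm) : ℤ) : O) := by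
    have e : y = (m : O) • z + (-F z x) • x := by rw [hy]; module
    rw [e]
    simp only [hF.add_left, hF.add_right, hF.smul_left, hF.smul_right, hx, hz]
    push_cast
    rw [← O.mul_star, hF.symm, ← hF.symm z x]
    simp only [star_neg]
    have : star (m : O) = m := by simp
    rw [this]
    ring
  by_cases hy0 : y = 0
  · have h0 : F y y = 0 := by
      rw [hy0, show (0 : V3) = (0 : O) • 0 by simp, hF.smul_left, zero_mul]
    rw [h0] at hyy
    have : m * (m ^ 2 - (F z x).norm) = 0 := by exact_mod_cast hyy.symm
    rcases mul_eq_zero.1 this with h | h <;> omega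
  · have := hF.pos y _ hy0 hyy
    have h1 := (mul_pos_iff_of_pos_left hm).1 this
    omega

theorem eq_of_norm_eq (hF : IsPosForm F) {x z : V3} {m : ℤ} (hx : F x x = m)
    (hz : F z z = m) (h : (F z x).norm = m ^ 2) : (m : O) • z = F z x • x := by
  by_contra hne
  set y := (m : O) • z - F z x • x with hy
  have hyy : F y y = ((m * (m ^ 2 - (F z x).norm) : ℤ) : O) := by
    have e : y = (m : O) • z + (-F z x) • x := by rw [hy]; module
    rw [e]
    simp only [hF.add_left, hF.add_right, hF.smul_left, hF.smul_right, hx, hz]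
    push_cast
    rw [← O.mul_star, hF.symm, ← hF.symm z x]
    simp only [star_neg]
    have : star (m : O) = m := by simp
    rw [this]
    ring
  have := hF.pos y _ (sub_ne_zero.2 hne) hyy
  rw [h] at this
  simp at this

/-- A positive Hermitian form of determinant one on the lattice has a vector of square norm at most
two. -/
theorem exists_le_two (hF : IsPosForm F)
    (hdet : ∀ u w z, IsUnit (cols u w z).det → (!![F u u, F w u, F z u; F u w, F w w, F z w;
      F u z, F w z, F z z] : M3).det = 1) : ∃ x, ∃ m : ℤ, F x x = m ∧ (m = 1 ∨ m = 2) := by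
  have hex : ∃ n : ℕ, ∃ x, x ≠ 0 ∧ F x x = ((n : ℤ) : O) := by
    obtain ⟨n, hn⟩ := hF.exists_int (fun _ => 1)
    have h0 : (fun _ => 1 : V3) ≠ 0 := fun h => one_ne_zero (congrFun h 0)
    have h1 := hF.pos _ _ h0 hn
    exact ⟨n.toNat, _, h0, by rw [hn, Int.toNat_of_nonneg h1.le]⟩
  classical
  obtain ⟨x₀, hx₀, hFx₀⟩ := Nat.find_spec hex
  have hmin : ∀ y (k : ℤ), y ≠ 0 → F y y = k → (Nat.find hex : ℤ) ≤ k := by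
    intro y k hy hk
    have h1 := hF.pos y k hy hk
    have h2 := Nat.find_min' hex ⟨y, hy, (by rw [hk, Int.toNat_of_nonneg h1.le] :
      F y y = ((k.toNat : ℤ) : O))⟩
    omega
  generalize (Nat.find hex : ℤ) = m at *
  obtain ⟨g, x, y, hg, rfl, hxy⟩ := exists_primitive hx₀
  have hx0 : x ≠ 0 := by rintro rfl; rw [smul_zero] at hx₀; exact hx₀ rfl
  obtain ⟨k, hk⟩ := hF.exists_int x
  have hk0 := hF.pos _ _ hx0 hk
  have hkm : k = m := by
    refine le_antisymm ?_ (hmin x k hx0 hk)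
    rw [hF.smul_left, hF.smul_right, hk, ← mul_assoc, O.mul_star] at hFx₀
    have h1 : g.norm * k = m := by exact_mod_cast hFx₀
    have := O.norm_pos hg
    nlinarith
  subst hkm
  refine ⟨x, k, hk, ?_⟩
  -- complete `x` to a basis
  obtain ⟨u₀, w₀, z₀, hu₀, hw₀, hz₀, hd₀⟩ := exists_basis_of_primitive (v := y) (x := x)
    (by rw [← star_hO, hxy, star_one])
  have hd : IsUnit (cols u₀ w₀ x).det := by
    obtain ⟨c, hc⟩ := exists_coords hd₀ x
    rw [cols_mulVec] at hc
    have hc2 : c 2 = 1 := by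
      have h1 := congrArg (hO · y) hc
      simp only [hO_add_left, hO_smul_left, hu₀, hw₀, hz₀] at h1
      rw [← star_hO y x, hxy] at h1
      simpa using h1
    have : (cols u₀ w₀ x).det = (cols u₀ w₀ z₀).det := by
      rw [← hc, hc2, det_cols, det_cols]
      simp only [Pi.add_apply, Pi.smul_apply, smul_eq_mul]
      ring
    rwa [this]
  have hF' : IsHermForm fun a b => (k : O) * F a b - F a x * F x b := by
    refine ⟨fun a b c => ?_, fun c a b => ?_, fun a b => ?_⟩
    · rw [hF.add_left, hF.add_left]; ring
    · rw [hF.smul_left, hF.smul_left]; ring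
    · rw [star_sub, star_mul', star_mul', hF.symm, hF.symm, hF.symm]
      have : star (k : O) = k := by simp
      rw [this]; ring
  obtain ⟨u, w, p, hP, hp, hp0, -, hb⟩ := hF'.exists_reduced
    (P := fun u w => IsUnit (cols u w x).det) hk0 (fun u w h => by
      have : (cols w u x).det = -(cols u w x).det := by rw [det_cols, det_cols]; ring
      rw [this]; exact h.neg)
    (fun u w l h => by
      have : (cols u (w + l • u) x).det = (cols u w x).det := by
        rw [det_cols, det_cols]; simp only [Pi.add_apply, Pi.smul_apply, smul_eq_mul]; ring
      rwa [this])
    (fun u w h => by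
      have h1 := hdet u w x h
      rw [det_fin_three] at h1
      simp only [of_apply, cons_val', cons_val_zero, cons_val_one, cons_val] at h1
      rw [hk] at h1
      linear_combination (k : O) * h1) hd
  obtain ⟨l, hl⟩ := O.exists_div (F u x) (b := (k : O)) (Int.cast_ne_zero.2 hk0.ne')
  rw [O.norm_intCast] at hl
  set u' := u + (-l) • x with hu'
  have e1 : F u' x = F u x - l * k := by rw [hu', hF.add_left, hF.smul_left, hk]; ring
  have e2 : F x u' = F x u - star l * k := by rw [hu', hF.add_right, hF.smul_right, hk, star_neg]; ring
  rw [← e1] at hl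
  obtain ⟨r, hr⟩ := hF.exists_int u'
  have hu0 : u' ≠ 0 := by
    intro h0
    have h1 : (cols u w x).det = (cols u' w x).det := by
      rw [hu', det_cols, det_cols]; simp only [Pi.add_apply, Pi.smul_apply, smul_eq_mul]; ring
    rw [h1, h0, det_cols] at hP
    simp at hP
  have hrk := hmin u' r hu0 hr
  have hpr : p = k * r - (F u' x).norm := by
    have : (p : O) = ((k * r - (F u' x).norm : ℤ) : O) := by
      rw [← hp]
      push_cast
      rw [← O.mul_star, hF.symm, e1, e2, ← hr]
      rw [hu', hF.add_left, hF.add_right, hF.add_right, hF.smul_left, hF.smul_left, hF.smul_right,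
        hF.smul_right, hk, star_neg]
      ring
    exact_mod_cast this
  have h1 : 3 * k ^ 2 ≤ 7 * p := by
    rw [hpr]; nlinarith
  have h2 : k < 3 := by
    by_contra hle
    push Not at hle
    have h3 : 3 * k ^ 2 * (3 * k ^ 2) ≤ 7 * p * (7 * p) :=
      mul_le_mul h1 h1 (by positivity) (by nlinarith)
    have h4 : k * k ≥ 3 * k := by nlinarith
    have h5 : k ^ 2 * k ^ 2 ≥ 27 * k := by nlinarith
    nlinarith
  omega

end IsPosForm

theorem isPosForm_sumForm {A : SU} {p : Fin 3 → ℂ} {c : ℂ} (hp : (herm p p).re < 0)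
    (h : mC A.m *ᵥ p = c • p) (ht : A.m.trace = ⟨0, -1⟩) (hc : 0 < c.re) : IsPosForm A.sumForm where
  toIsHermForm := A.isHermForm_sumForm
  pos x n hx hn := by
    have h1 := re_herm_neg_of_order_seven hp h ht hc (vC_ne_zero hx)
    rw [mC_mulVec, herm_vC] at h1
    rw [SU.sumForm_eq, ← star_hO (A.m *ᵥ x) x] at hn
    have h2 := congrArg (fun y => (toC y).re) hn
    simp only [map_neg, map_add, toC_star, Complex.neg_re, Complex.add_re, Complex.star_def,
      Complex.conj_re, map_intCast, Complex.intCast_re] at h2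
    have : (0 : ℝ) < n := by linarith
    exact_mod_cast this

@[simp] theorem O.re_four : (4 : O).re = 4 := by decide +kernel
@[simp] theorem O.im_four : (4 : O).im = 0 := by decide +kernel

theorem O.bounds_of_norm_le_four {z : O} (h : z.norm ≤ 4) :
    z.re ∈ Finset.Icc (-2 : ℤ) 2 ∧ z.im ∈ Finset.Icc (-1 : ℤ) 1 := by
  rw [O.norm_eq] at h
  simp only [Finset.mem_Icc]
  have h1 : z.im ^ 2 < 4 := by nlinarith [sq_nonneg (2 * z.re + z.im)]
  have h2 : z.re ^ 2 < 9 := by nlinarith [sq_nonneg (z.re + 4 * z.im)]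
  have h3 : -2 < z.im := by nlinarith
  have h4 : z.im < 2 := by nlinarith
  have h5 : -3 < z.re := by nlinarith
  have h6 : z.re < 3 := by nlinarith
  omega

/-- The Gram matrix of a vector and its first two images, as a function of `⟨x, x⟩`, `⟨A x, x⟩` and
`⟨A² x, x⟩`. -/
def gramSeven (n b₁ b₂ : O) : M3 := !![n, b₁, b₂; star b₁, n, b₁; star b₂, star b₁, n]

theorem det_gramSeven (n b₁ b₂ : O) : (gramSeven n b₁ b₂).det = n * n * n - n * b₁ * star b₁ -
    b₁ * star b₁ * n + b₁ * b₁ * star b₂ + b₂ * star b₁ * star b₁ - b₂ * n * star b₂ := by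
  rw [gramSeven, det_fin_three]; simp

/-- The value of `4 ⟨A x, x⟩` in terms of `n = ⟨x, x⟩` and two values of the form `SU.sumForm`. -/
def fourSeven (n : ℤ) (f₁ f₂ : O) : O := (f₂ - ⟨0, -1⟩ * f₁ + n * ⟨1, 1⟩) * ⟨-1, -1⟩

/-- The value of `⟨x, x⟩` in terms of values of the form `SU.sumForm`. -/
def normSeven (m : ℤ) (f₁ f₂ : O) : ℤ :=
  4 * m + 2 * ((f₂ - ⟨0, -1⟩ * f₁) * ⟨-1, -1⟩).re + ((f₂ - ⟨0, -1⟩ * f₁) * ⟨-1, -1⟩).im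

/-- The determinant of `gramSeven`, expanded. -/
def gramSevenDet (n b₁ b₂ : O) : O := n * n * n - n * b₁ * star b₁ -
    b₁ * star b₁ * n + b₁ * b₁ * star b₂ + b₂ * star b₁ * star b₁ - b₂ * n * star b₂

/-- The finite search that classifies the Gram matrices of order seven. -/
theorem gramSeven_search : ∀ m ∈ ({1, 2} : Finset ℤ), ∀ a ∈ Finset.Icc (-2 : ℤ) 2,
    ∀ b ∈ Finset.Icc (-1 : ℤ) 1, ∀ c ∈ Finset.Icc (-2 : ℤ) 2, ∀ d ∈ Finset.Icc (-1 : ℤ) 1,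
    QuadraticAlgebra.norm (⟨a, b⟩ : O) ≤ m ^ 2 → QuadraticAlgebra.norm (⟨c, d⟩ : O) ≤ m ^ 2 →
    ∀ n ∈ ({normSeven m ⟨a, b⟩ ⟨c, d⟩} : Finset ℤ),
    ∀ b₁ ∈ ({⟨(fourSeven n ⟨a, b⟩ ⟨c, d⟩).re / 4, (fourSeven n ⟨a, b⟩ ⟨c, d⟩).im / 4⟩} : Finset O),
    4 * b₁ = fourSeven n ⟨a, b⟩ ⟨c, d⟩ →
    gramSevenDet n b₁ (-⟨a, b⟩ - n) = -gramSevenDet m ⟨a, b⟩ ⟨c, d⟩ →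
    (gramSevenDet n b₁ (-⟨a, b⟩ - n)).re ≤ 0 →
    ((n : O) = 1 ∧ b₁ = -1 ∧ -⟨a, b⟩ - (n : O) = 0) ∨
    ((n : O) = 3 ∧ b₁ = ⟨0, -2⟩ ∧ -⟨a, b⟩ - (n : O) = ⟨-3, 1⟩) ∨
      ((n : O) = 0 ∧ b₁ = -1 ∧ -⟨a, b⟩ - (n : O) = ⟨-1, 1⟩) ∨ (m = 2 ∧ c = 2 ∧ d = -1) := by
  decide +kernel

/-- The possible values of `(⟨x, x⟩, ⟨A x, x⟩, ⟨A² x, x⟩)` for a short vector. -/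
def IsGramSeven (n b₁ b₂ : O) : Prop := (n = 1 ∧ b₁ = -1 ∧ b₂ = 0) ∨
  (n = 3 ∧ b₁ = ⟨0, -2⟩ ∧ b₂ = ⟨-3, 1⟩) ∨ (n = 0 ∧ b₁ = -1 ∧ b₂ = ⟨-1, 1⟩)

theorem SU.gram_cols_seven (A : SU) (x : V3) : (cols x (A.m *ᵥ x) (A.m *ᵥ (A.m *ᵥ x)))ᴴ * J0 *
    cols x (A.m *ᵥ x) (A.m *ᵥ (A.m *ᵥ x)) =
      gramSeven (hO x x) (hO (A.m *ᵥ x) x) (hO (A.m *ᵥ (A.m *ᵥ x)) x) := by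
  rw [gram_cols, gramSeven]
  simp only [star_hO, hO_mulVec]

theorem SU.pow_mulVec_eq {A : SU} {x : V3} {m f : O} (h : m • (A.m *ᵥ x) = f • x) (k : ℕ) :
    m ^ k • ((A ^ k).m *ᵥ x) = f ^ k • x := by
  induction k with
  | zero => simp [SU.m_one]
  | succ k ih =>
    rw [pow_succ' A, SU.m_mul, ← mulVec_mulVec, pow_succ, pow_succ, mul_comm, mul_smul,
      ← mulVec_smul, ih, mulVec_smul, smul_comm, h, smul_smul]

/-- A short vector for an element of order seven. -/
theorem SU.exists_gramSeven {A : SU} {p : Fin 3 → ℂ} {c : ℂ} (hp : (herm p p).re < 0)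
    (h : mC A.m *ᵥ p = c • p) (ht : A.m.trace = ⟨0, -1⟩) (hc : 0 < c.re) :
    ∃ x, IsGramSeven (hO x x) (hO (A.m *ᵥ x) x) (hO (A.m *ᵥ (A.m *ᵥ x)) x) := by
  have hF := isPosForm_sumForm hp h ht hc
  obtain ⟨x, m, hm, hm12⟩ := hF.exists_le_two fun u w z hd => by
    rw [SU.det_gram_sumForm ht, ← O.mul_star, mul_comm, star_mul_self_of_isUnit hd]
  refine ⟨x, ?_⟩
  have hm0 : 0 < m := by omega
  obtain ⟨n, hn⟩ := exists_hO_self x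
  have hAx : A.sumForm (A.m *ᵥ x) (A.m *ᵥ x) = m := by rw [SU.sumForm_map, hm]
  have hAAx : A.sumForm (A.m *ᵥ (A.m *ᵥ x)) (A.m *ᵥ (A.m *ᵥ x)) = m := by rw [SU.sumForm_map, hAx]
  have hf1 := hF.norm_le hm0 hm hAx
  have hf2 := hF.norm_le hm0 hm hAAx
  have hFx := A.sumForm_eq x x
  have hF1 := A.sumForm_eq (A.m *ᵥ x) x
  have hF2 := A.sumForm_eq (A.m *ᵥ (A.m *ᵥ x)) x
  rw [hO_mulVec] at hF1 hF2
  have hCH : A.m *ᵥ (A.m *ᵥ (A.m *ᵥ x)) = A.m.trace • (A.m *ᵥ (A.m *ᵥ x)) -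
      star A.m.trace • (A.m *ᵥ x) + x := by
    have h1 := congrArg (· *ᵥ x) A.cayley_hamilton
    simp only [sub_mulVec, add_mulVec, smul_mulVec, one_mulVec, zero_mulVec, pow_succ, pow_zero,
      one_mul, ← mulVec_mulVec] at h1
    rw [← sub_eq_zero, ← h1]; abel
  rw [hCH, hO_add_left, hO_sub_left, hO_smul_left, hO_smul_left, ht] at hF2
  have hG := det_gram (cols x (A.m *ᵥ x) (A.m *ᵥ (A.m *ᵥ x)))
  rw [SU.gram_cols_seven, det_gramSeven] at hG
  have hGF := SU.det_gram_sumForm ht x (A.m *ᵥ x) (A.m *ᵥ (A.m *ᵥ x))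
  simp only [SU.sumForm_map] at hGF
  have hsymm := hF.symm
  rw [← hsymm (A.m *ᵥ x) x, ← hsymm (A.m *ᵥ (A.m *ᵥ x)) x] at hGF
  have hGF' := det_gramSeven (A.sumForm x x) (A.sumForm (A.m *ᵥ x) x)
    (A.sumForm (A.m *ᵥ (A.m *ᵥ x)) x)
  rw [gramSeven, hGF] at hGF'
  rw [hm] at hFx hGF'
  rw [← star_hO (A.m *ᵥ x) x] at hFx
  have hA7 : A ^ 7 = 1 := by
    have := SU.orderOf_trace_seven hp h (.inl ht)
    rw [← this, pow_orderOf_eq_one]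
  have hx0 : x ≠ 0 := by
    rintro rfl
    rw [SU.sumForm, mulVec_zero, hO_zero_left] at hm
    have : m = 0 := by exact_mod_cast hm.symm
    omega
  have hlast : m = 2 → A.sumForm (A.m *ᵥ (A.m *ᵥ x)) x ≠ ⟨2, -1⟩ := by
    rintro rfl hf
    have h1 := hF.eq_of_norm_eq hm hAAx (by rw [hf]; decide +kernel)
    rw [hf, mulVec_mulVec, ← pow_two, ← SU.m_pow] at h1
    have h2 := SU.pow_mulVec_eq h1 7
    rw [← pow_mul, mul_comm, pow_mul, hA7, one_pow, SU.m_one, one_mulVec, ← sub_eq_zero,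
      ← sub_smul] at h2
    have h3 := (smul_eq_zero.1 h2).resolve_right hx0
    revert h3; decide +kernel
  clear hF hsymm hAx hAAx hGF hCH hA7
  generalize A.sumForm (A.m *ᵥ x) x = f₁ at *
  generalize A.sumForm (A.m *ᵥ (A.m *ᵥ x)) x = f₂ at *
  generalize hO (A.m *ᵥ (A.m *ᵥ x)) x = b₂ at *
  generalize hO (A.m *ᵥ x) x = b₁ at *
  rw [hn] at hF1 hF2 hG ⊢
  have hm4 : m ^ 2 ≤ 4 := by rcases hm12 with rfl | rfl <;> norm_num
  obtain ⟨i1, i2⟩ := O.bounds_of_norm_le_four (hf1.trans hm4)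
  obtain ⟨i3, i4⟩ := O.bounds_of_norm_le_four (hf2.trans hm4)
  have hst : star (⟨0, -1⟩ : O) = ⟨-1, 1⟩ := by decide +kernel
  rw [hst] at hF2
  have hb2 : b₂ = -f₁ - n := by linear_combination hF1
  have htr : 2 * b₁.re + b₁.im = -m := by
    have h1 := congrArg QuadraticAlgebra.re hFx
    simp at h1
    linarith
  have hY : 4 * b₁ = fourSeven n f₁ f₂ := by
    have e1 : (⟨0, -1⟩ : O) = -⟨0, 1⟩ := by decide +kernel
    have e2 : (⟨-1, 1⟩ : O) = -1 + ⟨0, 1⟩ := by decide +kernel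
    have e3 : (⟨-1, -1⟩ : O) = -1 - ⟨0, 1⟩ := by decide +kernel
    have e4 : (⟨1, 1⟩ : O) = 1 + ⟨0, 1⟩ := by decide +kernel
    have e5 : (⟨0, 1⟩ : O) ^ 2 - ⟨0, 1⟩ + 2 = 0 := by decide +kernel
    rw [fourSeven, hF2, e3, e4, hb2, e1, e2]
    linear_combination b₁ * e5
  have hN : n = normSeven m f₁ f₂ := by
    have h1 := congrArg QuadraticAlgebra.re hY
    have h2 := congrArg QuadraticAlgebra.im hY
    simp [fourSeven] at h1 h2
    simp [normSeven]
    linarith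
  have hq : b₁ = ⟨(fourSeven n f₁ f₂).re / 4, (fourSeven n f₁ f₂).im / 4⟩ := by
    rw [← hY]
    ext <;> simp
  have := gramSeven_search m (by simpa using hm12) f₁.re i1 f₁.im i2 f₂.re i3 f₂.im i4 hf1 hf2 n
    (by simpa using hN) b₁ (by simpa using hq) hY
    (by rw [← hb2]; simp only [gramSevenDet]; rw [hG, hGF'])
    (by
      rw [← hb2]; simp only [gramSevenDet]; rw [hG]
      have := O.norm_nonneg (cols x (A.m *ᵥ x) (A.m *ᵥ (A.m *ᵥ x))).det
      simpa using this)
  rw [← hb2] at this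
  rcases this with h | h | h | h
  · exact .inl h
  · exact .inr (.inl h)
  · exact .inr (.inr h)
  · exact absurd (QuadraticAlgebra.ext h.2.1 h.2.2) (hlast h.1)

theorem exists_eigenvalue_re_pos {A : SU} {p : Fin 3 → ℂ} {c : ℂ} (hp : (herm p p).re < 0)
    (h : mC A.m *ᵥ p = c • p) (ht : A.m.trace = ⟨0, -1⟩) :
    ∃ k ∈ ({1, 2, 4} : Finset ℕ), 0 < (c ^ k).re := by
  set t := toC A.m.trace with htdef
  have htt : t ^ 2 + t + 2 = 0 := by rw [htdef, ht]; exact trace_seven_sq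
  have hst : (star (⟨0, -1⟩ : O)) = -1 - ⟨0, -1⟩ := by decide +kernel
  have hts : toC (star A.m.trace) = -1 - t := by
    rw [htdef, ht, hst, map_sub, map_neg, map_one]
  have hcd : c * star c = 1 := by
    rw [Complex.star_def, Complex.mul_conj, SU.normSq_eigenvalue hp.ne h]; simp
  have hchar := eigenvalue_eq (ne_zero_of_neg hp) h
  rw [hts, ← htdef] at hchar
  have hc2 := sq_eigenvalue hcd hchar
  have hts' : star t = -1 - t := by rw [htdef, ← toC_star]; exact hts
  have hd2 : (star c) ^ 2 = (-1 - t) * star c - t + c := by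
    have := congrArg star hc2
    simp only [star_pow, star_add, star_mul', star_one, star_star, hts'] at this
    rw [this]; ring
  exact exists_pow_re_pos rfl hcd (cubic_of_eigenvalue htt hcd hc2 hd2)

theorem cols_mul_companion (u w z : V3) (s t : O) : cols u w z * !![0, 0, 1; 1, 0, s; 0, 1, t] =
    cols w z (u + s • w + t • z) := by
  refine Matrix.ext fun i j => ?_
  fin_cases j <;> fin_cases i <;>
    simp [cols, Matrix.mul_apply, Fin.sum_univ_three, mul_comm]

/-- The element of `SU` with trace `-τ` and eigenvalue of positive real part at a negative vector is
determined up to conjugacy by the Gram matrix of a short vector. -/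
theorem SU.isConj_of_gramSeven {A A' : SU} {x x' : V3} {n b₁ b₂ : O}
    (hG : IsGramSeven n b₁ b₂) (ht : A.m.trace = ⟨0, -1⟩) (ht' : A'.m.trace = ⟨0, -1⟩)
    (h1 : hO x x = n) (h2 : hO (A.m *ᵥ x) x = b₁) (h3 : hO (A.m *ᵥ (A.m *ᵥ x)) x = b₂)
    (h1' : hO x' x' = n) (h2' : hO (A'.m *ᵥ x') x' = b₁)
    (h3' : hO (A'.m *ᵥ (A'.m *ᵥ x')) x' = b₂) : IsConj A A' := by
  have hunit : ∀ (B : SU) (y : V3), hO y y = n → hO (B.m *ᵥ y) y = b₁ →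
      hO (B.m *ᵥ (B.m *ᵥ y)) y = b₂ → IsUnit (cols y (B.m *ᵥ y) (B.m *ᵥ (B.m *ᵥ y))).det := by
    intro B y e1 e2 e3
    have hd := det_gram (cols y (B.m *ᵥ y) (B.m *ᵥ (B.m *ᵥ y)))
    rw [SU.gram_cols_seven, e1, e2, e3] at hd
    have : (gramSeven n b₁ b₂).det = -1 := by
      rw [det_gramSeven]
      rcases hG with ⟨rfl, rfl, rfl⟩ | ⟨rfl, rfl, rfl⟩ | ⟨rfl, rfl, rfl⟩ <;> decide +kernel
    rw [this, neg_inj] at hd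
    rw [QuadraticAlgebra.isUnit_iff_norm_isUnit, show QuadraticAlgebra.norm _ = (1 : ℤ) by
      exact_mod_cast hd.symm]
    exact isUnit_one
  have hact : ∀ (B : SU) (y : V3), B.m.trace = ⟨0, -1⟩ →
      B.m * (cols y (B.m *ᵥ y) (B.m *ᵥ (B.m *ᵥ y)) * 1) =
        cols y (B.m *ᵥ y) (B.m *ᵥ (B.m *ᵥ y)) *
          !![0, 0, 1; 1, 0, ⟨1, -1⟩; 0, 1, ⟨0, -1⟩] := by
    intro B y e
    have hCH := congrArg (· *ᵥ y) B.cayley_hamilton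
    simp only [sub_mulVec, add_mulVec, smul_mulVec, one_mulVec, zero_mulVec, pow_succ, pow_zero,
      one_mul, ← mulVec_mulVec, e] at hCH
    have hst : star (⟨0, -1⟩ : O) = -⟨1, -1⟩ := by decide +kernel
    rw [hst] at hCH
    rw [mul_one, mul_cols, cols_mul_companion]
    congr 1
    rw [← sub_eq_zero, ← hCH, neg_smul]
    abel
  exact isConj_of_gram (hunit A x h1 h2 h3) (hunit A' x' h1' h2' h3')
    (by rw [SU.gram_cols_seven, SU.gram_cols_seven, h1, h2, h3, h1', h2', h3'])
    (by simp) (hact A x ht) (hact A' x' ht')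

/-! ### The generators and the elements of the table in `SU` -/

/-- The lift of `R`. -/
def RS : SU := ⟨!![-1, 0, 0; 0, 1, 0; 0, 0, -1], by decide +kernel, by decide +kernel⟩

/-- The lift of `I`. -/
def IS : SU := ⟨!![0, 0, 1; 0, -1, 0; 1, 0, 0], by decide +kernel, by decide +kernel⟩

/-- The lift of `T₁`. -/
def TS : SU := ⟨!![1, -1, ⟨-1, 1⟩; 0, 1, 1; 0, 0, 1], by decide +kernel, by decide +kernel⟩

/-- The elements of the table. -/
def elt : Fin 10 → SU := ![
  (RS * TS * IS * TS⁻¹) ^ 2,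
  IS * RS,
  TS ^ 2 * IS * (TS⁻¹ * IS) ^ 2 * TS ^ 2 * IS,
  TS * (IS * TS⁻¹) ^ 2 * (IS * TS) ^ 2,
  TS ^ 2 * (IS * TS⁻¹) ^ 2 * (IS * TS) ^ 2,
  (RS * TS) ^ 2 * IS * TS * IS * TS⁻¹ * RS * TS * IS * TS⁻¹,
  IS * TS⁻¹ * RS * TS,
  (TS⁻¹ * IS) ^ 2 * (TS * IS) ^ 2,
  TS * RS * (TS * IS) ^ 2 * TS⁻¹ * RS * TS * IS * TS⁻¹,
  IS * RS * TS]

/-- The matrices of the elements of the table. -/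
def eltM : Fin 10 → M3 := ![
  !![⟨1, -2⟩, 0, -4; 0, -1, 0; -2, 0, ⟨-1, 2⟩],
  !![0, 0, -1; 0, -1, 0; -1, 0, 0],
  !![⟨1, -1⟩, ⟨0, -1⟩, -2; ⟨0, -1⟩, -2, ⟨-1, 1⟩; -2, ⟨-1, 1⟩, ⟨0, 1⟩],
  !![1, ⟨0, -1⟩, -1; ⟨1, -1⟩, -1, 0; -1, 0, 0],
  !![1, ⟨1, -1⟩, -1; ⟨0, -1⟩, -1, 0; -1, 0, 0],
  !![-5, 0, ⟨-3, 6⟩; 0, 1, 0; ⟨-1, 2⟩, 0, 4],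
  !![0, 0, -1; 0, -1, -2; -1, 2, 2],
  !![0, 0, -1; 0, -1, ⟨-2, 1⟩; -1, ⟨1, 1⟩, 2],
  !![5, 0, ⟨3, -6⟩; 0, 1, 0; ⟨1, -2⟩, 0, -4],
  !![0, 0, -1; 0, -1, -1; -1, 1, ⟨1, -1⟩]]

theorem elt_m (i : Fin 10) : (elt i).m = eltM i := by
  revert i; decide +kernel

theorem RepresentedBy.unique {γ γ' : PicardGroup} {M : Matrix (Fin 3) (Fin 3) ℂ}
    (h : RepresentedBy γ M) (h' : RepresentedBy γ' M) : γ = γ' := by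
  obtain ⟨A, hA, h1⟩ := h
  obtain ⟨B, hB, h2⟩ := h'
  have : A = B := Units.ext (hA.trans hB.symm)
  exact Subtype.ext (by rw [← h1, ← h2, this])

theorem representedBy_ofMatrix {M N : Matrix (Fin 3) (Fin 3) O7} {h h' hM}
    {M' : Matrix (Fin 3) (Fin 3) ℂ} (h1 : M.map O7.subtype = M') :
    RepresentedBy (ofMatrix M N h h' hM) M' := ⟨_, h1, rfl⟩

theorem phi_RS : phi RS = R := by
  refine RepresentedBy.unique (M := !![1, 0, 0; 0, -1, 0; 0, 0, 1]) (representedBy_phi_neg ?_)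
    (representedBy_ofMatrix ?_)
  · ext i j; fin_cases i <;> fin_cases j <;> simp [RS, mC_apply]
  · ext i j; fin_cases i <;> fin_cases j <;> simp

theorem phi_IS : phi IS = I := by
  refine RepresentedBy.unique (M := !![0, 0, 1; 0, -1, 0; 1, 0, 0]) (representedBy_phi ?_)
    (representedBy_ofMatrix ?_)
  · ext i j; fin_cases i <;> fin_cases j <;> simp [IS, mC_apply]
  · ext i j; fin_cases i <;> fin_cases j <;> simp

theorem phi_TS : phi TS = T₁ := by
  refine RepresentedBy.unique (M := !![1, -1, tau - 1; 0, 1, 1; 0, 0, 1]) (representedBy_phi ?_)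
    (representedBy_ofMatrix ?_)
  · ext i j; fin_cases i <;> fin_cases j <;> simp [TS, mC_apply, toC_apply]; ring
  · ext i j; fin_cases i <;> fin_cases j <;> simp [tauO]

theorem table_elt (i : Fin 10) : (table i).elt = phi (elt i) := by
  fin_cases i <;> simp [table, elt, phi_RS, phi_IS, phi_TS]

@[simp] theorem O.re_five : (5 : O).re = 5 := rfl
@[simp] theorem O.im_five : (5 : O).im = 0 := rfl

theorem neg_table_mat (i : Fin 10) : mC (elt i).m = -(table i).mat := by
  rw [elt_m]
  ext j k
  fin_cases i <;> fin_cases j <;> fin_cases k <;>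
    simp [table, eltM, mC_apply, toC_apply, s7_eq, tauBar_eq] <;> ring

theorem representedBy_table (i : Fin 10) : RepresentedBy (table i).elt (table i).mat := by
  rw [table_elt]; exact representedBy_phi_neg (neg_table_mat i)

/-! ### Frames of the elements of the table -/

theorem HasFrame.intro {A : SU} {uu wu ww zu zw zz a b c d : O} (v u w z : V3)
    (h : A.m *ᵥ v = v ∧ hO u v = 0 ∧ hO w v = 0 ∧ hO z v = 1 ∧
      ((cols u w z).det = 1 ∨ (cols u w z).det = -1) ∧ hO u u = uu ∧ hO w u = wu ∧ hO w w = ww ∧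
      hO z u = zu ∧ hO z w = zw ∧ hO z z = zz ∧ A.m *ᵥ u = a • u + b • w ∧
      A.m *ᵥ w = c • u + d • w) : HasFrame A uu wu ww zu zw zz a b c d := by
  obtain ⟨h0, h1, h2, h3, h4, h5⟩ := h
  exact ⟨v, u, w, z, ⟨h0, h1, h2, h3, O.isUnit_iff.2 h4⟩, h5⟩

theorem hasFrame_RS : HasFrame RS 0 1 0 0 0 1 (-1) 0 0 (-1) :=
  .intro ![0, 1, 0] ![⟨-1, 2⟩, 0, -4] ![-2, 0, ⟨1, -2⟩] ![0, 1, 0] (by decide +kernel)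

theorem hasFrame_IS : HasFrame IS 0 ⟨0, 1⟩ 0 1 1 1 (-1) 0 0 (-1) :=
  .intro ![1, 0, 1] ![⟨2, -1⟩, ⟨-3, 1⟩, ⟨-2, 1⟩] ![⟨1, -1⟩, ⟨-2, 1⟩, ⟨-1, 1⟩] ![1, -1, 0]
    (by decide +kernel)

theorem hasFrame_elt_zero : HasFrame (elt 0) 1 0 1 0 0 (-1) (-1) 0 0 (-1) :=
  .intro ![⟨-1, 1⟩, 0, 1] ![0, -1, 0] ![⟨0, -1⟩, 0, -1] ![⟨1, -1⟩, 0, -1] (by decide +kernel)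

theorem hasFrame_elt_one : HasFrame (elt 1) 1 0 2 0 1 0 (-1) 0 0 (-1) :=
  .intro ![-1, 0, 1] ![0, -1, 0] ![-1, 0, -1] ![0, 0, -1] (by decide +kernel)

theorem hasFrame_elt_two : HasFrame (elt 2) 2 ⟨0, 1⟩ 2 1 1 1 (-1) 0 0 (-1) :=
  .intro ![⟨0, 1⟩, 1, ⟨1, -1⟩] ![-1, -1, ⟨-1, 1⟩] ![⟨0, -1⟩, -1, -1] ![⟨0, -1⟩, -2, ⟨-1, 1⟩]
    (by decide +kernel)

theorem hasFrame_elt_three (c : O) (hc : c = ⟨0, 1⟩ ∨ c = ⟨0, -1⟩) :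
    HasFrame (elt 3) 2 (-1) 2 0 c 1 0 1 (-1) (-1) := by
  rcases hc with rfl | rfl
  · exact .intro ![⟨0, 1⟩, 1, ⟨0, -1⟩] ![-1, ⟨-1, 1⟩, 0] ![1, 0, 1] ![0, -1, ⟨0, 1⟩]
      (by decide +kernel)
  · exact .intro ![⟨0, 1⟩, 1, ⟨0, -1⟩] ![0, ⟨-1, 1⟩, 1] ![1, ⟨1, -1⟩, 0] ![⟨0, -1⟩, -1, 0]
      (by decide +kernel)

theorem hasFrame_elt_four (c : O) (hc : c = ⟨1, -1⟩ ∨ c = ⟨-1, 1⟩) :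
    HasFrame (elt 4) 2 (-1) 2 0 c 1 0 1 (-1) (-1) := by
  rcases hc with rfl | rfl
  · exact .intro ![⟨-1, 1⟩, 1, ⟨1, -1⟩] ![1, ⟨0, -1⟩, 0] ![-1, 0, -1] ![0, -1, ⟨-1, 1⟩]
      (by decide +kernel)
  · exact .intro ![⟨-1, 1⟩, 1, ⟨1, -1⟩] ![0, ⟨0, -1⟩, -1] ![-1, ⟨0, 1⟩, 0] ![⟨1, -1⟩, -1, 0]
      (by decide +kernel)

theorem hasFrame_elt_five {n x y : ℤ} (hn : n = 1 ∨ n = -1) (hy : y = 1 ∨ y = -1)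
    (h : 2 * x + y = -1 * n) : HasFrame (elt 5) n ⟨x, y⟩ n 0 0 1 0 1 (-1) (-1) ∨
      HasFrame (elt 5)⁻¹ n ⟨x, y⟩ n 0 0 1 0 1 (-1) (-1) := by
  rcases hn with rfl | rfl <;> rcases hy with rfl | rfl
  · obtain rfl : x = -1 := by omega
    exact .inl <| .intro ![0, 1, 0] ![⟨3, -2⟩, 0, ⟨-1, -1⟩] ![⟨0, 1⟩, 0, 1] ![0, 1, 0]
      (by decide +kernel)
  · obtain rfl : x = 0 := by omega
    exact .inr <| .intro ![0, 1, 0] ![⟨3, -2⟩, 0, ⟨-1, -1⟩] ![⟨-3, 1⟩, 0, ⟨0, 1⟩] ![0, 1, 0]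
      (by decide +kernel)
  · obtain rfl : x = 0 := by omega
    exact .inl <| .intro ![0, 1, 0] ![⟨-1, -2⟩, 0, ⟨-2, 1⟩] ![⟨-1, 1⟩, 0, 1] ![0, 1, 0]
      (by decide +kernel)
  · obtain rfl : x = 1 := by omega
    exact .inr <| .intro ![0, 1, 0] ![⟨-1, -2⟩, 0, ⟨-2, 1⟩] ![⟨2, 1⟩, 0, ⟨1, -1⟩] ![0, 1, 0]
      (by decide +kernel)

theorem hasFrame_elt_eight {n x y : ℤ} (hn : n = 1 ∨ n = -1) (hy : y = 1 ∨ y = -1)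
    (h : 2 * x + y = 1 * n) : HasFrame (elt 8) n ⟨x, y⟩ n 0 0 1 0 1 (-1) 1 ∨
      HasFrame (elt 8)⁻¹ n ⟨x, y⟩ n 0 0 1 0 1 (-1) 1 := by
  rcases hn with rfl | rfl <;> rcases hy with rfl | rfl
  · obtain rfl : x = 0 := by omega
    exact .inr <| .intro ![0, 1, 0] ![⟨3, -2⟩, 0, ⟨-1, -1⟩] ![⟨3, -1⟩, 0, ⟨0, -1⟩] ![0, 1, 0]
      (by decide +kernel)
  · obtain rfl : x = 1 := by omega
    exact .inl <| .intro ![0, 1, 0] ![⟨3, -2⟩, 0, ⟨-1, -1⟩] ![⟨0, -1⟩, 0, -1] ![0, 1, 0]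
      (by decide +kernel)
  · obtain rfl : x = -1 := by omega
    exact .inr <| .intro ![0, 1, 0] ![⟨-1, -2⟩, 0, ⟨-2, 1⟩] ![⟨-2, -1⟩, 0, ⟨-1, 1⟩] ![0, 1, 0]
      (by decide +kernel)
  · obtain rfl : x = 0 := by omega
    exact .inl <| .intro ![0, 1, 0] ![⟨-1, -2⟩, 0, ⟨-2, 1⟩] ![⟨1, -1⟩, 0, -1] ![0, 1, 0]
      (by decide +kernel)

theorem hasFrame_elt_six : HasFrame (elt 6) 1 0 1 0 0 (-1) 0 1 (-1) 0 :=
  .intro ![-1, -1, 1] ![-1, -1, 0] ![0, 1, -1] ![1, 1, -1] (by decide +kernel)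

theorem hasFrame_elt_seven : HasFrame (elt 7) 2 ⟨1, -1⟩ 2 1 1 1 1 ⟨0, -1⟩ ⟨1, -1⟩ (-1) ∧
    HasFrame (elt 7) 2 ⟨0, 1⟩ 2 1 1 1 1 ⟨-1, 1⟩ ⟨0, 1⟩ (-1) :=
  ⟨.intro ![⟨1, -1⟩, ⟨0, -1⟩, ⟨-1, 1⟩] ![-1, ⟨-2, 1⟩, 1] ![0, ⟨0, 1⟩, ⟨1, -1⟩]
      ![-1, ⟨-1, 1⟩, ⟨1, -1⟩] (by decide +kernel),
    .intro ![⟨1, -1⟩, ⟨0, -1⟩, ⟨-1, 1⟩] ![0, ⟨0, -1⟩, ⟨-1, 1⟩] ![-1, 0, -1] ![-1, -1, 0]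
      (by decide +kernel)⟩

theorem exists_gramSeven_elt {n b₁ b₂ : O} (h : IsGramSeven n b₁ b₂) : ∃ x, hO x x = n ∧
    hO ((elt 9).m *ᵥ x) x = b₁ ∧ hO ((elt 9).m *ᵥ ((elt 9).m *ᵥ x)) x = b₂ := by
  rcases h with ⟨rfl, rfl, rfl⟩ | ⟨rfl, rfl, rfl⟩ | ⟨rfl, rfl, rfl⟩
  · exact ⟨![-1, -1, 0], by decide +kernel⟩
  · exact ⟨![⟨-2, 1⟩, ⟨-1, 1⟩, ⟨-1, -1⟩], by decide +kernel⟩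
  · exact ⟨![⟨-2, 1⟩, ⟨-1, 1⟩, ⟨0, -1⟩], by decide +kernel⟩

theorem trace_elt : ∀ i, (elt i).m.trace = (![-1, -1, -1, 0, 0, 0, 1, 1, 2, ⟨0, -1⟩] : _ → O) i := by
  decide +kernel

/-! ### The classification of elements with a fixed point -/

theorem isConj_inv_of_isConj {G : Type*} [Group G] {a b : G} (h : IsConj a b⁻¹) : IsConj a⁻¹ b := by
  obtain ⟨c, hc⟩ := isConj_iff.1 h
  refine isConj_iff.2 ⟨c, ?_⟩
  rw [← inv_inv b, ← hc]
  simp [mul_assoc]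

theorem IsGramSeven.isConj {A : SU} (ht : A.m.trace = ⟨0, -1⟩) {x : V3}
    (hx : IsGramSeven (hO x x) (hO (A.m *ᵥ x) x) (hO (A.m *ᵥ (A.m *ᵥ x)) x)) : IsConj A (elt 9) := by
  obtain ⟨y, h1, h2, h3⟩ := exists_gramSeven_elt hx
  exact SU.isConj_of_gramSeven hx ht (trace_elt 9) rfl rfl rfl h1 h2 h3

theorem zpowers_pow_eq {G : Type*} [Group G] {a : G} {n : ℕ} (h : (orderOf a).Coprime n) :
    Subgroup.zpowers (a ^ n) = Subgroup.zpowers a := by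
  refine le_antisymm ?_ ?_
  · rw [Subgroup.zpowers_le]
    exact Subgroup.pow_mem _ (Subgroup.mem_zpowers a) n
  · rw [Subgroup.zpowers_le]
    obtain ⟨m, hm⟩ := exists_pow_eq_self_of_coprime h.symm
    exact Subgroup.mem_zpowers_iff.2 ⟨m, by rw [zpow_natCast, hm]⟩

theorem exists_isConj_of_trace_seven {A : SU} {p : Fin 3 → ℂ} {c : ℂ} (hp : (herm p p).re < 0)
    (h : mC A.m *ᵥ p = c • p) (ht : A.m.trace = ⟨0, -1⟩) :
    ∃ B, Subgroup.zpowers B = Subgroup.zpowers A ∧ IsConj B (elt 9) := by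
  have ho := SU.orderOf_trace_seven hp h (.inl ht)
  obtain ⟨k, hk, hpos⟩ := exists_eigenvalue_re_pos hp h ht
  have h2 : (A ^ 2).m.trace = ⟨0, -1⟩ := by rw [SU.trace_sq, ht]; decide +kernel
  have h4 : (A ^ 4).m.trace = ⟨0, -1⟩ := by
    rw [show A ^ 4 = (A ^ 2) ^ 2 by rw [← pow_mul], SU.trace_sq, h2]; decide +kernel
  have hkt : (A ^ k).m.trace = ⟨0, -1⟩ := by
    simp only [Finset.mem_insert, Finset.mem_singleton] at hk
    rcases hk with rfl | rfl | rfl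
    · rwa [pow_one]
    · exact h2
    · exact h4
  refine ⟨A ^ k, zpowers_pow_eq ?_, ?_⟩
  · rw [ho]
    simp only [Finset.mem_insert, Finset.mem_singleton] at hk
    rcases hk with rfl | rfl | rfl <;> norm_num
  · obtain ⟨x, hx⟩ := SU.exists_gramSeven hp (SU.mulVec_pow_eigen h k) hkt hpos
    exact hx.isConj hkt

theorem sq_eq_one_of_trace {A : SU} {p : Fin 3 → ℂ} {c : ℂ} (hp : (herm p p).re < 0)
    (h : mC A.m *ᵥ p = c • p) (ht : A.m.trace = -1) : A ^ 2 = 1 := by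
  rw [← SU.orderOf_trace_neg_one hp h ht, pow_orderOf_eq_one]

theorem not_orthogonal_of_fixed {A : SU} {p : Fin 3 → ℂ} {v : V3} (hp : (herm p p).re < 0)
    (h : mC A.m *ᵥ p = (1 : ℂ) • p) (hA : A ≠ 1) (hv : A.m *ᵥ v = v) (hv0 : v ≠ 0)
    (hpv : herm p (vC v) = 0) : False := by
  have h1 := SU.trace_of_double (q := vC v) hp h (by rw [mC_mulVec, hv, one_smul]) (by
    intro a ha
    rw [ha, herm_smul_right] at hpv
    rcases mul_eq_zero.1 hpv with h0 | h0
    · rw [star_eq_zero] at h0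
      rw [h0, zero_smul] at ha
      exact vC_ne_zero hv0 ha
    · rw [h0] at hp; simp at hp) hA
  have := h1.2
  norm_num at this

theorem IsFrame.ne_zero {A : SU} {v u w z : V3} (h : IsFrame A v u w z) : v ≠ 0 := by
  rintro rfl
  have h1 := h.hz
  rw [← star_hO, hO_zero_left, star_zero] at h1
  exact zero_ne_one h1

theorem disc_ne_zero {n x y : ℤ} (hn : n = 1 ∨ n = -1) (hy : y = 1 ∨ y = -1)
    (h : 2 * x + y = n ∨ 2 * x + y = -n) : (n : O) * n - ⟨x, y⟩ * star ⟨x, y⟩ ≠ 0 := by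
  rw [O.mul_star, ← Int.cast_mul, ← Int.cast_sub, Int.cast_ne_zero, O.norm_eq]
  have hx : x = 0 ∨ x = 1 ∨ x = -1 := by omega
  rcases hx with rfl | rfl | rfl <;> rcases hn with rfl | rfl <;> rcases hy with rfl | rfl <;>
    first | omega | norm_num

/-- An element with an isolated fixed point generates a group conjugate to that of an element of the
table. -/
theorem exists_isConj_elt {A : SU} {p : Fin 3 → ℂ} {c : ℂ} (hp : (herm p p).re < 0)
    (h : mC A.m *ᵥ p = c • p) (hA : A ≠ 1) (hc : A.m.trace ≠ -1 ∨ c ≠ -1) :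
    ∃ i B, Subgroup.zpowers B = Subgroup.zpowers A ∧ IsConj B (elt i) := by
  have hmem := SU.trace_mem hp h
  simp only [ellipticTraces, Finset.mem_insert, Finset.mem_singleton] at hmem
  rcases hmem with ht | ht | ht | ht | ht | ht | ht
  · exact absurd (SU.eq_one_of_trace hp h ht) hA
  · obtain ⟨v, u, w, z, N, hf, hN, hcase⟩ := exists_isFrame hp h (by rw [ht]; decide +kernel) hA
    have h2 := sq_eq_one_of_trace hp h ht
    rcases hcase with ⟨hpos, hpv⟩ | ⟨hneg, -⟩
    · exfalso
      have hc2 := SU.mulVec_pow_eigen h 2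
      rw [h2, SU.m_one, map_one, one_mulVec] at hc2
      have hc3 : c ^ 2 = 1 := by
        have : (c ^ 2 - 1) • p = 0 := by rw [sub_smul, ← hc2, one_smul, sub_self]
        linear_combination (smul_eq_zero.1 this).resolve_right (ne_zero_of_neg hp)
      rcases sq_eq_one_iff.1 hc3 with rfl | rfl
      · exact not_orthogonal_of_fixed hp h hA hf.fix hf.ne_zero hpv
      · tauto
    · rcases hf.normalForm_two_neg hN hneg ht h2 with h | h | h
      · exact ⟨0, A, rfl, h.isConj hasFrame_elt_zero (by decide +kernel)⟩
      · exact ⟨1, A, rfl, h.isConj hasFrame_elt_one (by decide +kernel)⟩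
      · exact ⟨2, A, rfl, h.isConj hasFrame_elt_two (by decide +kernel)⟩
  · obtain ⟨v, u, w, z, N, hf, hN, hcase⟩ := exists_isFrame hp h (by rw [ht]; decide +kernel) hA
    have hd := hf.dvd_of_trace (T := 0) hN (by rw [ht]; simp) (by norm_num)
    have hNv : N = 1 ∨ N = -1 ∨ N = 3 ∨ N = -3 := by
      have h1 := Int.le_of_dvd (by norm_num) hd
      have h2 := Int.le_of_dvd (by norm_num) ((neg_dvd).2 hd)
      have h3 : -3 ≤ N := by omega
      interval_cases N <;> first | omega | norm_num at hd
    rcases hf.normalForm_three_six hN (ε := -1) (by rw [ht]; simp) (.inr rfl) hNv with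
      ⟨-, n, x, y, hn, hy, hxy, hfr⟩ | ⟨-, hfr⟩
    · have hD : (n : O) * n - ⟨x, y⟩ * star ⟨x, y⟩ ≠ 0 :=
        disc_ne_zero hn hy (by rcases hn with rfl | rfl <;> omega)
      push_cast at hfr
      rcases hasFrame_elt_five hn hy hxy with h | h
      · exact ⟨5, A, rfl, hfr.isConj h hD⟩
      · exact ⟨5, A⁻¹, Subgroup.zpowers_inv, isConj_inv_of_isConj (hfr.isConj h hD)⟩
    · obtain ⟨c, hc, hfr⟩ := hfr rfl
      push_cast at hfr
      simp only [Finset.mem_insert, Finset.mem_singleton] at hc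
      rcases hc with hc | hc | hc | hc
      · exact ⟨3, A, rfl, hfr.isConj (hasFrame_elt_three c (.inl hc)) (by decide +kernel)⟩
      · exact ⟨3, A, rfl, hfr.isConj (hasFrame_elt_three c (.inr hc)) (by decide +kernel)⟩
      · exact ⟨4, A, rfl, hfr.isConj (hasFrame_elt_four c (.inl hc)) (by decide +kernel)⟩
      · exact ⟨4, A, rfl, hfr.isConj (hasFrame_elt_four c (.inr hc)) (by decide +kernel)⟩
  · obtain ⟨v, u, w, z, N, hf, hN, hcase⟩ := exists_isFrame hp h (by rw [ht]; decide +kernel) hA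
    have hd := hf.dvd_of_trace (T := 1) hN (by rw [ht]; simp) (by norm_num)
    have hNv : N = 1 ∨ N = -1 ∨ N = 2 ∨ N = -2 := by
      have h1 := Int.le_of_dvd (by norm_num) hd
      have h2 := Int.le_of_dvd (by norm_num) ((neg_dvd).2 hd)
      omega
    rcases hf.normalForm_four hN ht hNv with ⟨-, h⟩ | ⟨-, h | h⟩
    · exact ⟨6, A, rfl, h.isConj hasFrame_elt_six (by decide +kernel)⟩
    · exact ⟨7, A, rfl, h.isConj hasFrame_elt_seven.1 (by decide +kernel)⟩
    · exact ⟨7, A, rfl, h.isConj hasFrame_elt_seven.2 (by decide +kernel)⟩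
  · obtain ⟨v, u, w, z, N, hf, hN, hcase⟩ := exists_isFrame hp h (by rw [ht]; decide +kernel) hA
    have hd := hf.dvd_of_trace (T := 2) hN (by rw [ht]; simp) (by norm_num)
    have hN1 : N = 1 ∨ N = -1 := Int.isUnit_iff.1 (isUnit_of_dvd_one hd)
    rcases hf.normalForm_three_six hN (ε := 1) (by rw [ht]; decide +kernel) (.inl rfl) (by omega) with
      ⟨-, n, x, y, hn, hy, hxy, hfr⟩ | ⟨h3, -⟩
    · have hD : (n : O) * n - ⟨x, y⟩ * star ⟨x, y⟩ ≠ 0 :=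
        disc_ne_zero hn hy (by rcases hn with rfl | rfl <;> omega)
      push_cast at hfr
      rcases hasFrame_elt_eight hn hy hxy with h | h
      · exact ⟨8, A, rfl, hfr.isConj h hD⟩
      · exact ⟨8, A⁻¹, Subgroup.zpowers_inv, isConj_inv_of_isConj (hfr.isConj h hD)⟩
    · omega
  · obtain ⟨B, h1, h2⟩ := exists_isConj_of_trace_seven hp h ht
    exact ⟨9, B, h1, h2⟩
  · have ht' : (A⁻¹).m.trace = ⟨0, -1⟩ := by rw [SU.trace_inv, ht]; decide +kernel
    have h' : mC (A⁻¹).m *ᵥ p = c⁻¹ • p := by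
      have hc0 : c ≠ 0 := by
        rintro rfl
        have := SU.normSq_eigenvalue hp.ne h
        simp at this
      have h1 : mC (A⁻¹).m *ᵥ (mC A.m *ᵥ p) = p := by
        rw [mulVec_mulVec, ← map_mul, SU.m_inv_mul, map_one, one_mulVec]
      rw [h, mulVec_smul] at h1
      rw [eq_inv_smul_iff₀ hc0, h1]
    obtain ⟨B, h1, h2⟩ := exists_isConj_of_trace_seven hp h' ht'
    exact ⟨9, B, h1.trans Subgroup.zpowers_inv, h2⟩

/-- A nontrivial element that acts by `-1` on a negative line is conjugate to `R` or `I`. -/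
theorem isConj_RS_or_IS {A : SU} {p : Fin 3 → ℂ} (hp : (herm p p).re < 0)
    (h : mC A.m *ᵥ p = (-1 : ℂ) • p) (ht : A.m.trace = -1) :
    IsConj A RS ∨ IsConj A IS := by
  have hA : A ≠ 1 := by
    rintro rfl
    rw [SU.m_one] at ht
    revert ht; decide +kernel
  obtain ⟨v, u, w, z, N, hf, hN, hcase⟩ := exists_isFrame hp h (by rw [ht]; decide +kernel) hA
  rcases hcase with ⟨hpos, hpv⟩ | ⟨-, h1, -⟩
  · rcases hf.normalForm_two_pos hN hpos ht (sq_eq_one_of_trace hp h ht) with ⟨-, h⟩ | ⟨-, h⟩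
    · exact .inl (h.isConj hasFrame_RS (by decide +kernel))
    · exact .inr (h.isConj hasFrame_IS (by decide +kernel))
  · norm_num at h1

/-! ### Short vectors orthogonal to a negative vector -/

/-- `v` is a primitive vector with `⟨v, v⟩ = -N`, and `u, w` is a basis of its orthogonal complement
of vectors of small norms `p` and `r`. -/
structure IsShortFrame (v u w z : V3) (N p r : ℤ) : Prop where
  frame : IsFrame 1 v u w z
  norm_v : hO v v = -N
  norm_u : hO u u = p
  norm_w : hO w w = r
  pos : 0 < N ∧ 0 < p ∧ 0 < r
  small : 2 * p < 3 * N ∧ 2 * r < 3 * N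

/-- The scalars of norm at most two. -/
def smallScalars : Finset O := {0, 1, -1, ⟨0, 1⟩, ⟨0, -1⟩, ⟨1, -1⟩, ⟨-1, 1⟩}

/-- A finite set that contains the vectors of norm at most two in the span of a short frame. -/
def shortVectors (u w : V3) : Finset V3 :=
  (smallScalars ×ˢ smallScalars).image fun ab => ab.1 • u + ab.2 • w

namespace IsShortFrame

variable {v u w z : V3} {N p r : ℤ}

theorem neg (h : IsShortFrame v u w z N p r) : (herm (vC v) (vC v)).re < 0 := by
  rw [herm_vC_self_re (n := -N) (by rw [h.norm_v]; simp)]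
  have := h.pos.1
  exact_mod_cast (by omega : -N < 0)

theorem disc (h : IsShortFrame v u w z N p r) : (p : O) * r - hO w u * hO u w = N := by
  rw [← h.norm_u, ← h.norm_w, h.frame.disc, h.norm_v, neg_neg]

theorem mem_shortVectors (h : IsShortFrame v u w z N p r) {x : V3} (hx : hO x v = 0) {k : ℤ}
    (hk : hO x x = k) (hk2 : k ≤ 2) : x ∈ shortVectors u w := by
  obtain ⟨a, b, rfl⟩ := h.frame.exists_coords_perp hx
  have hd := h.disc
  obtain ⟨hN0, hp0, hr0⟩ := h.pos
  obtain ⟨hs1, hs2⟩ := h.small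
  have hst := star_hO w u
  simp only [hO_add_left, hO_add_right, hO_smul_left, hO_smul_right, h.norm_u, h.norm_w] at hk
  have h1 : p * k = (p * a + b * hO w u).norm + N * b.norm := by
    have : (p : O) * k = ((p * a + b * hO w u).norm : ℤ) + N * (b.norm : ℤ) := by
      rw [← O.mul_star, ← O.mul_star, ← hk, ← hd]
      simp only [star_add, star_mul', star_intCast, hst]
      ring
    exact_mod_cast this
  have h2 : r * k = (r * b + a * hO u w).norm + N * a.norm := by
    have : (r : O) * k = ((r * b + a * hO u w).norm : ℤ) + N * (a.norm : ℤ) := by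
      rw [← O.mul_star, ← O.mul_star, ← hk, ← hd]
      simp only [star_add, star_mul', star_intCast, star_hO]
      ring
    exact_mod_cast this
  have h3 := O.norm_nonneg (p * a + b * hO w u)
  have h4 := O.norm_nonneg (r * b + a * hO u w)
  have ha : a.norm ≤ 2 := by
    by_contra hcon
    nlinarith
  have hb : b.norm ≤ 2 := by
    by_contra hcon
    nlinarith
  exact Finset.mem_image.2 ⟨(a, b), Finset.mem_product.2 ⟨O.norm_le_two ha, O.norm_le_two hb⟩, rfl⟩

end IsShortFrame

/-! ### Isometries that carry a rational point to another one -/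

/-- The adjugate of a matrix, written out. -/
def adj3 (B : M3) : M3 :=
  !![B 1 1 * B 2 2 - B 1 2 * B 2 1, -(B 0 1 * B 2 2) + B 0 2 * B 2 1,
      B 0 1 * B 1 2 - B 0 2 * B 1 1;
    -(B 1 0 * B 2 2) + B 1 2 * B 2 0, B 0 0 * B 2 2 - B 0 2 * B 2 0,
      -(B 0 0 * B 1 2) + B 0 2 * B 1 0;
    B 1 0 * B 2 1 - B 1 1 * B 2 0, -(B 0 0 * B 2 1) + B 0 1 * B 2 0,
      B 0 0 * B 1 1 - B 0 1 * B 1 0]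

/-- The determinant of a matrix, written out. -/
def det3 (B : M3) : O := B 0 0 * B 1 1 * B 2 2 - B 0 0 * B 1 2 * B 2 1 - B 0 1 * B 1 0 * B 2 2 +
  B 0 1 * B 1 2 * B 2 0 + B 0 2 * B 1 0 * B 2 1 - B 0 2 * B 1 1 * B 2 0

theorem adj3_eq (B : M3) : adj3 B = B.adjugate := by
  rw [adjugate_fin_three]; rfl

theorem det3_eq (B : M3) : det3 B = B.det := (det_fin_three B).symm

/-- The quotient `C * B⁻¹`, rounded to `ℤ[τ]`. -/
def divM (B C : M3) : M3 := fun i j =>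
  ⟨(star (det3 B) * (C * adj3 B) i j).re / (det3 B).norm,
    (star (det3 B) * (C * adj3 B) i j).im / (det3 B).norm⟩

theorem divM_eq {A B C : M3} (hB : B.det ≠ 0) (h : A * B = C) : divM B C = A := by
  have h1 : C * adj3 B = B.det • A := by
    rw [← h, adj3_eq, Matrix.mul_assoc, mul_adjugate, mul_smul_comm, mul_one]
  have hn : B.det.norm ≠ 0 := (O.norm_pos hB).ne'
  ext1 i j
  have h2 : star (det3 B) * (C * adj3 B) i j = (B.det.norm : ℤ) * A i j := by
    rw [h1, det3_eq, Matrix.smul_apply, smul_eq_mul, ← mul_assoc, mul_comm (star _), O.mul_star]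
  rw [divM, h2, det3_eq]
  ext <;> simp [Int.mul_ediv_cancel_left _ hn]

/-- The matrices of `SU` that carry the line of `v` to the line of `v'`. -/
def transporters (v u w v' u' w' : V3) : Finset M3 :=
  (((((shortVectors u' w').filter fun x => hO x x = hO u u) ×ˢ
    ((shortVectors u' w').filter fun x => hO x x = hO w w)).filter fun xy =>
      hO xy.2 xy.1 = hO w u) ×ˢ ({1, -1} : Finset O)).image
    (fun xy => divM (cols u w v) (cols xy.1.1 xy.1.2 (xy.2 • v'))) |>.filter
    fun M => Mᴴ * J0 * M = J0 ∧ det3 M = 1 ∧ (M *ᵥ v = v' ∨ M *ᵥ v = -v')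

theorem mem_transporters_def {v u w v' u' w' : V3} {M : M3} : M ∈ transporters v u w v' u' w' ↔
    (∃ (x y : V3) (e : O), (x ∈ shortVectors u' w' ∧ hO x x = hO u u) ∧ (y ∈ shortVectors u' w' ∧
      hO y y = hO w w) ∧ hO y x = hO w u ∧ (e = 1 ∨ e = -1) ∧ divM (cols u w v) (cols x y (e • v')) = M) ∧
    Mᴴ * J0 * M = J0 ∧ det3 M = 1 ∧ (M *ᵥ v = v' ∨ M *ᵥ v = -v') := by
  simp only [transporters, Finset.mem_filter, Finset.mem_image, Finset.mem_product,
    Finset.mem_insert, Finset.mem_singleton, Prod.exists, and_assoc]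

attribute [irreducible] transporters shortVectors divM

theorem IsShortFrame.mem_transporters {v u w z v' u' w' z' : V3} {N p r N' p' r' : ℤ}
    (h : IsShortFrame v u w z N p r) (h' : IsShortFrame v' u' w' z' N' p' r')
    (hp : p ≤ 2) (hr : r ≤ 2) (M : M3) : M ∈ transporters v u w v' u' w' ↔
      ∃ A : SU, A.m = M ∧ (A.m *ᵥ v = v' ∨ A.m *ᵥ v = -v') := by
  rw [mem_transporters_def]
  constructor
  · rintro ⟨-, h1, h2, h3⟩
    exact ⟨⟨M, by rw [← det3_eq, h2], h1⟩, rfl, h3⟩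
  · rintro ⟨A, rfl, hA⟩
    refine ⟨?_, A.unitary, by rw [det3_eq, A.det_m], hA⟩
    have hperp : ∀ x, hO x v = 0 → hO (A.m *ᵥ x) v' = 0 := by
      intro x hx
      rcases hA with hA | hA
      · rw [← hA, hO_mulVec, hx]
      · rw [← neg_eq_zero, ← hO_neg_right, ← hA, hO_mulVec, hx]
    have hmem : ∀ x, hO x v = 0 → ∀ k : ℤ, hO x x = k → k ≤ 2 →
        A.m *ᵥ x ∈ shortVectors u' w' := by
      intro x hx k hk hk2
      exact h'.mem_shortVectors (hperp x hx) (by rw [hO_mulVec, hk]) hk2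
    have hdet : (cols u w v).det ≠ 0 := by
      intro h0
      have h1 := det_gram (cols u w v)
      rw [h0, gram_cols] at h1
      have h2 : hO v u = 0 := by rw [← star_hO, h.frame.hu, star_zero]
      have h3 : hO v w = 0 := by rw [← star_hO, h.frame.hw, star_zero]
      rw [h.frame.hu, h.frame.hw, h2, h3, det_fin_three] at h1
      have h4 := h.frame.disc
      simp [h.norm_v] at h1 h4
      have h5 := h.pos.1
      have h6 : (N : O) * N = 0 := by linear_combination -h1 - N * h4
      have h7 : N * N = 0 := by exact_mod_cast h6
      nlinarith
    obtain ⟨e, he, hAv⟩ : ∃ e : O, (e = 1 ∨ e = -1) ∧ A.m *ᵥ v = e • v' := by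
      rcases hA with hA | hA
      · exact ⟨1, .inl rfl, by rw [hA, one_smul]⟩
      · exact ⟨-1, .inr rfl, by rw [hA, neg_smul, one_smul]⟩
    have hdiv := divM_eq (A := A.m) hdet (mul_cols A.m u w v)
    rw [hAv] at hdiv
    exact ⟨A.m *ᵥ u, A.m *ᵥ w, e, ⟨hmem u h.frame.hu p h.norm_u hp, hO_mulVec _ _ _⟩,
      ⟨hmem w h.frame.hw r h.norm_w hr, hO_mulVec _ _ _⟩, hO_mulVec _ _ _, he, hdiv⟩

/-- An isometry that carries the line of a primitive vector to that of another one carries the vector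
to plus or minus the other one. -/
theorem mulVec_eq_or_eq_neg {A : SU} {v z v' z' : V3} (hz : hO z v = 1) (hz' : hO z' v' = 1) {c : ℂ}
    (h : mC A.m *ᵥ vC v = c • vC v') : A.m *ᵥ v = v' ∨ A.m *ᵥ v = -v' := by
  rw [mC_mulVec] at h
  have hvz' : hO v' z' = 1 := by rw [← star_hO, hz', star_one]
  have hc : c = toC (hO (A.m *ᵥ v) z') := by
    rw [← herm_vC, h, herm_smul_left, herm_vC, hvz', map_one, mul_one]
  set k := hO (A.m *ᵥ v) z'
  have hk : A.m *ᵥ v = k • v' := by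
    funext i
    apply toC_injective
    have := congrFun h i
    rw [hc] at this
    simpa [vC] using this
  have hvz : hO v z = 1 := by rw [← star_hO, hz, star_one]
  have hu : IsUnit k := by
    refine IsUnit.of_mul_eq_one (hO v' (A.m *ᵥ z)) ?_
    rw [← hO_smul_left, ← hk, hO_mulVec, hvz]
  rcases O.isUnit_iff.1 hu with h1 | h1
  · exact .inl (by rw [hk, h1, one_smul])
  · exact .inr (by rw [hk, h1, neg_smul, one_smul])

theorem vC_neg (x : V3) : vC (-x) = -vC x := by funext i; simp [vC]

theorem vC_smul (a : O) (x : V3) : vC (a • x) = toC a • vC x := by funext i; simp [vC]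

theorem phi_smul_pt_eq_pt_iff (A : SU) {p q : Fin 3 → ℂ} (hp : (herm p p).re < 0)
    (hq : (herm q q).re < 0) : phi A • pt p hp = pt q hq ↔ ∃ c : ℂ, mC A.m *ᵥ p = c • q := by
  rw [phi_smul_pt, pt_eq_pt]

theorem IsShortFrame.mem_transporters_iff {v u w z v' u' w' z' : V3} {N p r N' p' r' : ℤ}
    (h : IsShortFrame v u w z N p r) (h' : IsShortFrame v' u' w' z' N' p' r')
    (hp : p ≤ 2) (hr : r ≤ 2) (A : SU) : A.m ∈ transporters v u w v' u' w' ↔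
      phi A • pt (vC v) h.neg = pt (vC v') h'.neg := by
  rw [h.mem_transporters h' hp hr, phi_smul_pt_eq_pt_iff]
  constructor
  · rintro ⟨B, hB, h1⟩
    obtain rfl : B = A := SU.ext hB
    rcases h1 with h1 | h1
    · exact ⟨1, by rw [mC_mulVec, h1, one_smul]⟩
    · exact ⟨-1, by rw [mC_mulVec, h1, vC_neg, neg_smul, one_smul]⟩
  · rintro ⟨c, hc⟩
    exact ⟨A, rfl, mulVec_eq_or_eq_neg h.frame.hz h'.frame.hz hc⟩

theorem IsShortFrame.card_stabilizer {v u w z : V3} {N p r : ℤ}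
    (h : IsShortFrame v u w z N p r) (hp : p ≤ 2) (hr : r ≤ 2) :
    Nat.card (MulAction.stabilizer PicardGroup (pt (vC v) h.neg)) =
      (transporters v u w v u w).card := by
  rw [← Nat.card_eq_finsetCard]
  refine Nat.card_congr (Equiv.ofBijective (fun γ => ⟨(phi.symm γ.1).m, ?_⟩) ⟨?_, ?_⟩)
  · rw [h.mem_transporters_iff h hp hr, MulEquiv.apply_symm_apply]
    exact γ.2
  · intro a b hab
    exact Subtype.ext (phi.symm.injective (SU.ext (congrArg Subtype.val hab)))
  · rintro ⟨M, hM⟩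
    obtain ⟨A, rfl, -⟩ := (h.mem_transporters h hp hr M).1 hM
    exact ⟨⟨phi A, (h.mem_transporters_iff h hp hr A).1 hM⟩, Subtype.ext (by simp)⟩

/-! ### Lines through a rational point -/

theorem isPrimitive_vC {x : V3} :
    IsPrimitive (vC x) ↔ ∀ d : O, (∀ i, d ∣ x i) → IsUnit d := by
  constructor
  · rintro ⟨-, h⟩ d hd
    obtain ⟨e, he, hde⟩ := h (toC d) (toC_mem_O7 d) fun i => by
      obtain ⟨y, hy⟩ := hd i
      exact ⟨toC y, toC_mem_O7 y, by rw [vC, hy, map_mul]⟩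
    obtain ⟨e, rfl⟩ := mem_O7_iff.1 he
    rw [← map_mul, ← map_one toC, toC_inj] at hde
    exact IsUnit.of_mul_eq_one _ hde
  · refine fun h => ⟨fun i => toC_mem_O7 _, fun d hd hdv => ?_⟩
    obtain ⟨d, rfl⟩ := mem_O7_iff.1 hd
    have := h d fun i => by
      obtain ⟨y, hy, hxy⟩ := hdv i
      obtain ⟨y, rfl⟩ := mem_O7_iff.1 hy
      rw [vC, ← map_mul, toC_inj] at hxy
      exact ⟨y, hxy⟩
    obtain ⟨e, he⟩ := this.exists_right_inv
    exact ⟨toC e, toC_mem_O7 e, by rw [← map_mul, he, map_one]⟩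

theorem IsPrimitive.exists_eq_vC {v : Fin 3 → ℂ} (h : IsPrimitive v) : ∃ x, v = vC x := by
  choose x hx using fun i => mem_O7_iff.1 (h.1 i)
  exact ⟨x, funext fun i => (hx i).symm⟩

theorem isPrimitive_of_hO_eq_one {x z : V3} (h : hO z x = 1) : IsPrimitive (vC x) := by
  refine isPrimitive_vC.2 fun d hd => ?_
  choose y hy using hd
  have h1 : x = d • (y : V3) := funext hy
  have h2 : hO x z = 1 := by rw [← star_hO, h, star_one]
  rw [h1, hO_smul_left] at h2
  exact IsUnit.of_mul_eq_one _ h2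

/-- The vector is not divisible by `τ` and not divisible by its conjugate. -/
def IsOdd (x : V3) : Prop := (∃ i, (x i).re % 2 = 1) ∧ ∃ i, ((x i).re + (x i).im) % 2 = 1

instance : DecidablePred IsOdd := fun _ => inferInstanceAs (Decidable (_ ∧ _))

theorem O.tau_dvd_iff {x : O} : (⟨0, 1⟩ : O) ∣ x ↔ x.re % 2 = 0 := by
  constructor
  · rintro ⟨y, rfl⟩
    simp
  · intro h
    refine ⟨⟨x.im + x.re / 2, -(x.re / 2)⟩, ?_⟩
    ext <;> simp; omega

theorem O.tauBar_dvd_iff {x : O} : (⟨1, -1⟩ : O) ∣ x ↔ (x.re + x.im) % 2 = 0 := by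
  constructor
  · rintro ⟨y, rfl⟩
    simp
  · intro h
    refine ⟨⟨-x.im, (x.re + x.im) / 2⟩, ?_⟩
    ext <;> simp
    omega

theorem isPrimitive_vC_iff {x : V3} {j : ℤ} (hx : hO x x = j) (hj : j = 1 ∨ j = 2) :
    IsPrimitive (vC x) ↔ IsOdd x := by
  rw [isPrimitive_vC]
  constructor
  · intro h
    constructor
    · by_contra! hcon
      have := O.isUnit_iff.1 (h ⟨0, 1⟩ fun i => O.tau_dvd_iff.2 (by have := hcon i; omega))
      revert this; decide +kernel
    · by_contra! hcon
      have := O.isUnit_iff.1 (h ⟨1, -1⟩ fun i => O.tauBar_dvd_iff.2 (by have := hcon i; omega))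
      revert this; decide +kernel
  · rintro ⟨⟨i, hi⟩, k, hk⟩ d hd
    choose y hy using hd
    have h1 : x = d • (y : V3) := funext hy
    obtain ⟨n, hn⟩ := exists_hO_self y
    have h2 : d.norm * n = j := by
      have : ((d.norm : ℤ) : O) * n = j := by
        rw [← hx, h1, hO_smul_left, hO_smul_right, hn, ← O.mul_star]; ring
      exact_mod_cast this
    have h3 : d.norm ≤ 2 := (Int.le_of_dvd (by omega) ⟨n, h2.symm⟩).trans (by omega)
    have h4 := O.norm_le_two h3
    have hdx : ∀ i, d ∣ x i := fun i => ⟨y i, hy i⟩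
    have hneg : ∀ {a b : O}, -a ∣ b → a ∣ b := fun h => (neg_dvd).1 h
    have e1 : (⟨0, -1⟩ : O) = -⟨0, 1⟩ := by decide +kernel
    have e2 : (⟨-1, 1⟩ : O) = -⟨1, -1⟩ := by decide +kernel
    simp only [Finset.mem_insert, Finset.mem_singleton] at h4
    rcases h4 with rfl | rfl | rfl | rfl | rfl | rfl | rfl
    · have := zero_dvd_iff.1 (hdx i); rw [this] at hi; simp at hi
    · exact isUnit_one
    · exact isUnit_one.neg
    · have := O.tau_dvd_iff.1 (hdx i); omega
    · rw [e1] at hdx; have := O.tau_dvd_iff.1 (hneg (hdx i)); omega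
    · have := O.tauBar_dvd_iff.1 (hdx k); omega
    · rw [e2] at hdx; have := O.tauBar_dvd_iff.1 (hneg (hdx k)); omega

/-- The first nonzero coefficient of the vector is positive. -/
def IsLexPos (x : V3) : Prop := 0 < (x 0).re ∨ (x 0).re = 0 ∧ (0 < (x 0).im ∨ (x 0).im = 0 ∧
  (0 < (x 1).re ∨ (x 1).re = 0 ∧ (0 < (x 1).im ∨ (x 1).im = 0 ∧
  (0 < (x 2).re ∨ (x 2).re = 0 ∧ 0 < (x 2).im))))

instance : DecidablePred IsLexPos := fun _ => inferInstanceAs (Decidable (_ ∨ _))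

theorem isLexPos_or {x : V3} (hx : x ≠ 0) : IsLexPos x ∨ IsLexPos (-x) := by
  by_contra hcon
  apply hx
  simp only [IsLexPos, Pi.neg_apply, QuadraticAlgebra.re_neg, QuadraticAlgebra.im_neg] at hcon
  funext i
  ext <;> fin_cases i <;> simp <;> omega

theorem not_isLexPos_neg {x : V3} (hx : IsLexPos x) : ¬ IsLexPos (-x) := by
  simp only [IsLexPos, Pi.neg_apply, QuadraticAlgebra.re_neg, QuadraticAlgebra.im_neg] at hx ⊢
  omega

/-- Representatives of the vectors polar to the `j`-lines through the point with short frame. -/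
def lineVectors (u w : V3) (j : ℤ) : Finset V3 :=
  (shortVectors u w).filter fun x => hO x x = j ∧ IsOdd x ∧ IsLexPos x

theorem IsOdd.neg {x : V3} (h : IsOdd x) : IsOdd (-x) := by
  obtain ⟨⟨i, hi⟩, k, hk⟩ := h
  refine ⟨⟨i, ?_⟩, k, ?_⟩ <;> simp <;> omega

theorem IsOdd.ne_zero {x : V3} (h : IsOdd x) : x ≠ 0 := by
  rintro rfl
  obtain ⟨⟨i, hi⟩, -⟩ := h
  simp at hi

theorem isOdd_of_mul {x y : V3} {m : O} (hm : m.norm = 4) (hxy : ∀ i, 2 * y i = m * x i)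
    (h : IsOdd x) : y = x ∨ y = -x := by
  obtain ⟨h1, h2⟩ := O.bounds_of_norm_le_four hm.le
  have key : ∀ a ∈ Finset.Icc (-2 : ℤ) 2, ∀ b ∈ Finset.Icc (-1 : ℤ) 1,
      (⟨a, b⟩ : O).norm = 4 → (⟨a, b⟩ : O) = 2 ∨ (⟨a, b⟩ : O) = -2 ∨ (b = 1 ∧ a = 1) ∨
        (b = -1 ∧ a = -1) ∨ (b = 1 ∧ a = -2) ∨ (b = -1 ∧ a = 2) := by decide +kernel
  have hre : ∀ i, 2 * (y i).re = m.re * (x i).re - 2 * (m.im * (x i).im) := fun i => by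
    have := congrArg QuadraticAlgebra.re (hxy i); simp at this; linarith
  have him : ∀ i, 2 * (y i).im = m.re * (x i).im + m.im * (x i).re + m.im * (x i).im := fun i => by
    have := congrArg QuadraticAlgebra.im (hxy i); simp at this; linarith
  obtain ⟨⟨i, hi⟩, k, hk⟩ := h
  have h3 := hre i
  have h4 := him k
  rcases key _ h1 _ h2 hm with h | h | ⟨hb, ha⟩ | ⟨hb, ha⟩ | ⟨hb, ha⟩ | ⟨hb, ha⟩
  · left
    have hm2 : m = 2 := h
    funext i
    have := hxy i
    rw [hm2] at this
    exact mul_left_cancel₀ (by decide +kernel) this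
  · right
    have hm2 : m = -2 := h
    funext i
    have := hxy i
    rw [hm2, neg_mul, ← mul_neg] at this
    exact mul_left_cancel₀ (by decide +kernel) this
  all_goals
    rw [ha, hb] at h3 h4
    omega

theorem eq_or_eq_neg_of_smul {x y : V3} {j : ℤ} (hj : j = 1 ∨ j = 2) (hx : hO x x = j)
    (hy : hO y y = j) (hxo : IsOdd x) {c : ℂ} (h : vC y = c • vC x) : y = x ∨ y = -x := by
  have h1 : toC (hO y x) = c * j := by
    rw [← herm_vC, h, herm_smul_left, herm_vC, hx, map_intCast]
  have h2 : ∀ i, (j : O) * y i = hO y x * x i := fun i => by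
    apply toC_injective
    have := congrFun h i
    simp only [vC, Pi.smul_apply, smul_eq_mul] at this
    rw [map_mul, map_mul, h1, this, map_intCast]; ring
  have h3 : hO y x * star (hO y x) = j * j := by
    have h4 : (j : O) • y = hO y x • x := funext h2
    have h5 : (j : O) * (j * hO y y) = hO y x * (star (hO y x) * hO x x) := by
      have := congrArg (fun z => hO z z) h4
      simp only [hO_smul_left, hO_smul_right, star_intCast] at this
      linear_combination this
    rw [hx, hy] at h5
    have hj0 : (j : O) ≠ 0 := by
      rw [Int.cast_ne_zero]; omega
    exact mul_right_cancel₀ hj0 (by linear_combination -h5)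
  have h4 : (hO y x).norm = j * j := by
    rw [O.mul_star] at h3; exact_mod_cast h3
  rcases hj with rfl | rfl
  · have h5 : IsUnit (hO y x) := QuadraticAlgebra.isUnit_iff_norm_isUnit.2 (by rw [h4]; simp)
    rcases O.isUnit_iff.1 h5 with h6 | h6
    · left; funext i; simpa [h6] using h2 i
    · right; funext i; simpa [h6] using h2 i
  · exact isOdd_of_mul (by rw [h4]; rfl) (fun i => by simpa using h2 i) hxo

section lines

variable {v u w z : V3} {N p r : ℤ}

theorem polarLine_vC_neg (x : V3) : polarLine (vC (-x)) = polarLine (vC x) := by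
  have : vC (-x) = (-1 : ℂ) • vC x := by rw [vC_neg, neg_smul, one_smul]
  rw [this, polarLine_smul (by norm_num)]

theorem mem_lineVectors {x : V3} {j : ℤ} : x ∈ lineVectors u w j ↔
    x ∈ shortVectors u w ∧ hO x x = j ∧ IsOdd x ∧ IsLexPos x := Finset.mem_filter

theorem hO_eq_zero_of_mem_shortVectors (h : IsFrame 1 v u w z) {x : V3}
    (hx : x ∈ shortVectors u w) : hO x v = 0 := by
  unfold shortVectors at hx
  obtain ⟨⟨a, b⟩, -, rfl⟩ := Finset.mem_image.1 hx
  rw [hO_add_left, hO_smul_left, hO_smul_left, h.hu, h.hw]; ring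

theorem IsShortFrame.injOn (h : IsShortFrame v u w z N p r) {j : ℤ} (hj : j = 1 ∨ j = 2) :
    Set.InjOn (fun x => polarLine (vC x)) (lineVectors u w j : Set V3) := by
  intro x hx y hy hxy
  obtain ⟨h1, h2, h3, h4⟩ := mem_lineVectors.1 hx
  obtain ⟨h1', h2', h3', h4'⟩ := mem_lineVectors.1 hy
  obtain ⟨c, hc⟩ := eq_smul_of_polarLine_subset h.neg (v := vC x) (w := vC y)
    (by rw [herm_vC, ← star_hO, hO_eq_zero_of_mem_shortVectors h.frame h1, star_zero, map_zero])
    (vC_ne_zero h3.ne_zero) hxy.le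
  rcases eq_or_eq_neg_of_smul hj h2 h2' h3 hc with h5 | h5
  · exact h5.symm
  · rw [h5] at h4'
    exact absurd h4' (not_isLexPos_neg h4)

theorem IsShortFrame.jLinesThrough_eq (h : IsShortFrame v u w z N p r) {j : ℕ}
    (hj : j = 1 ∨ j = 2) : jLinesThrough j (pt (vC v) h.neg) =
      (fun x => polarLine (vC x)) '' (lineVectors u w j : Set V3) := by
  have hj' : (j : ℤ) = 1 ∨ (j : ℤ) = 2 := by omega
  ext L
  constructor
  · rintro ⟨⟨y, hy, hyj, rfl⟩, hmem⟩
    obtain ⟨x, rfl⟩ := hy.exists_eq_vC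
    rw [pt_mem_polarLine, herm_vC, toC_eq_zero] at hmem
    have hxv : hO x v = 0 := by rw [← star_hO, hmem, star_zero]
    have hxj : hO x x = (j : ℤ) := toC_injective (by rw [← herm_vC, hyj]; simp)
    have hodd := (isPrimitive_vC_iff hxj hj').1 hy
    rcases isLexPos_or hodd.ne_zero with hp | hp
    · exact ⟨x, mem_lineVectors.2 ⟨h.mem_shortVectors hxv hxj (by omega), hxj, hodd, hp⟩, rfl⟩
    · refine ⟨-x, mem_lineVectors.2 ⟨h.mem_shortVectors (k := j) ?_ ?_ (by omega), ?_, hodd.neg, hp⟩,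
        polarLine_vC_neg x⟩
      · rw [hO_neg_left, hxv, neg_zero]
      · rw [hO_neg_left, hO_neg_right, hxj, neg_neg]
      · rw [hO_neg_left, hO_neg_right, hxj, neg_neg]
  · rintro ⟨x, hx, rfl⟩
    obtain ⟨h1, h2, h3, h4⟩ := mem_lineVectors.1 hx
    refine ⟨⟨vC x, (isPrimitive_vC_iff h2 hj').2 h3, by rw [herm_vC, h2]; simp, rfl⟩, ?_⟩
    rw [pt_mem_polarLine, herm_vC, ← star_hO, hO_eq_zero_of_mem_shortVectors h.frame h1, star_zero,
      map_zero]

theorem IsShortFrame.encard_jLinesThrough (h : IsShortFrame v u w z N p r) {j : ℕ}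
    (hj : j = 1 ∨ j = 2) : (jLinesThrough j (pt (vC v) h.neg)).encard =
      (lineVectors u w j).card := by
  rw [h.jLinesThrough_eq hj, (h.injOn (by omega)).encard_image, Set.encard_coe_eq_coe_finsetCard]

/-- The orbit of a line vector, up to sign. -/
def lineOrbit (v u w : V3) (x : V3) : Finset V3 :=
  (transporters v u w v u w).image fun M => if IsLexPos (M *ᵥ x) then M *ᵥ x else -(M *ᵥ x)

theorem IsShortFrame.stabOrbit_eq (h : IsShortFrame v u w z N p r) (hp : p ≤ 2) (hr : r ≤ 2)
    (x : V3) : stabOrbit (pt (vC v) h.neg) (polarLine (vC x)) =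
      (fun x => polarLine (vC x)) '' (lineOrbit v u w x : Set V3) := by
  have key : ∀ M : M3, polarLine (vC (if IsLexPos (M *ᵥ x) then M *ᵥ x else -(M *ᵥ x))) =
      polarLine (vC (M *ᵥ x)) := by
    intro M
    split_ifs
    · rfl
    · exact polarLine_vC_neg _
  ext L
  constructor
  · rintro ⟨γ, hγ, rfl⟩
    obtain ⟨A, rfl⟩ := phi.surjective γ
    refine ⟨_, Finset.mem_image_of_mem _ ((h.mem_transporters_iff h hp hr A).2 hγ), ?_⟩
    dsimp only
    rw [key, phi_image_polarLine, mC_mulVec]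
  · rintro ⟨y, hy, rfl⟩
    obtain ⟨M, hM, rfl⟩ := Finset.mem_image.1 hy
    obtain ⟨A, rfl, -⟩ := (h.mem_transporters h hp hr M).1 hM
    refine ⟨phi A, (h.mem_transporters_iff h hp hr A).1 hM, ?_⟩
    dsimp only
    rw [key, phi_image_polarLine, mC_mulVec]

end lines

/-! ### The rows with a rational fixed point -/

/-- The rows whose fixed point is rational. -/
def rationalRows : Finset (Fin 10) := {0, 1, 2, 3, 4, 6, 7}

/-- The fixed vectors of the rational rows. -/
def rowV : Fin 10 → V3 := ![![⟨-1, 1⟩, 0, 1], ![-1, 0, 1], ![⟨0, 1⟩, 1, ⟨1, -1⟩], ![⟨0, 1⟩, 1, ⟨0, -1⟩],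
  ![⟨-1, 1⟩, 1, ⟨1, -1⟩], 0, ![-1, -1, 1], ![⟨1, -1⟩, ⟨0, -1⟩, ⟨-1, 1⟩], 0, 0]

/-- The first vector of a short frame for a rational row. -/
def rowU : Fin 10 → V3 := ![![0, -1, 0], ![0, -1, 0], ![-1, -1, ⟨-1, 1⟩], ![-1, ⟨-1, 1⟩, 0],
  ![1, ⟨0, -1⟩, 0], 0, ![-1, -1, 0], ![-1, ⟨-2, 1⟩, 1], 0, 0]

/-- The second vector of a short frame for a rational row. -/
def rowW : Fin 10 → V3 := ![![⟨0, -1⟩, 0, -1], ![-1, 0, -1], ![⟨0, -1⟩, -1, -1], ![1, 0, 1],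
  ![-1, 0, -1], 0, ![0, 1, -1], ![0, ⟨0, 1⟩, ⟨1, -1⟩], 0, 0]

/-- A vector with product `1` with the fixed vector of a rational row. -/
def rowZ : Fin 10 → V3 := ![![⟨1, -1⟩, 0, -1], ![0, 0, -1], ![⟨0, -1⟩, -2, ⟨-1, 1⟩],
  ![0, -1, ⟨0, 1⟩], ![0, -1, ⟨-1, 1⟩], 0, ![1, 1, -1], ![-1, ⟨-1, 1⟩, ⟨1, -1⟩], 0, 0]

/-- Minus the norm of the fixed vector of a rational row. -/
def rowN : Fin 10 → ℤ := ![1, 2, 2, 3, 3, 0, 1, 2, 0, 0]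

/-- The norm of the first vector of the short frame. -/
def rowP : Fin 10 → ℤ := ![1, 1, 2, 2, 2, 0, 1, 2, 0, 0]

/-- The norm of the second vector of the short frame. -/
def rowQ : Fin 10 → ℤ := ![1, 2, 2, 2, 2, 0, 1, 2, 0, 0]

theorem isShortFrame_row : ∀ i ∈ rationalRows,
    IsShortFrame (rowV i) (rowU i) (rowW i) (rowZ i) (rowN i) (rowP i) (rowQ i) := by
  have key : ∀ i ∈ rationalRows, (hO (rowU i) (rowV i) = 0 ∧ hO (rowW i) (rowV i) = 0 ∧
      hO (rowZ i) (rowV i) = 1 ∧ ((cols (rowU i) (rowW i) (rowZ i)).det = 1 ∨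
        (cols (rowU i) (rowW i) (rowZ i)).det = -1)) ∧ hO (rowV i) (rowV i) = -rowN i ∧
      hO (rowU i) (rowU i) = rowP i ∧ hO (rowW i) (rowW i) = rowQ i ∧
      (0 < rowN i ∧ 0 < rowP i ∧ 0 < rowQ i) ∧
      (2 * rowP i < 3 * rowN i ∧ 2 * rowQ i < 3 * rowN i) := by decide +kernel
  intro i hi
  obtain ⟨⟨h1, h2, h3, h4⟩, h5, h6, h7, h8, h9⟩ := key i hi
  exact ⟨⟨by rw [SU.m_one, one_mulVec], h1, h2, h3, O.isUnit_iff.2 h4⟩, h5, h6, h7, h8, h9⟩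

theorem rowP_le : ∀ i, rowP i ≤ 2 := by decide +kernel

theorem rowQ_le : ∀ i, rowQ i ≤ 2 := by decide +kernel

theorem elt_mulVec_rowV : ∀ i ∈ rationalRows, (elt i).m *ᵥ rowV i = rowV i := by decide +kernel

/-- The matrices that carry the fixed point of one rational row to that of another one. -/
def rowTransporters (i j : Fin 10) : Finset M3 :=
  transporters (rowV i) (rowU i) (rowW i) (rowV j) (rowU j) (rowW j)

theorem card_rowTransporters : ∀ i ∈ rationalRows, (rowTransporters i i).card =
    (![8, 4, 8, 6, 6, 0, 8, 8, 0, 0] : Fin 10 → ℕ) i := by decide +kernel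

theorem rowTransporters_three_four : rowTransporters 3 4 = ∅ := by decide +kernel

theorem rowTransporters_zero_six : (rowTransporters 0 6).Nonempty := by
  rw [← Finset.card_pos]; decide +kernel

theorem rowTransporters_two_seven : (rowTransporters 2 7).Nonempty := by
  rw [← Finset.card_pos]; decide +kernel

theorem card_lineVectors : ∀ i ∈ rationalRows,
    (lineVectors (rowU i) (rowW i) 1).card = (![2, 1, 0, 0, 0, 0, 2, 0, 0, 0] : Fin 10 → ℕ) i ∧
    (lineVectors (rowU i) (rowW i) 2).card = (![2, 1, 4, 3, 3, 0, 2, 4, 0, 0] : Fin 10 → ℕ) i := by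
  decide +kernel

theorem lineOrbit_seven :
    lineOrbit (rowV 7) (rowU 7) (rowW 7) ![0, ⟨0, 1⟩, ⟨1, -1⟩] =
      {![0, ⟨0, 1⟩, ⟨1, -1⟩], ![⟨1, -1⟩, ⟨0, -1⟩, 0]} ∧
    lineOrbit (rowV 7) (rowU 7) (rowW 7) ![1, 0, 1] = {![1, 0, 1], ![1, ⟨2, -1⟩, -1]} ∧
    lineVectors (rowU 7) (rowW 7) 2 = {![0, ⟨0, 1⟩, ⟨1, -1⟩], ![⟨1, -1⟩, ⟨0, -1⟩, 0]} ∪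
      {![1, 0, 1], ![1, ⟨2, -1⟩, -1]} := by
  decide +kernel

/-! ### Points that are not rational -/

theorem isKRational_pt_of_smul {p : Fin 3 → ℂ} {hp : (herm p p).re < 0} {x : V3} {c : ℂ}
    (hc : c ≠ 0) (h : vC x = c • p) : IsKRational (pt p hp) :=
  ⟨vC x, fun i => toC_mem_K7 (x i), spans_pt.2 ⟨c, hc, h⟩⟩

theorem exists_primitive_of_isKRational {p : Fin 3 → ℂ} {hp : (herm p p).re < 0}
    (h : IsKRational (pt p hp)) : ∃ v y : V3, ∃ c : ℂ, c ≠ 0 ∧ hO y v = 1 ∧ vC v = c • p := by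
  obtain ⟨m, hm, hsp⟩ := h
  obtain ⟨c, hc, rfl⟩ := spans_pt.1 hsp
  choose x n hn hx using fun i => exists_toC_of_mem_K7 (hm i)
  set d : ℕ := n 0 * n 1 * n 2 with hd
  have hd0 : (d : ℂ) ≠ 0 := by
    have := Nat.mul_pos (Nat.mul_pos (hn 0) (hn 1)) (hn 2)
    exact_mod_cast this.ne'
  set X : V3 := ![(n 1 * n 2 : ℕ) * x 0, (n 0 * n 2 : ℕ) * x 1, (n 0 * n 1 : ℕ) * x 2] with hX
  have hXc : vC X = (d * c : ℂ) • p := by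
    have h0 := hx 0
    have h1 := hx 1
    have h2 := hx 2
    simp only [Pi.smul_apply, smul_eq_mul] at h0 h1 h2
    funext i
    fin_cases i <;> simp [vC, hX, hd, ← h0, ← h1, ← h2] <;> ring
  have hX0 : X ≠ 0 := by
    intro h0
    rw [h0] at hXc
    have h1 : vC (0 : V3) = 0 := by funext i; simp [vC]
    rw [h1] at hXc
    exact (smul_ne_zero (mul_ne_zero hd0 hc) (ne_zero_of_neg hp)) hXc.symm
  obtain ⟨g, v, y, hg, hXg, hy⟩ := exists_primitive hX0
  have hg0 : toC g ≠ 0 := fun h0 => hg (toC_eq_zero.1 h0)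
  refine ⟨v, y, (toC g)⁻¹ * (d * c), mul_ne_zero (inv_ne_zero hg0) (mul_ne_zero hd0 hc), hy, ?_⟩
  rw [mul_smul, ← hXc, hXg, vC_smul, smul_smul, inv_mul_cancel₀ hg0, one_smul]

/-- A line vector orthogonal to two independent integral vectors is rational. -/
theorem mul_eq_mul_of_orthogonal {p : Fin 3 → ℂ} {hp : (herm p p).re < 0}
    (hr : ¬ IsKRational (pt p hp)) {x y : V3} (hx : herm p (vC x) = 0) (hy : herm p (vC y) = 0)
    (i j : Fin 3) : x i * y j = x j * y i := by
  set n : V3 := ![star (x 1 * y 0 - x 0 * y 1), star (x 0 * y 2 - x 2 * y 0),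
    star (x 2 * y 1 - x 1 * y 2)] with hn
  rw [herm_eq] at hx hy
  by_cases h0 : n = 0
  · have e0 := star_eq_zero.1 (congrFun h0 0)
    have e1 := star_eq_zero.1 (congrFun h0 1)
    have e2 := star_eq_zero.1 (congrFun h0 2)
    fin_cases i <;> fin_cases j <;> simp only [Fin.zero_eta, Fin.mk_one, Fin.reduceFinMk]
    · linear_combination -e0
    · linear_combination e1
    · linear_combination e0
    · linear_combination -e2
    · linear_combination -e1
    · linear_combination e2
  · exfalso
    have hcross : ∀ i j, p i * vC n j = p j * vC n i := by
      simp only [vC] at hx hy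
      intro i j
      fin_cases i <;> fin_cases j <;> simp [vC, hn, toC_star] <;> simp only [Complex.star_def] at hx hy
      · linear_combination -((starRingEnd ℂ (toC (y 0))) * hx - (starRingEnd ℂ (toC (x 0))) * hy)
      · linear_combination (starRingEnd ℂ (toC (y 1))) * hx - (starRingEnd ℂ (toC (x 1))) * hy
      · linear_combination -(-(starRingEnd ℂ (toC (y 0))) * hx + (starRingEnd ℂ (toC (x 0))) * hy)
      · linear_combination -((starRingEnd ℂ (toC (y 2))) * hx - (starRingEnd ℂ (toC (x 2))) * hy)
      · linear_combination -(starRingEnd ℂ (toC (y 1))) * hx + (starRingEnd ℂ (toC (x 1))) * hy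
      · linear_combination -(-(starRingEnd ℂ (toC (y 2))) * hx + (starRingEnd ℂ (toC (x 2))) * hy)
    obtain ⟨k, hk⟩ := Function.ne_iff.1 (ne_zero_of_neg hp)
    rw [Pi.zero_apply] at hk
    have hnp : vC n = (vC n k / p k) • p := by
      funext i
      rw [Pi.smul_apply, smul_eq_mul, div_mul_eq_mul_div, eq_div_iff hk]
      linear_combination hcross k i
    refine hr (isKRational_pt_of_smul (c := vC n k / p k) ?_ hnp)
    intro hc
    rw [hc, zero_smul] at hnp
    exact vC_ne_zero h0 hnp

/-- An element that fixes a vector on a line that is not rational is trivial. -/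
theorem eq_one_of_not_isKRational {A : SU} {p : Fin 3 → ℂ} {hp : (herm p p).re < 0}
    (hr : ¬ IsKRational (pt p hp)) (h : mC A.m *ᵥ p = (1 : ℂ) • p) : A = 1 := by
  by_contra hA
  have ht : star A.m.trace = A.m.trace := by
    have := eigenvalue_eq (ne_zero_of_neg hp) h
    apply toC_injective
    linear_combination this
  obtain ⟨v, u, w, z, N, hf, hN, ⟨hpos, hpv⟩ | ⟨hneg, -, k, hk⟩⟩ := exists_isFrame hp h ht hA
  · exact not_orthogonal_of_fixed hp h hA hf.fix hf.ne_zero hpv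
  · refine hr (isKRational_pt_of_smul (c := k) ?_ hk)
    rintro rfl
    rw [zero_smul] at hk
    exact vC_ne_zero hf.ne_zero hk

/-- The eigenvalue of the elements of the stabilizer. -/
def eigenvalueHom (p : Fin 3 → ℂ) (hp : (herm p p).re < 0) :
    MulAction.stabilizer PicardGroup (pt p hp) →* ℂ where
  toFun γ := herm (mC (phi.symm γ.1).m *ᵥ p) p / herm p p
  map_one' := by
    rw [OneMemClass.coe_one, map_one, SU.m_one, map_one, one_mulVec, div_self]
    exact herm_ne_zero_of_neg hp hp
  map_mul' γ δ := by
    have hpp := herm_ne_zero_of_neg hp hp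
    have key : ∀ γ : MulAction.stabilizer PicardGroup (pt p hp),
        ∃ c : ℂ, mC (phi.symm γ.1).m *ᵥ p = c • p := fun γ => by
      rw [← phi_smul_pt_eq_iff _ hp, MulEquiv.apply_symm_apply]; exact γ.2
    obtain ⟨c, hc⟩ := key γ
    obtain ⟨d, hd⟩ := key δ
    rw [Subgroup.coe_mul, map_mul, SU.m_mul, map_mul, ← mulVec_mulVec, hd, mulVec_smul, hc]
    simp only [herm_smul_left]
    field_simp

theorem eigenvalueHom_spec {p : Fin 3 → ℂ} {hp : (herm p p).re < 0}
    (γ : MulAction.stabilizer PicardGroup (pt p hp)) :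
    mC (phi.symm γ.1).m *ᵥ p = eigenvalueHom p hp γ • p := by
  obtain ⟨c, hc⟩ := (phi_smul_pt_eq_iff (phi.symm γ.1) hp).1
    (by rw [MulEquiv.apply_symm_apply]; exact γ.2)
  have : eigenvalueHom p hp γ = c := by
    change herm (mC (phi.symm γ.1).m *ᵥ p) p / herm p p = c
    rw [hc, herm_smul_left, mul_div_cancel_right₀ _ (herm_ne_zero_of_neg hp hp)]
  rw [this, hc]

theorem eigenvalueHom_injective {p : Fin 3 → ℂ} {hp : (herm p p).re < 0}
    (hr : ¬ IsKRational (pt p hp)) : Function.Injective (eigenvalueHom p hp) := by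
  rw [injective_iff_map_eq_one]
  intro γ hγ
  have h1 := eigenvalueHom_spec γ
  rw [hγ] at h1
  have h2 := eq_one_of_not_isKRational hr h1
  exact Subtype.ext (by rw [← phi.apply_symm_apply γ.1, h2, map_one]; rfl)

theorem orderOf_mem_of_stabilizer {p : Fin 3 → ℂ} {hp : (herm p p).re < 0}
    (γ : MulAction.stabilizer PicardGroup (pt p hp)) :
    orderOf γ ∈ ({1, 2, 3, 4, 6, 7} : Finset ℕ) := by
  rw [← Subgroup.orderOf_coe, ← phi.symm.orderOf_eq]
  exact SU.orderOf_mem hp (eigenvalueHom_spec γ)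

theorem finite_stabilizer {p : Fin 3 → ℂ} {hp : (herm p p).re < 0}
    (hr : ¬ IsKRational (pt p hp)) : Finite (MulAction.stabilizer PicardGroup (pt p hp)) := by
  have h84 : ∀ γ : MulAction.stabilizer PicardGroup (pt p hp), γ ^ 84 = 1 := fun γ => by
    refine orderOf_dvd_iff_pow_eq_one.1 ?_
    have h1 := orderOf_mem_of_stabilizer γ
    revert h1
    generalize orderOf γ = k
    revert k
    decide
  refine Finite.of_injective (β := {c : ℂ // c ∈ Polynomial.nthRootsFinset 84 (1 : ℂ)})
    (fun γ => ⟨eigenvalueHom p hp γ, ?_⟩) fun γ δ h =>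
      eigenvalueHom_injective hr (congrArg Subtype.val h)
  rw [Polynomial.mem_nthRootsFinset (by norm_num), ← map_pow, h84, map_one]

/-- The order of the stabilizer of a point that is not rational. -/
theorem card_stabilizer_mem {p : Fin 3 → ℂ} {hp : (herm p p).re < 0}
    (hr : ¬ IsKRational (pt p hp)) :
    Nat.card (MulAction.stabilizer PicardGroup (pt p hp)) ∈ ({1, 2, 3, 4, 6, 7} : Finset ℕ) := by
  have := finite_stabilizer hr
  have := isCyclic_of_injective_ringHom _ (eigenvalueHom_injective hr)
  obtain ⟨γ, hγ⟩ := IsCyclic.exists_ofOrder_eq_natCard (α := MulAction.stabilizer PicardGroup (pt p hp))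
  rw [← hγ]
  exact orderOf_mem_of_stabilizer γ

theorem orderOf_dvd_card_stabilizer {A : SU} {p : Fin 3 → ℂ} {hp : (herm p p).re < 0} {c : ℂ}
    (h : mC A.m *ᵥ p = c • p) :
    orderOf A ∣ Nat.card (MulAction.stabilizer PicardGroup (pt p hp)) := by
  have := orderOf_dvd_natCard
    (⟨phi A, (phi_smul_pt_eq_iff A hp).2 ⟨c, h⟩⟩ : MulAction.stabilizer PicardGroup (pt p hp))
  rwa [← Subgroup.orderOf_coe, phi.orderOf_eq] at this

/-! ### The rows of the table -/

theorem table_ord (i : Fin 10) : (table i).ord = (![2, 2, 2, 3, 3, 3, 4, 4, 6, 7] : Fin 10 → ℕ) i := by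
  fin_cases i <;> rfl

theorem table_stabOrd (i : Fin 10) :
    (table i).stabOrd = (![8, 4, 8, 6, 6, 6, 8, 8, 6, 7] : Fin 10 → ℕ) i := by
  fin_cases i <;> rfl

theorem table_lines₁ (i : Fin 10) :
    (table i).lines₁ = (![2, 1, 0, 0, 0, 1, 2, 0, 1, 0] : Fin 10 → ℕ) i := by
  fin_cases i <;> rfl

theorem table_lines₂ (i : Fin 10) :
    (table i).lines₂ = (![2, 1, 4, 3, 3, 0, 2, 4, 0, 0] : Fin 10 → ℕ) i := by
  fin_cases i <;> rfl

theorem table_fixedVec_none {i : Fin 10} (hi : i ∉ rationalRows) : (table i).fixedVec = none := by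
  fin_cases i <;> first | rfl | exact absurd (by decide) hi

theorem table_fixedVec_some {i : Fin 10} (hi : i ∈ rationalRows) :
    (table i).fixedVec = some (vC (rowV i), -rowN i) := by
  have h : ∀ a b c : O, vC ![a, b, c] = ![toC a, toC b, toC c] := fun a b c => by
    funext i; fin_cases i <;> rfl
  fin_cases i <;> first
    | exact absurd hi (by decide)
    | simp [table, rowV, rowN, h, toC_apply, tauBar_eq]
  all_goals first | ring1 | (constructor <;> ring1)

theorem elt_ne_one (i : Fin 10) : elt i ≠ 1 := by
  intro h
  have h1 := congrArg SU.m h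
  rw [elt_m, SU.m_one] at h1
  revert h1
  clear h
  revert i
  decide +kernel

theorem orderOf_elt {i : Fin 10} {p : Fin 3 → ℂ} {c : ℂ} (hp : (herm p p).re < 0)
    (h : mC (elt i).m *ᵥ p = c • p) :
    orderOf (elt i) = (![2, 2, 2, 3, 3, 3, 4, 4, 6, 7] : Fin 10 → ℕ) i := by
  have ht := trace_elt i
  fin_cases i
  · exact SU.orderOf_trace_neg_one hp h ht
  · exact SU.orderOf_trace_neg_one hp h ht
  · exact SU.orderOf_trace_neg_one hp h ht
  · exact SU.orderOf_trace_zero hp h ht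
  · exact SU.orderOf_trace_zero hp h ht
  · exact SU.orderOf_trace_zero hp h ht
  · exact SU.orderOf_trace_one hp h ht
  · exact SU.orderOf_trace_one hp h ht
  · exact SU.orderOf_trace_two hp h ht
  · exact SU.orderOf_trace_seven hp h (.inl ht)

theorem isCorrect_of {i : Fin 10} {p : Fin 3 → ℂ} {c : ℂ} (hp : (herm p p).re < 0)
    (h : mC (elt i).m *ᵥ p = c • p) (hc : (elt i).m.trace ≠ -1 ∨ c ≠ -1)
    (hvec : FixedVecCorrect (pt p hp) (table i).fixedVec)
    (hstab : Nat.card (MulAction.stabilizer PicardGroup (pt p hp)) = (table i).stabOrd)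
    (h1 : (jLinesThrough 1 (pt p hp)).encard = (table i).lines₁)
    (h2 : (jLinesThrough 2 (pt p hp)).encard = (table i).lines₂) :
    (table i).IsCorrect (pt p hp) := by
  have hfix : fixedSet (table i).elt = {pt p hp} := by
    rw [table_elt]; exact SU.fixedSet_eq hp h (elt_ne_one i) hc
  refine ⟨representedBy_table i, ?_, hfix, isIsolatedFixedPoint_of_eq hfix, hvec, hstab, h1, h2⟩
  rw [table_elt, phi.orderOf_eq, orderOf_elt hp h, table_ord]

theorem isCorrect_rational {i : Fin 10} (hi : i ∈ rationalRows) :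
    (table i).IsCorrect (pt (vC (rowV i)) (isShortFrame_row i hi).neg) := by
  have hf := isShortFrame_row i hi
  refine isCorrect_of (c := 1) hf.neg ?_ (.inr (by norm_num)) ?_ ?_ ?_ ?_
  · rw [mC_mulVec, elt_mulVec_rowV i hi, one_smul]
  · rw [table_fixedVec_some hi]
    refine ⟨isPrimitive_of_hO_eq_one hf.frame.hz, spans_pt.2 ⟨1, one_ne_zero, (one_smul _ _).symm⟩, ?_⟩
    rw [herm_vC, hf.norm_v]; simp
  · rw [hf.card_stabilizer (rowP_le i) (rowQ_le i), table_stabOrd]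
    refine (card_rowTransporters i hi).trans ?_
    clear hf; revert i; decide
  · rw [hf.encard_jLinesThrough (.inl rfl), table_lines₁]
    refine congrArg Nat.cast ((card_lineVectors i hi).1.trans ?_)
    clear hf; revert i; decide
  · rw [hf.encard_jLinesThrough (.inr rfl), table_lines₂]
    refine congrArg Nat.cast ((card_lineVectors i hi).2.trans ?_)
    clear hf; revert i; decide

theorem exists_fixed_of_pow_eq_one {A : SU} {n : ℕ} (hn : 0 < n) (h : A ^ n = 1) :
    ∃ p, (herm p p).re < 0 ∧ ∃ c : ℂ, mC A.m *ᵥ p = c • p := by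
  have : Finite (Subgroup.zpowers A) :=
    (finite_zpowers.2 (isOfFinOrder_iff_pow_eq_one.2 ⟨n, hn, h⟩)).to_subtype
  obtain ⟨p, hp, hall⟩ := exists_fixed_of_finite (Subgroup.zpowers A)
  exact ⟨p, hp, hall A (Subgroup.mem_zpowers A)⟩

theorem not_isKRational_of_det {A : SU} {p : Fin 3 → ℂ} {hp : (herm p p).re < 0} {c : ℂ}
    (h : mC A.m *ᵥ p = c • p) (h1 : ∀ v : V3, A.m *ᵥ v = v → 0 ≤ (hO v v).re)
    (h2 : det3 (A.m + 1) ≠ 0) : ¬ IsKRational (pt p hp) := by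
  intro hr
  obtain ⟨v, y, k, hk, hy, hv⟩ := exists_primitive_of_isKRational hr
  have hAv : mC A.m *ᵥ vC v = c • vC v := by
    rw [hv, mulVec_smul, h, smul_comm]
  have hneg : (hO v v).re < 0 := by
    have h3 : (herm (vC v) (vC v)).re < 0 := by
      rw [hv, herm_smul_self]
      exact mul_neg_of_pos_of_neg (Complex.normSq_pos.2 hk) hp
    rw [O.star_eq_self (star_hO v v), herm_vC_self_re (O.star_eq_self (star_hO v v))] at *
    exact_mod_cast h3
  rcases mulVec_eq_or_eq_neg hy hy hAv with h3 | h3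
  · exact absurd (h1 v h3) (by omega)
  · rw [det3_eq] at h2
    refine h2 (exists_mulVec_eq_zero_iff.1 ⟨v, ?_, ?_⟩)
    · rintro rfl
      rw [← star_hO, hO_zero_left, star_zero] at hy
      exact zero_ne_one hy
    · rw [add_mulVec, one_mulVec, h3, neg_add_cancel]

theorem elt_eight_pow_four : elt 8 ^ 4 = elt 5 := SU.ext (by decide +kernel)

theorem elt_eight_pow_six : elt 8 ^ 6 = 1 := SU.ext (by decide +kernel)

theorem elt_nine_pow_seven : elt 9 ^ 7 = 1 := SU.ext (by decide +kernel)

theorem not_isKRational_five {p : Fin 3 → ℂ} {hp : (herm p p).re < 0} {c : ℂ}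
    (h : mC (elt 5).m *ᵥ p = c • p) : ¬ IsKRational (pt p hp) := by
  refine not_isKRational_of_det h (fun v hv => ?_) (by decide +kernel)
  rw [elt_m] at hv
  have e0 := congrFun hv 0
  have e2 := congrFun hv 2
  simp only [eltM, mulVec, dotProduct, Fin.sum_univ_three] at e0 e2
  have h30 : (3 : O) ≠ 0 := by decide +kernel
  have f1 : (⟨-3, 6⟩ : O) = 3 * ⟨-1, 2⟩ := by decide +kernel
  have f2 : (⟨-1, 2⟩ : O) * ⟨-1, 2⟩ = -7 := by decide +kernel
  simp at e0 e2
  rw [f1] at e0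
  have hv2 : v 2 = 0 := by
    refine (mul_eq_zero.1 (?_ : (3 : O) * v 2 = 0)).resolve_left h30
    linear_combination -(⟨-1, 2⟩ * e0) - 6 * e2 + 3 * v 2 * f2
  have hv0 : v 0 = 0 := by
    rw [hv2] at e0
    refine (mul_eq_zero.1 (?_ : (6 : O) * v 0 = 0)).resolve_left (by decide +kernel)
    linear_combination -e0
  rw [hO_eq, hv0, hv2]
  have := O.norm_nonneg (v 1)
  simp only [mul_zero]
  rw [zero_add, add_zero, mul_comm, O.mul_star]
  simpa using this

theorem not_isKRational_nine {p : Fin 3 → ℂ} {hp : (herm p p).re < 0} {c : ℂ}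
    (h : mC (elt 9).m *ᵥ p = c • p) : ¬ IsKRational (pt p hp) := by
  refine not_isKRational_of_det h (fun v hv => ?_) (by decide +kernel)
  have : v = 0 := by
    by_contra h0
    have h1 : det3 ((elt 9).m - 1) = 0 := by
      rw [det3_eq]
      exact exists_mulVec_eq_zero_iff.1 ⟨v, h0, by rw [sub_mulVec, one_mulVec, hv, sub_self]⟩
    revert h1; decide +kernel
  rw [this, hO_zero_left]; rfl

theorem not_parallel_nine {x : V3} (hx0 : x ≠ 0) {j : ℤ} (hj : j = 1 ∨ j = 2) (hxj : hO x x = j)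
    (h : ∀ i k, x i * ((elt 9).m *ᵥ x) k = x k * ((elt 9).m *ᵥ x) i) : False := by
  set m := hO ((elt 9).m *ᵥ x) x with hm
  have h1 : (j : O) • ((elt 9).m *ᵥ x) = m • x := by
    funext k
    rw [Pi.smul_apply, Pi.smul_apply, smul_eq_mul, smul_eq_mul, ← hxj, hm, hO_eq, hO_eq]
    linear_combination star (x 0) * h 2 k + star (x 1) * h 1 k + star (x 2) * h 0 k
  have h2 : m.norm = j * j := by
    have h3 := congrArg (fun y => hO y y) h1
    simp only [hO_smul_left, hO_smul_right, star_intCast, hO_mulVec, hxj] at h3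
    have hj0 : (j : O) ≠ 0 := by
      rw [Int.cast_ne_zero]; omega
    have h4 : m * star m = j * j := mul_right_cancel₀ hj0 (by linear_combination -h3)
    rw [O.mul_star] at h4
    exact_mod_cast h4
  have hCH := congrArg (fun M => (j : O) ^ 3 • (M *ᵥ x)) (elt 9).cayley_hamilton
  have e1 := SU.pow_mulVec_eq h1 1
  have e2 := SU.pow_mulVec_eq h1 2
  have e3 := SU.pow_mulVec_eq h1 3
  simp only [SU.m_pow, pow_one] at e1 e2 e3
  have h5 : (m ^ 3 - (elt 9).m.trace * (m ^ 2 * j) + star (elt 9).m.trace * (m * j ^ 2) - j ^ 3) • x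
      = 0 := by
    simp only [sub_mulVec, add_mulVec, smul_mulVec, one_mulVec, zero_mulVec, smul_zero] at hCH
    funext i
    have c0 := congrFun hCH i
    have c1 := congrFun e1 i
    have c2 := congrFun e2 i
    have c3 := congrFun e3 i
    simp only [Pi.smul_apply, Pi.sub_apply, Pi.add_apply, Pi.zero_apply, smul_eq_mul] at c0 c1 c2 c3 ⊢
    linear_combination c0 - c3 + (elt 9).m.trace * j * c2 - star (elt 9).m.trace * j ^ 2 * c1
  have h6 := (smul_eq_zero.1 h5).resolve_right hx0
  rw [trace_elt] at h6
  obtain ⟨b1, b2⟩ := O.bounds_of_norm_le_four (z := m) (by rcases hj with rfl | rfl <;> omega)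
  have key : ∀ j ∈ ({1, 2} : Finset ℤ), ∀ a ∈ Finset.Icc (-2 : ℤ) 2, ∀ b ∈ Finset.Icc (-1 : ℤ) 1,
      (⟨a, b⟩ : O).norm = j * j → (⟨a, b⟩ : O) ^ 3 - ⟨0, -1⟩ * ((⟨a, b⟩ : O) ^ 2 * j) +
        star ⟨0, -1⟩ * (⟨a, b⟩ * (j : O) ^ 2) - (j : O) ^ 3 ≠ 0 := by decide +kernel
  exact key j (by simpa using hj) _ b1 _ b2 h2 h6

/-- The isolated fixed point of the elements of order three and six with one `1`-line. -/
theorem isCorrect_five_eight : ∃ q, (table 5).IsCorrect q ∧ (table 8).IsCorrect q := by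
  obtain ⟨p, hp, c, hc⟩ := exists_fixed_of_pow_eq_one (by norm_num) elt_eight_pow_six
  have hc5 := SU.mulVec_pow_eigen hc 4
  rw [elt_eight_pow_four] at hc5
  have hr : ¬ IsKRational (pt p hp) := not_isKRational_five hc5
  have hcard : Nat.card (MulAction.stabilizer PicardGroup (pt p hp)) = 6 := by
    have h1 := card_stabilizer_mem hr
    have h2 := orderOf_dvd_card_stabilizer (hp := hp) hc
    rw [orderOf_elt hp hc] at h2
    revert h1 h2
    generalize Nat.card _ = k
    change k ∈ _ → 6 ∣ k → _
    revert k
    decide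
  have hp1 : herm p (vC ![0, 1, 0]) = 0 := by
    have h1 := herm_mulVec (elt 5) p (vC ![0, 1, 0])
    rw [hc5, mC_mulVec, show (elt 5).m *ᵥ ![0, 1, 0] = ![0, 1, 0] by decide +kernel,
      herm_smul_left] at h1
    by_contra h0
    have h2 := mul_right_cancel₀ h0 (h1.trans (one_mul _).symm)
    exact elt_ne_one 5 (eq_one_of_not_isKRational hr (h2 ▸ hc5))
  have hline : ∀ j : ℕ, ∀ L ∈ jLinesThrough j (pt p hp), j = 1 ∧ L = polarLine (vC ![0, 1, 0]) := by
    rintro j L ⟨⟨y, hy, hyj, rfl⟩, hmem⟩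
    obtain ⟨x, rfl⟩ := hy.exists_eq_vC
    rw [pt_mem_polarLine] at hmem
    have h0 : x 0 = 0 := by simpa using mul_eq_mul_of_orthogonal hr hmem hp1 0 1
    have h2 : x 2 = 0 := by simpa using mul_eq_mul_of_orthogonal hr hmem hp1 2 1
    have hu : IsUnit (x 1) := isPrimitive_vC.1 hy (x 1) fun i => by
      fin_cases i
      · exact ⟨0, by simpa using h0⟩
      · exact dvd_rfl
      · exact ⟨0, by simpa using h2⟩
    have hx : x = x 1 • ![0, 1, 0] := by
      funext i; fin_cases i <;> simp [h0, h2]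
    rw [hx] at hyj ⊢
    rcases O.isUnit_iff.1 hu with h3 | h3
    · rw [h3, one_smul] at hyj ⊢
      rw [herm_vC, show hO ![0, 1, 0] ![0, 1, 0] = 1 by decide +kernel, map_one] at hyj
      exact ⟨by exact_mod_cast hyj.symm, rfl⟩
    · rw [h3, neg_smul, one_smul] at hyj ⊢
      rw [herm_vC, show hO (-![0, 1, 0]) (-![0, 1, 0]) = 1 by decide +kernel, map_one] at hyj
      exact ⟨by exact_mod_cast hyj.symm, polarLine_vC_neg _⟩
  have h1 : (jLinesThrough 1 (pt p hp)).encard = 1 := by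
    rw [Set.encard_eq_one]
    refine ⟨polarLine (vC ![0, 1, 0]), Set.eq_singleton_iff_unique_mem.2
      ⟨⟨⟨vC ![0, 1, 0], isPrimitive_of_hO_eq_one (z := ![0, 1, 0]) (by decide +kernel), ?_, rfl⟩,
        (pt_mem_polarLine (hv := hp)).2 hp1⟩, fun L hL => (hline 1 L hL).2⟩⟩
    rw [herm_vC, show hO ![0, 1, 0] ![0, 1, 0] = 1 by decide +kernel]; simp
  have h2 : (jLinesThrough 2 (pt p hp)).encard = 0 := by
    rw [Set.encard_eq_zero]
    exact Set.eq_empty_of_forall_notMem fun L hL => absurd (hline 2 L hL).1 (by norm_num)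
  refine ⟨pt p hp, isCorrect_of hp hc5 (.inl (by rw [trace_elt]; decide +kernel)) ?_ hcard ?_ ?_,
    isCorrect_of hp hc (.inl (by rw [trace_elt]; decide +kernel)) ?_ hcard ?_ ?_⟩
  · rw [table_fixedVec_none (by decide)]; exact hr
  · rw [h1, table_lines₁]; rfl
  · rw [h2, table_lines₂]; rfl
  · rw [table_fixedVec_none (by decide)]; exact hr
  · rw [h1, table_lines₁]; rfl
  · rw [h2, table_lines₂]; rfl

theorem isCorrect_nine : ∃ q, (table 9).IsCorrect q := by
  obtain ⟨p, hp, c, hc⟩ := exists_fixed_of_pow_eq_one (by norm_num) elt_nine_pow_seven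
  have hr : ¬ IsKRational (pt p hp) := not_isKRational_nine hc
  have hcard : Nat.card (MulAction.stabilizer PicardGroup (pt p hp)) = 7 := by
    have h1 := card_stabilizer_mem hr
    have h2 := orderOf_dvd_card_stabilizer (hp := hp) hc
    rw [orderOf_elt hp hc] at h2
    revert h1 h2
    generalize Nat.card _ = k
    change k ∈ _ → 7 ∣ k → _
    revert k
    decide
  have hline : ∀ j : ℕ, j = 1 ∨ j = 2 → (jLinesThrough j (pt p hp)).encard = 0 := by
    intro j hj
    rw [Set.encard_eq_zero]
    refine Set.eq_empty_of_forall_notMem ?_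
    rintro L ⟨⟨y, hy, hyj, rfl⟩, hmem⟩
    obtain ⟨x, rfl⟩ := hy.exists_eq_vC
    rw [pt_mem_polarLine] at hmem
    have hxj : hO x x = (j : ℤ) := toC_injective (by rw [← herm_vC, hyj]; simp)
    have hmem' : herm p (vC ((elt 9).m *ᵥ x)) = 0 := by
      have h1 := herm_mulVec (elt 9) p (vC x)
      rw [hc, mC_mulVec, herm_smul_left, hmem] at h1
      refine (mul_eq_zero.1 h1).resolve_left fun h0 => ?_
      have := SU.normSq_eigenvalue hp.ne hc
      rw [h0] at this
      simp at this
    have hx0 : x ≠ 0 := by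
      rintro rfl
      rw [hO_zero_left] at hxj
      have : (j : ℤ) = 0 := by exact_mod_cast hxj.symm
      omega
    have hprop := mul_eq_mul_of_orthogonal hr hmem hmem'
    exact not_parallel_nine hx0 (by omega) hxj hprop
  refine ⟨pt p hp, isCorrect_of hp hc (.inl (by rw [trace_elt]; decide +kernel)) ?_ hcard ?_ ?_⟩
  · rw [table_fixedVec_none (by decide)]; exact hr
  · rw [hline 1 (.inl rfl), table_lines₁]; rfl
  · rw [hline 2 (.inr rfl), table_lines₂]; rfl

theorem exists_isCorrect (i : Fin 10) : ∃ q, (table i).IsCorrect q := by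
  by_cases hi : i ∈ rationalRows
  · exact ⟨_, isCorrect_rational hi⟩
  · have : i = 5 ∨ i = 8 ∨ i = 9 := by revert i; decide
    rcases this with rfl | rfl | rfl
    · exact isCorrect_five_eight.imp fun _ h => h.1
    · exact isCorrect_five_eight.imp fun _ h => h.2
    · exact isCorrect_nine

/-! ### Complex reflections -/

theorem fixedSet_R : fixedSet R = polarLine ![0, 1, 0] := by
  rw [← phi_RS]
  refine fixedSet_eq_polarLine (N := 1) (by simp [herm_eq]) (fun y => ?_) one_ne_zero
  funext i
  fin_cases i <;>
    simp [RS, mC_apply, mulVec, dotProduct, Fin.sum_univ_three, herm_eq]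
  ring

theorem fixedSet_I : fixedSet I = polarLine ![1, 0, 1] := by
  rw [← phi_IS]
  refine fixedSet_eq_polarLine (N := 2) (by simp [herm_eq]) (fun y => ?_) two_ne_zero
  funext i
  fin_cases i <;>
    simp [IS, mC_apply, mulVec, dotProduct, Fin.sum_univ_three, herm_eq] <;> ring

theorem orderOf_R : orderOf R = 2 := by
  rw [← phi_RS, phi.orderOf_eq]
  exact orderOf_eq_prime (SU.ext (by decide +kernel))
    fun h => absurd (congrArg SU.m h) (by decide +kernel)

theorem orderOf_I : orderOf I = 2 := by
  rw [← phi_IS, phi.orderOf_eq]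
  exact orderOf_eq_prime (SU.ext (by decide +kernel))
    fun h => absurd (congrArg SU.m h) (by decide +kernel)

theorem isComplexReflection_R : IsComplexReflection R := by
  refine ⟨fun h => ?_, ![0, 1, 0], by simp [herm_eq], fixedSet_R.ge⟩
  have := orderOf_R
  rw [h, orderOf_one] at this
  norm_num at this

theorem isComplexReflection_I : IsComplexReflection I := by
  refine ⟨fun h => ?_, ![1, 0, 1], by simp [herm_eq], fixedSet_I.ge⟩
  have := orderOf_I
  rw [h, orderOf_one] at this
  norm_num at this

theorem isPrimitive_zero_one_zero : IsPrimitive ![0, 1, 0] := by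
  have : (![0, 1, 0] : Fin 3 → ℂ) = vC ![0, 1, 0] := by
    funext i; fin_cases i <;> simp [vC]
  rw [this]
  exact isPrimitive_of_hO_eq_one (z := ![0, 1, 0]) (by decide +kernel)

theorem isPrimitive_one_zero_one : IsPrimitive ![1, 0, 1] := by
  have : (![1, 0, 1] : Fin 3 → ℂ) = vC ![1, 0, 1] := by
    funext i; fin_cases i <;> simp [vC]
  rw [this]
  exact isPrimitive_of_hO_eq_one (z := ![1, 0, 0]) (by decide +kernel)

theorem not_isConj_R_I : ¬ IsConj R I := by
  rw [← phi_RS, ← phi_IS]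
  intro h
  obtain ⟨γ, hγ⟩ := isConj_iff.1 h
  obtain ⟨g, rfl⟩ := phi.surjective γ
  rw [← map_mul, ← map_inv, ← map_mul] at hγ
  have h1 : g * RS = IS * g := by rw [← phi.injective hγ]; group
  set y := g.m *ᵥ ![0, 1, 0] with hy
  have h2 : IS.m *ᵥ y = y := by
    rw [hy, mulVec_mulVec, ← SU.m_mul, ← h1, SU.m_mul, ← mulVec_mulVec]
    congr 1
    decide +kernel
  have h3 : hO y y = 1 := by rw [hy, hO_mulVec]; decide +kernel
  have e0 := congrFun h2 0
  have e1 := congrFun h2 1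
  simp [IS, mulVec, dotProduct, Fin.sum_univ_three] at e0 e1
  have e1' : y 1 = 0 := by
    refine (mul_eq_zero.1 (?_ : (2 : O) * y 1 = 0)).resolve_left (by decide +kernel)
    linear_combination -e1
  rw [hO_eq, e0, e1'] at h3
  have h4 : (2 : O) * ((y 0).norm : ℤ) = 1 := by
    rw [← O.mul_star]; linear_combination h3
  have h5 : 2 * (y 0).norm = 1 := by exact_mod_cast h4
  omega

theorem isConj_R_or_I {γ : PicardGroup} (h : IsComplexReflection γ) : IsConj γ R ∨ IsConj γ I := by
  obtain ⟨A, rfl⟩ := phi.surjective γ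
  obtain ⟨-, p, hp, hAp, ht⟩ := trace_of_isComplexReflection h
  rw [← phi_RS, ← phi_IS]
  exact (isConj_RS_or_IS hp hAp ht).imp (MonoidHom.map_isConj phi.toMonoidHom)
    (MonoidHom.map_isConj phi.toMonoidHom)

theorem fixedSet_conj (γ δ : PicardGroup) :
    fixedSet (δ * γ * δ⁻¹) = (fun q => δ • q) '' fixedSet γ := by
  ext q
  constructor
  · rintro ⟨hq, h⟩
    refine ⟨δ⁻¹ • q, ⟨smul_mem_H2 _ hq, ?_⟩, smul_inv_smul _ _⟩
    rw [eq_inv_smul_iff, ← mul_smul, ← mul_smul]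
    exact h
  · rintro ⟨x, ⟨hx, h⟩, rfl⟩
    refine ⟨smul_mem_H2 _ hx, ?_⟩
    dsimp only
    rw [← mul_smul, inv_mul_cancel_right, mul_smul, h]

/-- The fixed points of an element that fixes a complex line are not isolated. -/
theorem not_isIsolatedFixedPoint_of_eq_polarLine {A : SU} {v : Fin 3 → ℂ}
    (h : fixedSet (phi A) = polarLine v) (q : P2) : ¬ IsIsolatedFixedPoint (phi A) q := by
  intro hiso
  have hq := hiso.1
  rw [h] at hq
  obtain ⟨p, hp, rfl⟩ := exists_eq_pt hq.1
  have hpv := (pt_mem_polarLine (hv := hp)).1 hq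
  obtain ⟨u, hu0, hup, huv⟩ := exists_herm_eq_zero p v
  obtain ⟨δ, hδ, hneg⟩ := exists_neg_add_smul hp u
  have hδ' : (δ : ℂ) ≠ 0 := by exact_mod_cast hδ
  obtain ⟨c, hc⟩ := (phi_smul_pt_eq_iff A hp).1 hiso.1.2
  obtain ⟨d, hd⟩ := (phi_smul_pt_eq_iff A hneg).1 (h.ge (pt_mem_polarLine (hv := hneg).2 (by
    rw [herm_add_left, herm_smul_left, hpv, huv]; ring))).2
  have hcd : d = c := by
    have h1 := herm_mulVec A (p + (δ : ℂ) • u) p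
    rw [hc, hd, herm_smul_left, herm_smul_right, ← mul_assoc] at h1
    have h2 : d * star c = 1 :=
      mul_right_cancel₀ (herm_ne_zero_of_neg hp hneg) (by rw [h1, one_mul])
    have h3 : c * star c = 1 := by
      rw [Complex.star_def, Complex.mul_conj, SU.normSq_eigenvalue hp.ne hc]; simp
    exact mul_right_cancel₀ (right_ne_zero_of_mul_eq_one h3) (by rw [h2, h3])
  have hu : mC A.m *ᵥ u = c • u := by
    rw [hcd, mulVec_add, mulVec_smul, hc, smul_add, add_right_inj, smul_comm] at hd
    exact smul_right_injective _ hδ' hd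
  refine not_isIsolatedFixedPoint hp hc hu ?_ hiso
  rintro a rfl
  rw [herm_smul_left] at hup
  have ha := (mul_eq_zero.1 hup).resolve_right (fun h0 => by rw [h0] at hp; simp at hp)
  exact hu0 (by rw [ha, zero_smul])

theorem not_isIsolatedFixedPoint_of_isConj {A : SU} (h : IsConj A RS ∨ IsConj A IS) (q : P2) :
    ¬ IsIsolatedFixedPoint (phi A) q := by
  have key : ∀ B v, fixedSet (phi B) = polarLine v → IsConj A B →
      ∃ v, fixedSet (phi A) = polarLine v := by
    intro B v hB hAB
    obtain ⟨g, hg⟩ := isConj_iff.1 hAB.symm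
    refine ⟨mC g.m *ᵥ v, ?_⟩
    rw [← hg, map_mul, map_mul, map_inv, fixedSet_conj, hB, phi_image_polarLine]
  obtain ⟨v, hv⟩ : ∃ v, fixedSet (phi A) = polarLine v := by
    rcases h with h | h
    · exact key RS _ (by rw [phi_RS]; exact fixedSet_R) h
    · exact key IS _ (by rw [phi_IS]; exact fixedSet_I) h
  exact not_isIsolatedFixedPoint_of_eq_polarLine hv q

/-! ### Elements with an isolated fixed point -/

theorem mem_map_conj {G : Type*} [Group G] {H : Subgroup G} {g x : G} :
    x ∈ H.map (MulAut.conj g).toMonoidHom ↔ g⁻¹ * x * g ∈ H := by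
  constructor
  · rintro ⟨y, hy, rfl⟩
    simpa [mul_assoc] using hy
  · exact fun h => ⟨_, h, by simp [mul_assoc]⟩

theorem ConjSubgroups.symm {H H' : Subgroup PicardGroup} (h : ConjSubgroups H H') :
    ConjSubgroups H' H := by
  obtain ⟨g, rfl⟩ := h
  refine ⟨g⁻¹, ?_⟩
  ext x
  rw [mem_map_conj, mem_map_conj]
  simp only [inv_inv, mul_assoc, inv_mul_cancel, inv_mul_cancel_left, mul_one]

theorem ConjSubgroups.trans {H H' H'' : Subgroup PicardGroup} (h : ConjSubgroups H H')
    (h' : ConjSubgroups H' H'') : ConjSubgroups H H'' := by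
  obtain ⟨g, rfl⟩ := h
  obtain ⟨g', rfl⟩ := h'
  refine ⟨g' * g, ?_⟩
  ext x
  rw [mem_map_conj, mem_map_conj, mem_map_conj, _root_.mul_inv_rev]
  simp only [mul_assoc]

theorem conjSubgroups_zpowers {A B C : SU} (h : Subgroup.zpowers B = Subgroup.zpowers A)
    (hBC : IsConj B C) : ConjSubgroups (Subgroup.zpowers (phi A)) (Subgroup.zpowers (phi C)) := by
  obtain ⟨g, rfl⟩ := isConj_iff.1 hBC
  refine ⟨phi g, ?_⟩
  have h1 : ∀ D : SU, Subgroup.zpowers (phi D) = (Subgroup.zpowers D).map phi.toMonoidHom :=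
    fun D => (MonoidHom.map_zpowers phi.toMonoidHom D).symm
  rw [h1 A, ← h, ← h1 B, MonoidHom.map_zpowers]
  congr 1
  simp

/-- An element with an isolated fixed point is not trivial and the eigenvalue is simple. -/
theorem trace_of_isIsolatedFixedPoint {A : SU} {p : Fin 3 → ℂ} {c : ℂ} {hp : (herm p p).re < 0}
    (h : IsIsolatedFixedPoint (phi A) (pt p hp)) (hc : mC A.m *ᵥ p = c • p) :
    A ≠ 1 ∧ (A.m.trace ≠ -1 ∨ c ≠ -1) := by
  constructor
  · rintro rfl
    obtain ⟨u, hu0, hup, -⟩ := exists_herm_eq_zero p p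
    refine not_isIsolatedFixedPoint (q := u) (c := 1) hp ?_ ?_ ?_ h
    · rw [SU.m_one, map_one, one_mulVec, one_smul]
    · rw [SU.m_one, map_one, one_mulVec, one_smul]
    · rintro a rfl
      rw [herm_smul_left] at hup
      have ha := (mul_eq_zero.1 hup).resolve_right (fun h0 => by rw [h0] at hp; simp at hp)
      exact hu0 (by rw [ha, zero_smul])
  · by_contra! hcon
    obtain ⟨ht, rfl⟩ := hcon
    exact not_isIsolatedFixedPoint_of_isConj (isConj_RS_or_IS hp hc ht) _ h

theorem exists_conjSubgroups {γ : PicardGroup} (h : ∃ q, IsIsolatedFixedPoint γ q) :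
    ∃ i, ConjSubgroups (Subgroup.zpowers γ) (Subgroup.zpowers (table i).elt) := by
  obtain ⟨A, rfl⟩ := phi.surjective γ
  obtain ⟨q, hq⟩ := h
  obtain ⟨p, hp, rfl⟩ := exists_eq_pt hq.1.1
  obtain ⟨c, hc⟩ := (phi_smul_pt_eq_iff A hp).1 hq.1.2
  obtain ⟨hA, htc⟩ := trace_of_isIsolatedFixedPoint hq hc
  obtain ⟨i, B, hB, hBi⟩ := exists_isConj_elt hp hc hA htc
  exact ⟨i, by rw [table_elt]; exact conjSubgroups_zpowers hB hBi⟩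

/-! ### Invariants of the fixed points -/

theorem isPrimitive_mulVec (A : SU) {x : V3} (h : IsPrimitive (vC x)) :
    IsPrimitive (vC (A.m *ᵥ x)) := by
  rw [isPrimitive_vC] at h ⊢
  intro d hd
  refine h d fun i => ?_
  have hx : x = (A⁻¹).m *ᵥ (A.m *ᵥ x) := by rw [mulVec_mulVec, SU.m_inv_mul, one_mulVec]
  rw [hx]
  change d ∣ ∑ k, (A⁻¹).m i k * (A.m *ᵥ x) k
  exact Finset.dvd_sum fun k _ => (hd k).mul_left _

theorem image_mem_jLinesThrough (γ : PicardGroup) {j : ℕ} {q : P2} {L : Set P2}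
    (h : L ∈ jLinesThrough j q) : (fun x => γ • x) '' L ∈ jLinesThrough j (γ • q) := by
  obtain ⟨A, rfl⟩ := phi.surjective γ
  obtain ⟨⟨v, hv, hvj, rfl⟩, hq⟩ := h
  refine ⟨?_, Set.mem_image_of_mem _ hq⟩
  obtain ⟨x, rfl⟩ := hv.exists_eq_vC
  refine ⟨vC (A.m *ᵥ x), isPrimitive_mulVec A hv, ?_, ?_⟩
  · rw [← mC_mulVec, herm_mulVec, hvj]
  · rw [phi_image_polarLine, mC_mulVec]

theorem encard_jLinesThrough_smul (γ : PicardGroup) (j : ℕ) (q : P2) :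
    (jLinesThrough j (γ • q)).encard = (jLinesThrough j q).encard := by
  have key : ∀ (γ : PicardGroup) (q : P2),
      (jLinesThrough j q).encard ≤ (jLinesThrough j (γ • q)).encard := fun γ q =>
    Set.encard_le_encard_of_injOn (f := fun L => (fun x => γ • x) '' L)
      (fun L hL => image_mem_jLinesThrough γ hL)
      ((Set.image_injective.2 (MulAction.injective γ)).injOn)
  refine le_antisymm ?_ (key γ q)
  have := key γ⁻¹ (γ • q)
  rwa [inv_smul_smul] at this

section fixedPoints

variable {p : Fin 10 → P2}

theorem Row.IsCorrect.mem_fixedSet {r : Row} {q : P2} (h : r.IsCorrect q) : q ∈ fixedSet r.elt := by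
  rw [h.2.2.1]; rfl

theorem Row.IsCorrect.eq_of_mem {r : Row} {q q' : P2} (h : r.IsCorrect q) (h' : q' ∈ fixedSet r.elt) :
    q' = q := by
  rw [h.2.2.1] at h'; exact h'

theorem Row.IsCorrect.elt_mem {r : Row} {q : P2} (h : r.IsCorrect q) :
    r.elt ∈ MulAction.stabilizer PicardGroup q := h.mem_fixedSet.2

theorem eq_pt_of_isCorrect {i : Fin 10} (hi : i ∈ rationalRows) {q : P2}
    (h : (table i).IsCorrect q) : q = pt (vC (rowV i)) (isShortFrame_row i hi).neg :=
  (isCorrect_rational hi).eq_of_mem h.mem_fixedSet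

theorem stabilizer_smul_eq (g : PicardGroup) (q : P2) :
    (MulAction.stabilizer PicardGroup q).map (MulAut.conj g).toMonoidHom =
      MulAction.stabilizer PicardGroup (g • q) :=
  (MulAction.stabilizer_smul_eq_stabilizer_map_conj g q).symm

theorem card_stabilizer_smul (g : PicardGroup) (q : P2) :
    Nat.card (MulAction.stabilizer PicardGroup (g • q)) =
      Nat.card (MulAction.stabilizer PicardGroup q) := by
  rw [← stabilizer_smul_eq]
  exact (Nat.card_congr (Subgroup.equivMapOfInjective _ _ (MulAut.conj g).injective).toEquiv).symm

/-- A subgroup conjugate that carries an element with an isolated fixed point to one that fixes a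
point carries the fixed points to each other. -/
theorem smul_eq_of_map_le {i j : Fin 10} (hp : ∀ i, (table i).IsCorrect (p i)) {g : PicardGroup}
    {H : Subgroup PicardGroup} (hH : H ≤ MulAction.stabilizer PicardGroup (p i))
    (hj : (table j).elt ∈ H.map (MulAut.conj g).toMonoidHom) : g • p i = p j := by
  refine (hp j).eq_of_mem ⟨smul_mem_H2 _ (hp i).mem_fixedSet.1, ?_⟩
  have h1 := Subgroup.map_mono (f := (MulAut.conj g).toMonoidHom) hH hj
  rw [stabilizer_smul_eq] at h1
  exact h1

theorem not_smul_three_eq_four (hp : ∀ i, (table i).IsCorrect (p i)) (g : PicardGroup) :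
    g • p 3 ≠ p 4 := by
  intro h
  obtain ⟨A, rfl⟩ := phi.surjective g
  rw [eq_pt_of_isCorrect (by decide) (hp 3), eq_pt_of_isCorrect (by decide) (hp 4)] at h
  have h1 := ((isShortFrame_row 3 (by decide)).mem_transporters_iff (isShortFrame_row 4 (by decide))
    (rowP_le 3) (rowQ_le 3) A).2 h
  change A.m ∈ rowTransporters 3 4 at h1
  rw [rowTransporters_three_four] at h1
  exact absurd h1 (Finset.notMem_empty _)

theorem stabClass_eq_of_smul (hp : ∀ i, (table i).IsCorrect (p i)) {i j : Fin 10} {g : PicardGroup}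
    (h : g • p i = p j) : stabClass i = stabClass j := by
  have h1 : (table i).stabOrd = (table j).stabOrd := by
    obtain ⟨-, -, -, -, -, hi, -⟩ := hp i
    obtain ⟨-, -, -, -, -, hj, -⟩ := hp j
    rw [← hi, ← hj, ← h, card_stabilizer_smul]
  have h2 : (table i).lines₁ = (table j).lines₁ := by
    obtain ⟨-, -, -, -, -, -, hi, -⟩ := hp i
    obtain ⟨-, -, -, -, -, -, hj, -⟩ := hp j
    rw [← h, encard_jLinesThrough_smul, hi] at hj
    exact_mod_cast hj
  rw [table_stabOrd, table_stabOrd] at h1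
  rw [table_lines₁, table_lines₁] at h2
  have key : ∀ i j : Fin 10, (![8, 4, 8, 6, 6, 6, 8, 8, 6, 7] : Fin 10 → ℕ) i =
      (![8, 4, 8, 6, 6, 6, 8, 8, 6, 7] : Fin 10 → ℕ) j →
      (![2, 1, 0, 0, 0, 1, 2, 0, 1, 0] : Fin 10 → ℕ) i =
        (![2, 1, 0, 0, 0, 1, 2, 0, 1, 0] : Fin 10 → ℕ) j →
      stabClass i = stabClass j ∨ (i = 3 ∧ j = 4) ∨ (i = 4 ∧ j = 3) := by decide
  rcases key i j h1 h2 with h3 | ⟨rfl, rfl⟩ | ⟨rfl, rfl⟩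
  · exact h3
  · exact absurd h (not_smul_three_eq_four hp g)
  · exact absurd (inv_smul_eq_iff.2 h.symm) (not_smul_three_eq_four hp g⁻¹)

theorem exists_smul_eq_of_transporters {i j : Fin 10} (hp : ∀ i, (table i).IsCorrect (p i))
    (hi : i ∈ rationalRows) (hj : j ∈ rationalRows) (h : (rowTransporters i j).Nonempty) :
    ∃ g : PicardGroup, g • p i = p j := by
  obtain ⟨M, hM⟩ := h
  have hfi := isShortFrame_row i hi
  have hfj := isShortFrame_row j hj
  obtain ⟨A, rfl, -⟩ := (hfi.mem_transporters hfj (rowP_le i) (rowQ_le i) M).1 hM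
  refine ⟨phi A, ?_⟩
  rw [eq_pt_of_isCorrect hi (hp i), eq_pt_of_isCorrect hj (hp j)]
  exact (hfi.mem_transporters_iff hfj (rowP_le i) (rowQ_le i) A).1 hM

theorem five_eq_eight (hp : ∀ i, (table i).IsCorrect (p i)) : p 5 = p 8 := by
  obtain ⟨q, h5, h8⟩ := isCorrect_five_eight
  rw [h5.eq_of_mem (hp 5).mem_fixedSet, h8.eq_of_mem (hp 8).mem_fixedSet]

theorem exists_smul_eq_of_stabClass (hp : ∀ i, (table i).IsCorrect (p i)) {i j : Fin 10}
    (h : stabClass i = stabClass j) : ∃ g : PicardGroup, g • p i = p j := by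
  have key : ∀ i j : Fin 10, stabClass i = stabClass j → i = j ∨ (i = 0 ∧ j = 6) ∨
      (i = 6 ∧ j = 0) ∨ (i = 2 ∧ j = 7) ∨ (i = 7 ∧ j = 2) ∨ (i = 5 ∧ j = 8) ∨ (i = 8 ∧ j = 5) := by
    decide
  have hsymm : ∀ {i j : Fin 10}, (∃ g : PicardGroup, g • p i = p j) →
      ∃ g : PicardGroup, g • p j = p i := fun ⟨g, hg⟩ => ⟨g⁻¹, inv_smul_eq_iff.2 hg.symm⟩
  have h06 := exists_smul_eq_of_transporters hp (by decide) (by decide) rowTransporters_zero_six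
  have h27 := exists_smul_eq_of_transporters hp (by decide) (by decide) rowTransporters_two_seven
  have h58 : ∃ g : PicardGroup, g • p 5 = p 8 := ⟨1, by rw [one_smul, five_eq_eight hp]⟩
  rcases key i j h with rfl | ⟨rfl, rfl⟩ | ⟨rfl, rfl⟩ | ⟨rfl, rfl⟩ | ⟨rfl, rfl⟩ | ⟨rfl, rfl⟩ | ⟨rfl, rfl⟩
  · exact ⟨1, one_smul _ _⟩
  · exact h06
  · exact hsymm h06
  · exact h27
  · exact hsymm h27
  · exact h58
  · exact hsymm h58

theorem conjSubgroups_stabilizer_iff (hp : ∀ i, (table i).IsCorrect (p i)) (i j : Fin 10) :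
    ConjSubgroups (MulAction.stabilizer PicardGroup (p i))
      (MulAction.stabilizer PicardGroup (p j)) ↔ stabClass i = stabClass j := by
  constructor
  · rintro ⟨g, hg⟩
    exact stabClass_eq_of_smul hp (smul_eq_of_map_le hp le_rfl (hg ▸ (hp j).elt_mem))
  · intro h
    obtain ⟨g, hg⟩ := exists_smul_eq_of_stabClass hp h
    exact ⟨g, by rw [stabilizer_smul_eq, hg]⟩

theorem eq_of_conjSubgroups_zpowers (hp : ∀ i, (table i).IsCorrect (p i)) {i j : Fin 10}
    (h : ConjSubgroups (Subgroup.zpowers (table i).elt) (Subgroup.zpowers (table j).elt)) :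
    i = j := by
  obtain ⟨g, hg⟩ := h
  have h1 : (table i).ord = (table j).ord := by
    obtain ⟨-, hi, -⟩ := hp i
    obtain ⟨-, hj, -⟩ := hp j
    rw [← hi, ← hj, ← Nat.card_zpowers, ← Nat.card_zpowers, ← hg]
    exact Nat.card_congr (Subgroup.equivMapOfInjective _ _ (MulAut.conj g).injective).toEquiv
  have h2 : stabClass i = stabClass j := by
    refine stabClass_eq_of_smul hp (g := g) (smul_eq_of_map_le hp (H := Subgroup.zpowers _) ?_
      (hg ▸ Subgroup.mem_zpowers _))
    rw [Subgroup.zpowers_le]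
    exact (hp i).elt_mem
  rw [table_ord, table_ord] at h1
  clear hg
  revert i j
  decide

theorem existsUnique_conjSubgroups (hp : ∀ i, (table i).IsCorrect (p i)) {γ : PicardGroup}
    (h : ∃ q, IsIsolatedFixedPoint γ q) :
    ∃! i, ConjSubgroups (Subgroup.zpowers γ) (Subgroup.zpowers (table i).elt) := by
  obtain ⟨i, hi⟩ := exists_conjSubgroups h
  exact ⟨i, hi, fun j hj => eq_of_conjSubgroups_zpowers hp (hj.symm.trans hi)⟩

/-! ### Maximal finite subgroups -/

theorem exists_le_stabilizer (H : Subgroup PicardGroup) [Finite H] :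
    ∃ q ∈ H2, H ≤ MulAction.stabilizer PicardGroup q := by
  have : Finite (H.map phi.symm.toMonoidHom) :=
    Finite.of_equiv _ (Subgroup.equivMapOfInjective H phi.symm.toMonoidHom phi.symm.injective).toEquiv
  obtain ⟨q, hq, hall⟩ := exists_fixed_of_finite (H.map phi.symm.toMonoidHom)
  refine ⟨pt q hq, pt_mem_H2 hq, fun γ hγ => ?_⟩
  obtain ⟨A, rfl⟩ := phi.surjective γ
  exact (phi_smul_pt_eq_iff A hq).2 (hall A ⟨phi A, hγ, by simp⟩)

theorem finite_stabilizer_of_isCorrect (hp : ∀ i, (table i).IsCorrect (p i)) (i : Fin 10) :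
    Finite (MulAction.stabilizer PicardGroup (p i)) := by
  obtain ⟨-, -, -, -, -, hi, -⟩ := hp i
  refine Nat.finite_of_card_ne_zero ?_
  rw [hi, table_stabOrd]
  clear hi
  revert i
  decide

theorem isMaximalFinite_stabilizer (hp : ∀ i, (table i).IsCorrect (p i)) (i : Fin 10) :
    IsMaximalFinite (MulAction.stabilizer PicardGroup (p i)) := by
  refine ⟨finite_stabilizer_of_isCorrect hp i, fun H hH hle => ?_⟩
  have : Finite H := hH
  obtain ⟨q, hq, hHq⟩ := exists_le_stabilizer H
  have : q = p i := (hp i).eq_of_mem ⟨hq, hHq (hle (hp i).elt_mem)⟩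
  exact this ▸ hHq

/-- A maximal finite subgroup that is conjugate to a subgroup of a stabilizer of the table is
conjugate to that stabilizer. -/
theorem IsMaximalFinite.conjSubgroups {H : Subgroup PicardGroup} (h : IsMaximalFinite H)
    (hp : ∀ i, (table i).IsCorrect (p i)) {i : Fin 10} {g : PicardGroup}
    (hg : ∀ γ ∈ H, g * γ * g⁻¹ ∈ MulAction.stabilizer PicardGroup (p i)) :
    ConjSubgroups H (MulAction.stabilizer PicardGroup (p i)) := by
  have := finite_stabilizer_of_isCorrect hp i
  have hfin : Finite ((MulAction.stabilizer PicardGroup (p i)).map (MulAut.conj g⁻¹).toMonoidHom) :=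
    Finite.of_equiv _ (Subgroup.equivMapOfInjective _ _ (MulAut.conj g⁻¹).injective).toEquiv
  have hle : H ≤ (MulAction.stabilizer PicardGroup (p i)).map (MulAut.conj g⁻¹).toMonoidHom := by
    intro γ hγ
    rw [mem_map_conj, inv_inv]
    exact hg γ hγ
  have heq := le_antisymm hle (h.2 hfin hle)
  exact ConjSubgroups.symm ⟨g⁻¹, heq.symm⟩

theorem RS_mem_stabilizer (hp : ∀ i, (table i).IsCorrect (p i)) :
    phi RS ∈ MulAction.stabilizer PicardGroup (p 1) := by
  rw [eq_pt_of_isCorrect (by decide) (hp 1)]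
  exact (phi_smul_pt_eq_iff RS _).2 ⟨-1, by
    rw [mC_mulVec, show RS.m *ᵥ rowV 1 = -rowV 1 by decide +kernel, vC_neg, neg_smul, one_smul]⟩

theorem IS_mem_stabilizer (hp : ∀ i, (table i).IsCorrect (p i)) :
    phi IS ∈ MulAction.stabilizer PicardGroup (p 1) := by
  rw [eq_pt_of_isCorrect (by decide) (hp 1)]
  exact (phi_smul_pt_eq_iff IS _).2 ⟨-1, by
    rw [mC_mulVec, show IS.m *ᵥ rowV 1 = -rowV 1 by decide +kernel, vC_neg, neg_smul, one_smul]⟩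

theorem exists_conjSubgroups_stabilizer (hp : ∀ i, (table i).IsCorrect (p i))
    {H : Subgroup PicardGroup} (h : IsMaximalFinite H) :
    ∃ i, ConjSubgroups H (MulAction.stabilizer PicardGroup (p i)) := by
  have : Finite H := h.1
  obtain ⟨q, hq, hHq⟩ := exists_le_stabilizer H
  obtain ⟨x, hx, rfl⟩ := exists_eq_pt hq
  have heig : ∀ A : SU, phi A ∈ H → ∃ c : ℂ, mC A.m *ᵥ x = c • x := fun A hA =>
    (phi_smul_pt_eq_iff A hx).1 (hHq hA)
  by_cases hall : ∀ A : SU, phi A ∈ H → A ≠ 1 → A.m.trace = -1 ∧ mC A.m *ᵥ x = (-1 : ℂ) • x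
  · have hone : ∀ A B : SU, phi A ∈ H → phi B ∈ H → A ≠ 1 → B ≠ 1 → A = B := by
      intro A B hA hB hA1 hB1
      obtain ⟨-, h1⟩ := hall A hA hA1
      obtain ⟨-, h2⟩ := hall B hB hB1
      have hB2 : B ^ 2 = 1 := sq_eq_one_of_trace hx h2 (hall B hB hB1).1
      have hAB : A * B = 1 := by
        by_contra hne
        obtain ⟨-, h3⟩ := hall (A * B) (by rw [map_mul]; exact H.mul_mem hA hB) hne
        rw [SU.m_mul, map_mul, ← mulVec_mulVec, h2, mulVec_smul, h1, smul_smul] at h3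
        have h4 : (2 : ℂ) • x = 0 := by
          rw [← sub_eq_zero, ← sub_smul] at h3
          norm_num at h3
          simp [h3]
        exact smul_ne_zero two_ne_zero (ne_zero_of_neg hx) h4
      rw [pow_two] at hB2
      exact mul_right_cancel (hAB.trans hB2.symm)
    by_cases htriv : ∃ A : SU, phi A ∈ H ∧ A ≠ 1
    · obtain ⟨A, hA, hA1⟩ := htriv
      obtain ⟨ht, hAx⟩ := hall A hA hA1
      obtain ⟨g, hg⟩ : ∃ g : SU, phi (g * A * g⁻¹) ∈ MulAction.stabilizer PicardGroup (p 1) := by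
        rcases isConj_RS_or_IS hx hAx ht with hc | hc
        · obtain ⟨g, hg⟩ := isConj_iff.1 hc
          exact ⟨g, hg ▸ RS_mem_stabilizer hp⟩
        · obtain ⟨g, hg⟩ := isConj_iff.1 hc
          exact ⟨g, hg ▸ IS_mem_stabilizer hp⟩
      refine ⟨1, h.conjSubgroups hp (g := phi g) fun γ hγ => ?_⟩
      obtain ⟨B, rfl⟩ := phi.surjective γ
      by_cases hB : B = 1
      · rw [hB, map_one, mul_one, mul_inv_cancel]
        exact Subgroup.one_mem _
      · rw [hone B A hγ hA hB hA1, ← map_inv, ← map_mul, ← map_mul]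
        exact hg
    · refine ⟨0, h.conjSubgroups hp (g := 1) fun γ hγ => ?_⟩
      obtain ⟨B, rfl⟩ := phi.surjective γ
      have : B = 1 := by
        by_contra hB
        exact htriv ⟨B, hγ, hB⟩
      rw [this, map_one, mul_one, mul_inv_cancel]
      exact Subgroup.one_mem _
  · push Not at hall
    obtain ⟨A, hA, hA1, htA⟩ := hall
    obtain ⟨c, hc⟩ := heig A hA
    obtain ⟨i, B, hB, hBi⟩ := exists_isConj_elt hx hc hA1 (by
      by_contra! hcon
      exact htA hcon.1 (hcon.2 ▸ hc))
    obtain ⟨g, hg⟩ := conjSubgroups_zpowers hB hBi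
    have hmem : (table i).elt ∈ (Subgroup.zpowers (phi A)).map (MulAut.conj g).toMonoidHom := by
      rw [hg, table_elt]; exact Subgroup.mem_zpowers _
    have hgx : g • pt x hx = p i := by
      refine (hp i).eq_of_mem ⟨smul_mem_H2 _ hq, ?_⟩
      have h1 := Subgroup.map_mono (f := (MulAut.conj g).toMonoidHom)
        ((Subgroup.zpowers_le.2 hA).trans hHq) hmem
      rw [stabilizer_smul_eq] at h1
      exact h1
    refine ⟨i, h.conjSubgroups hp (g := g) fun γ hγ => ?_⟩
    rw [← hgx, MulAction.mem_stabilizer_iff, ← mul_smul, inv_mul_cancel_right, mul_smul,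
      MulAction.mem_stabilizer_iff.1 (hHq hγ)]

theorem exists_stabOrbit_seven (hp : ∀ i, (table i).IsCorrect (p i)) : ∃ L₁ L₂ : Set P2,
    jLinesThrough 2 (p 7) = stabOrbit (p 7) L₁ ∪ stabOrbit (p 7) L₂ ∧
    Disjoint (stabOrbit (p 7) L₁) (stabOrbit (p 7) L₂) ∧
    (stabOrbit (p 7) L₁).encard = 2 ∧ (stabOrbit (p 7) L₂).encard = 2 := by
  have hf := isShortFrame_row 7 (by decide)
  obtain ⟨h1, h2, h3⟩ := lineOrbit_seven
  have hinj := hf.injOn (j := 2) (.inr rfl)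
  refine ⟨polarLine (vC ![0, ⟨0, 1⟩, ⟨1, -1⟩]), polarLine (vC ![1, 0, 1]), ?_⟩
  rw [eq_pt_of_isCorrect (by decide) (hp 7), hf.jLinesThrough_eq (.inr rfl),
    hf.stabOrbit_eq (rowP_le 7) (rowQ_le 7), hf.stabOrbit_eq (rowP_le 7) (rowQ_le 7), h1, h2]
  rw [show ((2 : ℕ) : ℤ) = 2 by rfl]
  rw [h3] at hinj ⊢
  rw [Finset.coe_union] at hinj ⊢
  refine ⟨Set.image_union _ _ _, ?_, ?_, ?_⟩
  · rw [Set.disjoint_left]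
    rintro _ ⟨x, hx, rfl⟩ ⟨y, hy, hxy⟩
    rw [hinj (Set.mem_union_right _ hy) (Set.mem_union_left _ hx) hxy] at hy
    exact Finset.disjoint_left.1 (by decide +kernel : Disjoint (_ : Finset V3) _) hx hy
  · rw [(hinj.mono Set.subset_union_left).encard_image, Set.encard_coe_eq_coe_finsetCard]
    exact congrArg Nat.cast (by decide +kernel : Finset.card _ = 2)
  · rw [(hinj.mono Set.subset_union_right).encard_image, Set.encard_coe_eq_coe_finsetCard]
    exact congrArg Nat.cast (by decide +kernel : Finset.card _ = 2)

end fixedPoints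

end

end Picard7

theorem mainTheorem1 :
    -- complex reflections
    ((Picard7.IsComplexReflection Picard7.R ∧ orderOf Picard7.R = 2 ∧
        Picard7.fixedSet Picard7.R = Picard7.polarLine ![0, 1, 0] ∧
        Picard7.IsPrimitive ![0, 1, 0] ∧ Picard7.herm ![0, 1, 0] ![0, 1, 0] = 1) ∧
      (Picard7.IsComplexReflection Picard7.I ∧ orderOf Picard7.I = 2 ∧
        Picard7.fixedSet Picard7.I = Picard7.polarLine ![1, 0, 1] ∧
        Picard7.IsPrimitive ![1, 0, 1] ∧ Picard7.herm ![1, 0, 1] ![1, 0, 1] = 2) ∧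
      ¬ IsConj Picard7.R Picard7.I ∧
      ∀ γ : Picard7.PicardGroup, Picard7.IsComplexReflection γ →
        IsConj γ Picard7.R ∨ IsConj γ Picard7.I) ∧
    ∃ p : Fin 10 → Picard7.P2,
      -- the rows of the tables
      (∀ i, (Picard7.table i).IsCorrect (p i)) ∧
      -- the last row of order 4: the 2-lines through the fixed point form two orbits of size two
      (∃ L₁ L₂ : Set Picard7.P2,
        Picard7.jLinesThrough 2 (p 7) =
          Picard7.stabOrbit (p 7) L₁ ∪ Picard7.stabOrbit (p 7) L₂ ∧
        Disjoint (Picard7.stabOrbit (p 7) L₁) (Picard7.stabOrbit (p 7) L₂) ∧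
        (Picard7.stabOrbit (p 7) L₁).encard = 2 ∧ (Picard7.stabOrbit (p 7) L₂).encard = 2) ∧
      -- torsion elements with an isolated fixed point
      (∀ γ : Picard7.PicardGroup, IsOfFinOrder γ →
        (∃ q, Picard7.IsIsolatedFixedPoint γ q) →
        ∃! i : Fin 10, Picard7.ConjSubgroups (Subgroup.zpowers γ)
          (Subgroup.zpowers (Picard7.table i).elt)) ∧
      -- maximal finite subgroups
      (∀ i, Picard7.IsMaximalFinite (MulAction.stabilizer Picard7.PicardGroup (p i))) ∧
      (∀ H : Subgroup Picard7.PicardGroup, Picard7.IsMaximalFinite H →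
        ∃ i, Picard7.ConjSubgroups H (MulAction.stabilizer Picard7.PicardGroup (p i))) ∧
      (∀ i j, Picard7.ConjSubgroups (MulAction.stabilizer Picard7.PicardGroup (p i))
          (MulAction.stabilizer Picard7.PicardGroup (p j)) ↔
        Picard7.stabClass i = Picard7.stabClass j) := by
  choose p hp using Picard7.exists_isCorrect
  exact ⟨⟨⟨Picard7.isComplexReflection_R, Picard7.orderOf_R, Picard7.fixedSet_R,
      Picard7.isPrimitive_zero_one_zero, by simp [Picard7.herm_eq]⟩,
    ⟨Picard7.isComplexReflection_I, Picard7.orderOf_I, Picard7.fixedSet_I,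
      Picard7.isPrimitive_one_zero_one, by simp [Picard7.herm_eq]; norm_num⟩,
    Picard7.not_isConj_R_I, fun _ => Picard7.isConj_R_or_I⟩,
    p, hp, Picard7.exists_stabOrbit_seven hp,
    fun _ _ h => Picard7.existsUnique_conjSubgroups hp h,
    Picard7.isMaximalFinite_stabilizer hp,
    fun _ h => Picard7.exists_conjSubgroups_stabilizer hp h,
    Picard7.conjSubgroups_stabilizer_iff hp⟩
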